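/- **Setting.** Let $(N,g,J)$ be a connected Kähler manifold of real dimension $2n$ with Kähler form $\omega(u,v)=g(Ju,v)$, and let $\Phi:\mathbb{T}^n\times N\to N$ be a smooth action of the torus $\mathbb{T}^n=\mathbb{R}^n/\mathbb{Z}^n$, $\mathrm{Lie}(\mathbb{T}^n)=\mathbb{R}^n$. Write $\Phi_a=\Phi(a,\cdot)$, let $N^\circ=\{q\in N : \Phi(a,q)=q\Rightarrow a=e\}$ be the set of points where the action is free, and let $\xi_N(q)=\frac{d}{dt}\big|_0\Phi([t\xi],q)$ be the fundamental vector field of $\xi\in\mathbb{R}^n$. A *momentum map* is a smooth $\mathbb{T}^n$-invariant map $\mu:N\to\mathbb{R}^n$ with $\omega(\xi_N,\cdot)=d\langle\mu,\xi\rangle$ for all $\xi$. Assume that $\Phi$ is effective, holomorphic and Hamiltonian (each $\Phi_a$ preserves $\omega$ and a momentum map exists), and that for every $\xi\in\mathbb{R}^n$ the vector field $-J\xi_N$ is complete, with flow $\varphi^\xi:\mathbb{R}\times N\to N$. **Terminology.** A connection is *flat* if its torsion and curvature vanish. Given a Riemannian metric $h$ and a linear connection $\nabla$ on a manifold $M$,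 the *dual connection* $\nabla^*$ is the one with $Xh(Y,Z)=h(\nabla_XY,Z)+h(Y,\nabla^*_XZ)$ for all vector fields; $(M,h,\nabla)$ is *dually flat* if $\nabla$ and $\nabla^*$ are flat. An *isomorphism* $(M,h,\nabla)\to(M',h',\nabla')$ of dually flat spaces is a diffeomorphism that pulls back $h'$, $\nabla'$, $\nabla'^*$ to $h$, $\nabla$, $\nabla^*$. A *global pair of dual coordinate systems* is a pair $(x,y)$ of coordinate systems on all of $M$ such that $x$ is $\nabla$-affine ($\nabla_{\partial/\partial x_i}\partial/\partial x_j=0$ for all $i,j$), $y$ is $\nabla^*$-affine and $h(\partial/\partial x_i,\partial/\partial y_j)=\delta_{ij}$. On $TM$, with $T_u(TM)\cong T_xM\oplus T_xM$ via $A\mapsto(\pi_*A,KA)$, where $\pi:TM\to M$ is the projection and $K$ the connector of $\nabla$, put $g^{TM}((v,w),(\bar v,\bar w))=h(v,\bar v)+h(w,\bar w)$ and $J^{TM}(v,w)=(-w,v)$. The effective, holomorphic and isometric action $\Phi$ is a *torification* of $(M,h,\nabla)$, $\dim M=n$, if there are a global frame $X_1,\dots,X_n$ of $\nabla$-parallel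 vector fields on $M$ and a holomorphic and isometric diffeomorphism $F:TM/\Gamma\to N^\circ$, where $\Gamma$ is the group of translations $u\mapsto u+\sum_i k_iX_i$, $k\in\mathbb{Z}^n$, and $TM/\Gamma$ carries the structure induced from $TM$, such that $F([u+\sum_i t_iX_i])=\Phi([t],F([u]))$ for all $t\in\mathbb{R}^n$, $u\in TM$. Let $\nabla^{\mathrm{flat}}$ be the canonical flat connection of $\mathbb{R}^n$ and of its open subsets, and let $x=(x_1,\dots,x_n)$ be the standard coordinates. **Theorem.** Fix $p\in N^\circ$ and for $x,u,v\in\mathbb{R}^n$ set $h_x(u,v)=g_{\varphi^x(1,p)}(u_N,v_N)$. Then: 1. $h$ is a Riemannian metric on $\mathbb{R}^n$ and $(\mathbb{R}^n,h,\nabla^{\mathrm{flat}})$ is dually flat. 2. $\Phi$ is a torification of $(\mathbb{R}^n,h,\nabla^{\mathrm{flat}})$. 3. Let $\mu$ be a momentum map. Then $\mu(N^\circ)$ is open in $\mathbb{R}^n$ and carries a unique Riemannian metric $k$ that makes $\mu:N^\circ\to\mu(N^\circ)$ a Riemannian submersion; let $\nabla^k$ be the dual connection of $\nabla^{\mathrm{flat}}$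 with respect to $k$. The canonical space $(\mu(N^\circ),k,\nabla^k)$ is dually flat, and there are coordinates $y=(y_1,\dots,y_n)$ on $\mathbb{R}^n$ such that (a) $(x,y)$ is a global pair of dual coordinate systems on $(\mathbb{R}^n,h,\nabla^{\mathrm{flat}})$, and (b) $-y$ is an isomorphism of dually flat spaces from $(\mathbb{R}^n,h,\nabla^{\mathrm{flat}})$ to $(\mu(N^\circ),k,\nabla^k)$. If there is no $C\in\mathbb{R}^n\setminus\{0\}$ with $\mu(N^\circ)=\mu(N^\circ)+C$ (which is the case if $N$ is compact), then $y$ satisfying (a) and (b) is unique. -/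

import Mathlib

open scoped Manifold ContDiff

noncomputable section

namespace KahlerToric

/-- The Euclidean space `ℝⁿ`. -/
abbrev Vec (n : ℕ) : Type := EuclideanSpace ℝ (Fin n)

/-! ### Geometry of open subsets of `ℝⁿ`

A vector field on an open set `U ⊆ ℝⁿ` is represented by a function `Vec n → Vec n` that is smooth
on `U`; only its values on `U` matter, and all identities are required on `U` only. Metrics and
connections on `U` are represented in the same way. -/

section Domain

variable {n : ℕ}

/-- Smooth vector fields on `U`. -/
def IsSmoothField (U : Set (Vec n)) (X : Vec n → Vec n) : Prop := ContDiffOn ℝ ∞ X U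

/-- Smooth Riemannian metrics on `U`. -/
structure IsRiemannianMetric (U : Set (Vec n)) (h : Vec n → Vec n →L[ℝ] Vec n →L[ℝ] ℝ) :
    Prop where
  smooth : ContDiffOn ℝ ∞ h U
  symm : ∀ x ∈ U, ∀ u v, h x u v = h x v u
  pos : ∀ x ∈ U, ∀ u, u ≠ 0 → 0 < h x u u

/-- Linear connections `(X, Y) ↦ ∇_X Y` on `U`. -/
structure IsLinearConnection (U : Set (Vec n))
    (D : (Vec n → Vec n) → (Vec n → Vec n) → (Vec n → Vec n)) : Prop where
  smooth : ∀ X Y, IsSmoothField U X → IsSmoothField U Y → IsSmoothField U (D X Y)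
  linear_left : ∀ (f g : Vec n → ℝ) (X Y Z : Vec n → Vec n),
    ContDiffOn ℝ ∞ f U → ContDiffOn ℝ ∞ g U →
    IsSmoothField U X → IsSmoothField U Y → IsSmoothField U Z →
    ∀ x ∈ U, D (fun z => f z • X z + g z • Y z) Z x = f x • D X Z x + g x • D Y Z x
  add_right : ∀ X Y Z : Vec n → Vec n,
    IsSmoothField U X → IsSmoothField U Y → IsSmoothField U Z →
    ∀ x ∈ U, D X (fun z => Y z + Z z) x = D X Y x + D X Z x
  leibniz : ∀ (f : Vec n → ℝ) (X Y : Vec n → Vec n),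
    ContDiffOn ℝ ∞ f U → IsSmoothField U X → IsSmoothField U Y →
    ∀ x ∈ U, D X (fun z => f z • Y z) x = fderiv ℝ f x (X x) • Y x + f x • D X Y x

/-- `∇` is flat on `U`: torsion and curvature vanish. -/
structure IsFlatConnection (U : Set (Vec n))
    (D : (Vec n → Vec n) → (Vec n → Vec n) → (Vec n → Vec n)) : Prop where
  torsion : ∀ X Y, IsSmoothField U X → IsSmoothField U Y →
    ∀ x ∈ U, D X Y x - D Y X x - VectorField.lieBracket ℝ X Y x = 0
  curvature : ∀ X Y Z, IsSmoothField U X → IsSmoothField U Y → IsSmoothField U Z →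
    ∀ x ∈ U, D X (D Y Z) x - D Y (D X Z) x - D (VectorField.lieBracket ℝ X Y) Z x = 0

/-- The canonical flat connection `∇^flat` of `ℝⁿ`, also used on open subsets. -/
def flatConnection (X Y : Vec n → Vec n) : Vec n → Vec n := fun x => fderiv ℝ Y x (X x)

/-- `(h, ∇, ∇*)` is a dualistic structure on `U`: `h` is a Riemannian metric and `∇*` is the dual
connection of `∇` with respect to `h` (which determines `∇*` uniquely on `U`). -/
structure IsDualistic (U : Set (Vec n)) (h : Vec n → Vec n →L[ℝ] Vec n →L[ℝ] ℝ)
    (D Dstar : (Vec n → Vec n) → (Vec n → Vec n) → (Vec n → Vec n)) : Prop where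
  isOpen : IsOpen U
  metric : IsRiemannianMetric U h
  connection : IsLinearConnection U D
  connection_dual : IsLinearConnection U Dstar
  dual : ∀ X Y Z, IsSmoothField U X → IsSmoothField U Y → IsSmoothField U Z →
    ∀ x ∈ U, fderiv ℝ (fun z => h z (Y z) (Z z)) x (X x)
      = h x (D X Y x) (Z x) + h x (Y x) (Dstar X Z x)

/-- The dualistic structure `(h, ∇, ∇*)` on `U` is dually flat. -/
structure IsDuallyFlat (U : Set (Vec n)) (h : Vec n → Vec n →L[ℝ] Vec n →L[ℝ] ℝ)
    (D Dstar : (Vec n → Vec n) → (Vec n → Vec n) → (Vec n → Vec n)) : Prop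
    extends IsDualistic U h D Dstar where
  flat : IsFlatConnection U D
  flat_dual : IsFlatConnection U Dstar

/-- `f` restricts to a diffeomorphism from `U` onto `U'`. -/
def IsDiffeoOn (U U' : Set (Vec n)) (f : Vec n → Vec n) : Prop :=
  ContDiffOn ℝ ∞ f U ∧ Set.MapsTo f U U' ∧
    ∃ f' : Vec n → Vec n, ContDiffOn ℝ ∞ f' U' ∧ Set.MapsTo f' U' U ∧ Set.InvOn f' f U U'

/-- `y` is a coordinate system on the open set `U`: a diffeomorphism onto an open set. -/
def IsCoordinateSystem (U : Set (Vec n)) (y : Vec n → Vec n) : Prop :=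
  IsOpen (y '' U) ∧ IsDiffeoOn U (y '' U) y

/-- The coordinate vector field `∂/∂y_j`, that is, the field sent to the constant field `e_j`
by the derivative of `y`. -/
def coordField (y : Vec n → Vec n) (j : Fin n) : Vec n → Vec n :=
  fun x => (fderiv ℝ y x).inverse (EuclideanSpace.single j 1)

/-- `y` is an affine coordinate system on `U` for the connection `∇`. -/
def IsAffineCoordinateSystem (U : Set (Vec n))
    (D : (Vec n → Vec n) → (Vec n → Vec n) → (Vec n → Vec n)) (y : Vec n → Vec n) : Prop :=
  IsCoordinateSystem U y ∧ ∀ i j, ∀ x ∈ U, D (coordField y i) (coordField y j) x = 0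

/-- `(x, y)` is a global pair of dual coordinate systems on `(U, h, ∇)`, where `∇*` is the dual
connection of `∇`. -/
structure IsDualCoordinatePair (U : Set (Vec n)) (h : Vec n → Vec n →L[ℝ] Vec n →L[ℝ] ℝ)
    (D Dstar : (Vec n → Vec n) → (Vec n → Vec n) → (Vec n → Vec n))
    (x y : Vec n → Vec n) : Prop where
  affine : IsAffineCoordinateSystem U D x
  affine_dual : IsAffineCoordinateSystem U Dstar y
  pairing : ∀ i j, ∀ z ∈ U, h z (coordField x i z) (coordField y j z) = if i = j then 1 else 0

/-- `φ^* ∇' = ∇` for a diffeomorphism `φ` from `U` to `U'`: if the fields `X'`, `Y'` on `U'` are the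
push-forwards of `X`, `Y`, then `∇'_{X'} Y'` is the push-forward of `∇_X Y`. -/
def PullsBackConnection (U U' : Set (Vec n)) (φ : Vec n → Vec n)
    (D D' : (Vec n → Vec n) → (Vec n → Vec n) → (Vec n → Vec n)) : Prop :=
  ∀ X Y X' Y', IsSmoothField U X → IsSmoothField U Y →
    IsSmoothField U' X' → IsSmoothField U' Y' →
    (∀ x ∈ U, X' (φ x) = fderiv ℝ φ x (X x)) → (∀ x ∈ U, Y' (φ x) = fderiv ℝ φ x (Y x)) →
    ∀ x ∈ U, D' X' Y' (φ x) = fderiv ℝ φ x (D X Y x)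

/-- `φ` is an isomorphism of dually flat spaces from `(U, h, ∇)` to `(U', h', ∇')`, with dual
connections `∇*` and `∇'*`. -/
structure IsDuallyFlatIso (U : Set (Vec n)) (h : Vec n → Vec n →L[ℝ] Vec n →L[ℝ] ℝ)
    (D Dstar : (Vec n → Vec n) → (Vec n → Vec n) → (Vec n → Vec n))
    (U' : Set (Vec n)) (h' : Vec n → Vec n →L[ℝ] Vec n →L[ℝ] ℝ)
    (D' Dstar' : (Vec n → Vec n) → (Vec n → Vec n) → (Vec n → Vec n))
    (φ : Vec n → Vec n) : Prop where
  source : IsDuallyFlat U h D Dstar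
  target : IsDuallyFlat U' h' D' Dstar'
  diffeo : IsDiffeoOn U U' φ
  metric : ∀ x ∈ U, ∀ u v, h' (φ x) (fderiv ℝ φ x u) (fderiv ℝ φ x v) = h x u v
  connection : PullsBackConnection U U' φ D D'
  connection_dual : PullsBackConnection U U' φ Dstar Dstar'

/-! #### Dombrowski's construction

The tangent bundle of `U` is `U ×ˢ univ`: the pair `(x, r)` is the vector `r` at `x`. -/

/-- The connector `K_u : T_u(TU) → T_x U` at `u = (x, r)`; in coordinates
`K_u (a, b) = b + Γ_x (a, r)`, with Christoffel symbols `Γ_x (a, r) = (∇_a r)(x)` for constant fields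
`a`, `r`. -/
def connector (D : (Vec n → Vec n) → (Vec n → Vec n) → (Vec n → Vec n)) (u A : Vec n × Vec n) :
    Vec n :=
  A.2 + D (fun _ => A.1) (fun _ => u.2) u.1

/-- The metric of `TU`: `A ↦ (π_* A, K A)` is an isometry onto `T_x U ⊕ T_x U`. -/
def dombrowskiMetric (h : Vec n → Vec n →L[ℝ] Vec n →L[ℝ] ℝ)
    (D : (Vec n → Vec n) → (Vec n → Vec n) → (Vec n → Vec n)) (u A B : Vec n × Vec n) : ℝ :=
  h u.1 A.1 B.1 + h u.1 (connector D u A) (connector D u B)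

/-- The almost complex structure of `TU`: `J A` is the vector with `π_* (J A) = - K A` and
`K (J A) = π_* A`. -/
def dombrowskiJ (D : (Vec n → Vec n) → (Vec n → Vec n) → (Vec n → Vec n)) (u A : Vec n × Vec n) :
    Vec n × Vec n :=
  (-connector D u A, A.1 - D (fun _ => -connector D u A) (fun _ => u.2) u.1)

/-! #### Parallel lattices -/

/-- `X = (X₁, …, Xₙ)` is a frame of `∇`-parallel vector fields on `U`, that is, a generator of a
parallel lattice in `TU`. -/
structure IsParallelFrame (U : Set (Vec n))
    (D : (Vec n → Vec n) → (Vec n → Vec n) → (Vec n → Vec n)) (X : Fin n → Vec n → Vec n) :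
    Prop where
  smooth : ∀ i, IsSmoothField U (X i)
  parallel : ∀ i Y, IsSmoothField U Y → ∀ x ∈ U, D Y (X i) x = 0
  basis : ∀ x ∈ U, LinearIndependent ℝ (fun i => X i x)

/-- The orbit relation on `TU` of the group `Γ(L)` of translations
`u ↦ u + k₁ X₁ + ⋯ + kₙ Xₙ`, `k ∈ ℤⁿ`. -/
def latticeSetoid (U : Set (Vec n)) (X : Fin n → Vec n → Vec n) :
    Setoid {u : Vec n × Vec n // u.1 ∈ U} where
  r u v := u.1.1 = v.1.1 ∧ ∃ k : Fin n → ℤ, v.1.2 = u.1.2 + ∑ i, (k i : ℝ) • X i u.1.1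
  iseqv := by
    refine ⟨fun u => ⟨rfl, 0, by simp⟩, ?_, ?_⟩
    · rintro u v ⟨h, k, hk⟩
      refine ⟨h.symm, -k, ?_⟩
      rw [hk, ← h]
      simp
    · rintro u v w ⟨h, k, hk⟩ ⟨h', l, hl⟩
      refine ⟨h.trans h', k + l, ?_⟩
      rw [hl, hk, ← h]
      simp [add_smul, Finset.sum_add_distrib, add_assoc]

/-- The quotient `M_L = TU / Γ(L)`, where `L` is the lattice generated by `X`. -/
abbrev LatticeQuotient (U : Set (Vec n)) (X : Fin n → Vec n → Vec n) : Type :=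
  Quotient (latticeSetoid U X)

/-- The quotient map `q_L : TU → M_L`. -/
def quotientMap (U : Set (Vec n)) (X : Fin n → Vec n → Vec n)
    (u : {u : Vec n × Vec n // u.1 ∈ U}) : LatticeQuotient U X :=
  Quotient.mk (latticeSetoid U X) u

end Domain

/-! ### Kähler manifolds -/

section Kahler

variable {E : Type*} [NormedAddCommGroup E] [NormedSpace ℝ E] {H : Type*} [TopologicalSpace H]
  {I : ModelWithCorners ℝ E H} {N : Type*} [TopologicalSpace N] [ChartedSpace H N]
  [IsManifold I ∞ N]

/-- Smooth vector fields on a manifold. -/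
def IsSmoothVectorField (X : (p : N) → TangentSpace I p) : Prop :=
  ContMDiff I I.tangent ∞ (fun p => (⟨p, X p⟩ : TangentBundle I N))

variable (I N) in
/-- A Kähler structure `(g, J)`: a Riemannian metric and a compatible smooth almost complex
structure `J` that is integrable (its Nijenhuis tensor vanishes) and whose fundamental form
`ω (u, v) = g (J u, v)` is closed. -/
structure KahlerStructure where
  g : Bundle.ContMDiffRiemannianMetric I ∞ E (fun p : N => TangentSpace I p)
  J : (p : N) → TangentSpace I p →L[ℝ] TangentSpace I p
  J_smooth : ContMDiff I (I.prod 𝓘(ℝ, E →L[ℝ] E)) ∞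
    (fun p => Bundle.TotalSpace.mk' (E →L[ℝ] E)
      (E := fun p : N => TangentSpace I p →L[ℝ] TangentSpace I p) p (J p))
  J_sq : ∀ p v, J p (J p v) = -v
  hermitian : ∀ p v w, g.inner p (J p v) (J p w) = g.inner p v w
  integrable : ∀ X Y : (p : N) → TangentSpace I p,
    IsSmoothVectorField X → IsSmoothVectorField Y → ∀ p : N,
      VectorField.mlieBracket I X Y p
        + J p (VectorField.mlieBracket I (fun q => J q (X q)) Y p)
        + J p (VectorField.mlieBracket I X (fun q => J q (Y q)) p)
        - VectorField.mlieBracket I (fun q => J q (X q)) (fun q => J q (Y q)) p = 0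
  -- the invariant formula for `dω (X, Y, Z) = 0`
  closed : ∀ X Y Z : (p : N) → TangentSpace I p,
    IsSmoothVectorField X → IsSmoothVectorField Y → IsSmoothVectorField Z → ∀ p : N,
      mvfderiv I (fun q => g.inner q (J q (Y q)) (Z q)) p (X p)
        + mvfderiv I (fun q => g.inner q (J q (Z q)) (X q)) p (Y p)
        + mvfderiv I (fun q => g.inner q (J q (X q)) (Y q)) p (Z p)
        - g.inner p (J p (VectorField.mlieBracket I X Y p)) (Z p)
        - g.inner p (J p (VectorField.mlieBracket I Y Z p)) (X p)
        - g.inner p (J p (VectorField.mlieBracket I Z X p)) (Y p) = 0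

/-- The Kähler form `ω (u, v) = g (J u, v)`. -/
def KahlerStructure.omega (K : KahlerStructure I N) (p : N)
    (u v : TangentSpace I p) : ℝ :=
  K.g.inner p (K.J p u) v

/-- `φ : ℝ × N → N` is the (global) flow of the vector field `X`; such a `φ` exists exactly when `X`
is complete. -/
def IsFlow (X : (p : N) → TangentSpace I p) (φ : ℝ → N → N) : Prop :=
  ∀ q, φ 0 q = q ∧ IsMIntegralCurve (fun t => φ t q) X

end Kahler

/-! ### Torus actions -/

/-- The torus `ℝⁿ/ℤⁿ`. -/
abbrev Torus (n : ℕ) : Type := Fin n → UnitAddCircle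

/-- The quotient map `ℝⁿ → ℝⁿ/ℤⁿ`, `t ↦ [t]`, which is also the exponential map of the torus. -/
def toTorus {n : ℕ} (t : Vec n) : Torus n := fun i => (t i : UnitAddCircle)

section Action

variable {n : ℕ} {E : Type*} [NormedAddCommGroup E] [NormedSpace ℝ E]
  {H : Type*} [TopologicalSpace H] {I : ModelWithCorners ℝ E H}
  {N : Type*} [TopologicalSpace N] [ChartedSpace H N] [AddAction (Torus n) N]

variable (n I N) in
/-- The action `Tⁿ × N → N` is smooth. The smooth structure of `Tⁿ = ℝⁿ/ℤⁿ` is the one for which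
`ℝⁿ → Tⁿ` is a local diffeomorphism, so smoothness is tested on `ℝⁿ × N`. -/
def IsSmoothTorusAction : Prop :=
  ContMDiff (𝓘(ℝ, Vec n).prod I) I ∞ (fun q : Vec n × N => toTorus q.1 +ᵥ q.2)

variable (n N) in
/-- The set `N°` of points where the action is free. -/
def freeSet : Set N := {p | ∀ a : Torus n, a +ᵥ p = p → a = 0}

variable (I) in
/-- The map `ξ ↦ ξ_N (p)` from `Lie(Tⁿ) = ℝⁿ` to `T_p N`: the derivative at `0` of
`t ↦ [t] +ᵥ p`. So `ξ_N` is the fundamental vector field of `ξ`. -/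
def fundamental (p : N) : Vec n →L[ℝ] TangentSpace I p :=
  (mfderiv 𝓘(ℝ, Vec n) I (fun t : Vec n => toTorus t +ᵥ p) 0 : Vec n →L[ℝ] E)

variable [IsManifold I ∞ N] (K : KahlerStructure I N)

/-- Each `Φ_a` is a holomorphic map. -/
def IsHolomorphicAction (n : ℕ) [AddAction (Torus n) N] : Prop :=
  ∀ (a : Torus n) (p : N) (v : TangentSpace I p),
    mfderiv I I (fun q : N => a +ᵥ q) p (K.J p v)
      = K.J (a +ᵥ p) (mfderiv I I (fun q : N => a +ᵥ q) p v)

/-- Each `Φ_a` is an isometric map. -/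
def IsIsometricAction (n : ℕ) [AddAction (Torus n) N] : Prop :=
  ∀ (a : Torus n) (p : N) (v w : TangentSpace I p),
    K.g.inner (a +ᵥ p) (mfderiv I I (fun q : N => a +ᵥ q) p v)
      (mfderiv I I (fun q : N => a +ᵥ q) p w) = K.g.inner p v w

/-- Each `Φ_a` preserves the Kähler form. -/
def IsSymplecticAction (n : ℕ) [AddAction (Torus n) N] : Prop :=
  ∀ (a : Torus n) (p : N) (v w : TangentSpace I p),
    K.omega (a +ᵥ p) (mfderiv I I (fun q : N => a +ᵥ q) p v)
      (mfderiv I I (fun q : N => a +ᵥ q) p w) = K.omega p v w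

/-- `μ : N → ℝⁿ` is a momentum map: it is invariant and `ω (ξ_N, ·) = d⟨μ, ξ⟩` for all `ξ`. -/
structure IsMomentumMap (μ : N → Vec n) : Prop where
  smooth : ContMDiff I 𝓘(ℝ, Vec n) ∞ μ
  invariant : ∀ (a : Torus n) (p : N), μ (a +ᵥ p) = μ p
  hamiltonian : ∀ (ξ : Vec n) (p : N) (v : TangentSpace I p),
    K.omega p (fundamental I p ξ) v = mvfderiv I (fun q => inner ℝ (μ q) ξ) p v

/-- The action is Hamiltonian. -/
def IsHamiltonianAction (n : ℕ) [AddAction (Torus n) N] : Prop :=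
  IsSymplecticAction K n ∧ ∃ μ : N → Vec n, IsMomentumMap K μ

/-- The action on `N` is a torification of the dually flat space `(U, h, ∇)`: it is effective,
holomorphic and isometric, and there are a parallel frame `X` on `U`, generating a lattice `L`, and a
bijection `F` from `M_L = TU / Γ(L)` onto `N°` that is a holomorphic and isometric diffeomorphism,
equivariant for the action `[t] · q_L (u) = q_L (u + t₁ X₁ + ⋯ + tₙ Xₙ)` on `M_L`.

The smooth structure, the metric and the complex structure of `M_L` are those for which
`q_L : TU → M_L` is a local diffeomorphism, locally isometric and holomorphic; the conditions on `F`
are expressed accordingly through a map `τ` that represents `F ∘ q_L` on `U × ℝⁿ`. -/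
def IsTorification (U : Set (Vec n)) (h : Vec n → Vec n →L[ℝ] Vec n →L[ℝ] ℝ)
    (D : (Vec n → Vec n) → (Vec n → Vec n) → (Vec n → Vec n)) : Prop :=
  FaithfulVAdd (Torus n) N ∧ IsHolomorphicAction K n ∧ IsIsometricAction K n ∧
  ∃ X : Fin n → Vec n → Vec n, IsParallelFrame U D X ∧
  ∃ F : LatticeQuotient U X → N,
    Function.Injective F ∧ Set.range F = freeSet n N ∧
    (∀ (t : Vec n) (u v : {u : Vec n × Vec n // u.1 ∈ U}), v.1.1 = u.1.1 →
      v.1.2 = u.1.2 + ∑ i, t i • X i u.1.1 →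
      F (quotientMap U X v) = toTorus t +ᵥ F (quotientMap U X u)) ∧
    ∃ τ : Vec n × Vec n → N,
      (∀ u : {u : Vec n × Vec n // u.1 ∈ U}, τ u.1 = F (quotientMap U X u)) ∧
      IsLocalDiffeomorphOn 𝓘(ℝ, Vec n × Vec n) I ∞ τ {u | u.1 ∈ U} ∧
      (∀ u : Vec n × Vec n, u.1 ∈ U → ∀ A : Vec n × Vec n,
        mfderiv 𝓘(ℝ, Vec n × Vec n) I τ u (dombrowskiJ D u A)
          = K.J (τ u) (mfderiv 𝓘(ℝ, Vec n × Vec n) I τ u A)) ∧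
      (∀ u : Vec n × Vec n, u.1 ∈ U → ∀ A B : Vec n × Vec n,
        K.g.inner (τ u) (mfderiv 𝓘(ℝ, Vec n × Vec n) I τ u A)
            (mfderiv 𝓘(ℝ, Vec n × Vec n) I τ u B)
          = dombrowskiMetric h D u A B)

/-- `k` is the Riemannian metric on `μ(N°)` that makes `μ : N° → μ(N°)` a Riemannian submersion: each
derivative is onto, and isometric on the orthogonal complement of its kernel. -/
structure IsSubmersionMetric (μ : N → Vec n) (k : Vec n → Vec n →L[ℝ] Vec n →L[ℝ] ℝ) : Prop where
  metric : IsRiemannianMetric (μ '' freeSet n N) k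
  surjective : ∀ p ∈ freeSet n N, Function.Surjective (mfderiv I 𝓘(ℝ, Vec n) μ p)
  isometric : ∀ p ∈ freeSet n N, ∀ u v : TangentSpace I p,
    (∀ w : TangentSpace I p, mfderiv I 𝓘(ℝ, Vec n) μ p w = 0 →
      K.g.inner p u w = 0 ∧ K.g.inner p v w = 0) →
    k (μ p) (mfderiv I 𝓘(ℝ, Vec n) μ p u) (mfderiv I 𝓘(ℝ, Vec n) μ p v) = K.g.inner p u v

/-- `(k, ∇^k, ∇^flat)` is the canonical dualistic structure of `μ(N°)`: `k` makes `μ` a Riemannian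
submersion and `∇^k` is the dual connection of `∇^flat` with respect to `k`. -/
structure IsCanonicalStructure (μ : N → Vec n) (k : Vec n → Vec n →L[ℝ] Vec n →L[ℝ] ℝ)
    (Dk : (Vec n → Vec n) → (Vec n → Vec n) → (Vec n → Vec n)) : Prop where
  submersion : IsSubmersionMetric K μ k
  dualistic : IsDualistic (μ '' freeSet n N) k Dk flatConnection

end Action

end KahlerToric

end

open KahlerToric

/-!
Let `y = -μ ∘ (x ↦ φ x 1 p)`. As `μ` is a momentum map and `φ x` is the flow of `-J x_N`, the matrix
of `h` at `x` is the Jacobian of `y`, so `h` is a Hessian metric and `y` is the dual coordinate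
system of the affine coordinates `x`.

The vector fields `ξ_N` and `-J η_N` all commute, so that `(x, t) ↦ [t] + φ x 1 p` is holomorphic on
`ℝⁿ × ℝⁿ = Tℝⁿ`, and its image is open in the free set `N°`; the images for the various `p`
partition `N°`. Every other point of `N` is fixed by a torsion element of the torus (a closed
nontrivial subgroup contains torsion), and the fixed points of a holomorphic map of finite order
form, locally, a Lipschitz graph of codimension at least two, which does not disconnect. Hence `N°`
is connected, a single image fills it, and this is the torification. On `N°` the momentum map is
`-y`, which transports `h` to the submersion metric; the Legendre transformation exchanges the two
affine structures. Two dual coordinate systems differ by a translation, which `μ(N°)` must absorb.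
-/

namespace KahlerToric

section FlatConnection

variable {n : ℕ} {U : Set (Vec n)}

theorem IsSmoothField.differentiableAt {X : Vec n → Vec n} (hX : IsSmoothField U X)
    (hU : IsOpen U) {x : Vec n} (hx : x ∈ U) : DifferentiableAt ℝ X x :=
  (hX.contDiffAt (hU.mem_nhds hx)).differentiableAt (by simp)

theorem IsSmoothField.contDiffOn_fderiv {X : Vec n → Vec n} (hX : IsSmoothField U X)
    (hU : IsOpen U) : ContDiffOn ℝ ∞ (fderiv ℝ X) U :=
  ContDiffOn.fderiv_of_isOpen (m := ∞) hX hU (by simp)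

theorem IsSmoothField.fderiv_apply {f X : Vec n → Vec n} (hf : IsSmoothField U f)
    (hU : IsOpen U) (hX : IsSmoothField U X) : IsSmoothField U fun z => fderiv ℝ f z (X z) :=
  (hf.contDiffOn_fderiv hU).clm_apply hX

theorem IsSmoothField.isSymmSndFDerivAt {X : Vec n → Vec n} (hX : IsSmoothField U X)
    (hU : IsOpen U) {x : Vec n} (hx : x ∈ U) : IsSymmSndFDerivAt ℝ X x :=
  (hX.contDiffAt (hU.mem_nhds hx)).isSymmSndFDerivAt (by simpa using ENat.LEInfty.out (m := 2))

theorem IsSmoothField.fderiv_fderiv_apply {f X : Vec n → Vec n} (hf : IsSmoothField U f)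
    (hU : IsOpen U) (hX : IsSmoothField U X) {x : Vec n} (hx : x ∈ U) (u : Vec n) :
    fderiv ℝ (fun z => fderiv ℝ f z (X z)) x u
      = fderiv ℝ (fderiv ℝ f) x u (X x) + fderiv ℝ f x (fderiv ℝ X x u) := by
  have hdf : DifferentiableAt ℝ (fderiv ℝ f) x :=
    ((hf.contDiffOn_fderiv hU).contDiffAt (hU.mem_nhds hx)).differentiableAt (by simp)
  rw [fderiv_clm_apply hdf (hX.differentiableAt hU hx)]
  simp [add_comm]

theorem isLinearConnection_flatConnection (hU : IsOpen U) :
    IsLinearConnection U (flatConnection (n := n)) where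
  smooth _ _ hX hY := hY.fderiv_apply hU hX
  linear_left f g X Y Z _ _ _ _ _ x _ := by simp [flatConnection]
  add_right X Y Z _ hY hZ x hx := by
    simp only [flatConnection]
    rw [fderiv_fun_add (hY.differentiableAt hU hx) (hZ.differentiableAt hU hx)]
    rfl
  leibniz f X Y hf _ hY x hx := by
    simp only [flatConnection]
    rw [fderiv_fun_smul ((hf.contDiffAt (hU.mem_nhds hx)).differentiableAt (by simp))
      (hY.differentiableAt hU hx)]
    simp [add_comm]

theorem isFlatConnection_flatConnection (hU : IsOpen U) :
    IsFlatConnection U (flatConnection (n := n)) where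
  torsion X Y _ _ x _ := by simp [flatConnection, VectorField.lieBracket]
  curvature X Y Z hX hY hZ x hx := by
    unfold flatConnection
    rw [hZ.fderiv_fderiv_apply hU hY hx, hZ.fderiv_fderiv_apply hU hX hx,
      (hZ.isSymmSndFDerivAt hU hx).eq (X x) (Y x)]
    simp [VectorField.lieBracket]

end FlatConnection

section Connection

variable {n : ℕ} {U U' : Set (Vec n)} {h : Vec n → Vec n →L[ℝ] Vec n →L[ℝ] ℝ}
  {D D₁ D₂ D' : (Vec n → Vec n) → (Vec n → Vec n) → (Vec n → Vec n)}

theorem IsLinearConnection.congr_right (hD : IsLinearConnection U D)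
    {X Y Z : Vec n → Vec n} (hX : IsSmoothField U X) (hY : IsSmoothField U Y)
    (hZ : IsSmoothField U Z) (hYZ : Set.EqOn Y Z U) : Set.EqOn (D X Y) (D X Z) U := by
  classical
  -- `W = Y - Z` vanishes on `U`, so it equals `f • W` for the indicator function `f` of the
  -- complement of `U`, which also vanishes on `U`; apply the Leibniz rule to this product.
  intro x hx
  set W : Vec n → Vec n := fun z => Y z - Z z
  set f : Vec n → ℝ := Uᶜ.indicator 1
  have hW : IsSmoothField U W := hY.sub hZ
  have hW0 : ∀ z ∈ U, W z = 0 := fun z hz => sub_eq_zero.2 (hYZ hz)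
  have hf0 : Set.EqOn f 0 U := fun z hz => by simp [f, hz]
  have hf : ContDiffOn ℝ ∞ f U := (contDiffOn_const (c := (0 : ℝ))).congr hf0
  have hfW : (fun z => f z • W z) = W := by
    funext z
    by_cases hz : z ∈ U
    · simp [hW0 z hz]
    · simp [f, hz]
  have hDW : D X W x = 0 := by
    have hleib := hD.leibniz f X W hf hX hW x hx
    rwa [hfW, hW0 x hx, hf0 hx, smul_zero, Pi.zero_apply, zero_smul, zero_add] at hleib
  have hadd := hD.add_right X Z W hX hZ hW x hx
  rwa [show (fun z => Z z + W z) = Y from funext fun z => add_sub_cancel _ _, hDW, add_zero]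
    at hadd

theorem IsFlatConnection.congr (hflat : IsFlatConnection U D₁) (hU : IsOpen U)
    (hD₁ : IsLinearConnection U D₁) (hD₂ : IsLinearConnection U D₂)
    (heq : ∀ X Y, IsSmoothField U X → IsSmoothField U Y → Set.EqOn (D₁ X Y) (D₂ X Y) U) :
    IsFlatConnection U D₂ where
  torsion X Y hX hY x hx := by
    rw [← heq X Y hX hY hx, ← heq Y X hY hX hx]
    exact hflat.torsion X Y hX hY x hx
  curvature X Y Z hX hY hZ x hx := by
    have hXY : IsSmoothField U (VectorField.lieBracket ℝ X Y) :=
      (hY.fderiv_apply hU hX).sub (hX.fderiv_apply hU hY)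
    have hiter : ∀ X Y, IsSmoothField U X → IsSmoothField U Y →
        D₁ X (D₁ Y Z) x = D₂ X (D₂ Y Z) x := fun X Y hX hY =>
      (hD₁.congr_right hX (hD₁.smooth Y Z hY hZ) (hD₂.smooth Y Z hY hZ) (heq Y Z hY hZ) hx).trans
        (heq X _ hX (hD₂.smooth Y Z hY hZ) hx)
    rw [← hiter X Y hX hY, ← hiter Y X hY hX, ← heq _ Z hXY hZ hx]
    exact hflat.curvature X Y Z hX hY hZ x hx

theorem IsDualistic.symm (hD : IsDualistic U h D D') : IsDualistic U h D' D where
  isOpen := hD.isOpen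
  metric := hD.metric
  connection := hD.connection_dual
  connection_dual := hD.connection
  dual X Y Z hX hY hZ x hx := by
    have hswap : (fun z => h z (Y z) (Z z)) =ᶠ[nhds x] fun z => h z (Z z) (Y z) := by
      filter_upwards [hD.isOpen.mem_nhds hx] with z hz using hD.metric.symm z hz _ _
    rw [hswap.fderiv_eq, hD.dual X Z Y hX hZ hY x hx, add_comm, hD.metric.symm x hx (Z x),
      hD.metric.symm x hx _ (Y x)]

theorem IsDualistic.dual_unique (hD₁ : IsDualistic U h D D₁) (hD₂ : IsDualistic U h D D₂)
    {X Z : Vec n → Vec n} (hX : IsSmoothField U X) (hZ : IsSmoothField U Z) :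
    Set.EqOn (D₁ X Z) (D₂ X Z) U := by
  intro x hx
  have hpair : ∀ w, h x w (D₁ X Z x) = h x w (D₂ X Z x) := fun w => by
    have e₁ := hD₁.dual X (fun _ => w) Z hX contDiffOn_const hZ x hx
    have e₂ := hD₂.dual X (fun _ => w) Z hX contDiffOn_const hZ x hx
    exact add_left_cancel (e₁.symm.trans e₂)
  by_contra hne
  refine (hD₁.metric.pos x hx _ (sub_ne_zero.2 hne)).ne' ?_
  rw [map_sub, hpair, sub_self]

theorem PullsBackConnection.congr_right {φ : Vec n → Vec n}
    (hφ : PullsBackConnection U U' φ D D₁) (hmaps : Set.MapsTo φ U U')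
    (heq : ∀ X Y, IsSmoothField U' X → IsSmoothField U' Y → Set.EqOn (D₁ X Y) (D₂ X Y) U') :
    PullsBackConnection U U' φ D D₂ := fun X Y X' Y' hX hY hX' hY' hXX' hYY' x hx =>
  (heq X' Y' hX' hY' (hmaps hx)).symm.trans (hφ X Y X' Y' hX hY hX' hY' hXX' hYY' x hx)

end Connection

section LocalDiffeo

variable {n : ℕ} {U V : Set (Vec n)} {f : Vec n → Vec n}

/-- `f` is a local diffeomorphism on the open set `U`, not necessarily injective. -/
structure IsLocalDiffeoOn (U : Set (Vec n)) (f : Vec n → Vec n) : Prop where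
  isOpen : IsOpen U
  smooth : IsSmoothField U f
  isInvertible : ∀ x ∈ U, (fderiv ℝ f x).IsInvertible

/-- The pull-back by `f` of the flat connection `∇^flat`. -/
noncomputable def pullbackFlat (f X Y : Vec n → Vec n) : Vec n → Vec n :=
  fun x => (fderiv ℝ f x).inverse (fderiv ℝ (fun z => fderiv ℝ f z (Y z)) x (X x))

theorem pullbackFlat_congr {f₁ f₂ : Vec n → Vec n} (hf : fderiv ℝ f₁ = fderiv ℝ f₂) :
    pullbackFlat f₁ = pullbackFlat f₂ := by
  unfold pullbackFlat
  rw [hf]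

theorem pullbackFlat_neg (f : Vec n → Vec n) : pullbackFlat (fun x => -f x) = pullbackFlat f := by
  have hneg : fderiv ℝ (fun x => -f x) = fun x =>
      ((ContinuousLinearEquiv.neg ℝ : Vec n ≃L[ℝ] Vec n) : Vec n →L[ℝ] Vec n) ∘L fderiv ℝ f x := by
    funext x
    rw [fderiv_fun_neg]
    rfl
  funext X Y x
  simp only [pullbackFlat, hneg, ContinuousLinearMap.inverse_equiv_comp,
    ContinuousLinearMap.comp_apply]
  rw [show (fun z => ((ContinuousLinearEquiv.neg ℝ : Vec n ≃L[ℝ] Vec n) : Vec n →L[ℝ] Vec n)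
      (fderiv ℝ f z (Y z))) = fun z => -fderiv ℝ f z (Y z) from rfl, fderiv_fun_neg]
  simp

namespace IsLocalDiffeoOn

theorem differentiableAt (hf : IsLocalDiffeoOn U f) {x : Vec n} (hx : x ∈ U) :
    DifferentiableAt ℝ f x :=
  hf.smooth.differentiableAt hf.isOpen hx

theorem neg (hf : IsLocalDiffeoOn U f) : IsLocalDiffeoOn U fun x => -f x where
  isOpen := hf.isOpen
  smooth := hf.smooth.neg
  isInvertible x hx := by
    obtain ⟨e, he⟩ := hf.isInvertible x hx
    refine ⟨e.trans (ContinuousLinearEquiv.neg ℝ), ?_⟩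
    rw [fderiv_fun_neg, ← he]
    ext u : 1
    simp

theorem fderiv_pullbackFlat (hf : IsLocalDiffeoOn U f) (X Y : Vec n → Vec n) {x : Vec n}
    (hx : x ∈ U) :
    fderiv ℝ f x (pullbackFlat f X Y x) = fderiv ℝ (fun z => fderiv ℝ f z (Y z)) x (X x) :=
  (hf.isInvertible x hx).self_apply_inverse _

theorem contDiffOn_inverse_fderiv (hf : IsLocalDiffeoOn U f) :
    ContDiffOn ℝ ∞ (fun x => (fderiv ℝ f x).inverse) U := by
  intro x hx
  obtain ⟨e, he⟩ := hf.isInvertible x hx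
  have hinv : ContDiffAt ℝ ∞ ContinuousLinearMap.inverse (fderiv ℝ f x) := by
    rw [← he]
    exact contDiffAt_map_inverse e
  exact hinv.comp_contDiffWithinAt x (hf.smooth.contDiffOn_fderiv hf.isOpen x hx)

theorem isLinearConnection_pullbackFlat (hf : IsLocalDiffeoOn U f) :
    IsLinearConnection U (pullbackFlat f) where
  smooth _ _ hX hY := hf.contDiffOn_inverse_fderiv.clm_apply
    ((hf.smooth.fderiv_apply hf.isOpen hY).fderiv_apply hf.isOpen hX)
  linear_left a b X Y Z _ _ _ _ _ x _ := by simp [pullbackFlat]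
  add_right X Y Z _ hY hZ x hx := by
    simp only [pullbackFlat, map_add]
    rw [fderiv_fun_add ((hf.smooth.fderiv_apply hf.isOpen hY).differentiableAt hf.isOpen hx)
      ((hf.smooth.fderiv_apply hf.isOpen hZ).differentiableAt hf.isOpen hx)]
    simp
  leibniz a X Y ha _ hY x hx := by
    simp only [pullbackFlat, map_smul]
    rw [fderiv_fun_smul ((ha.contDiffAt (hf.isOpen.mem_nhds hx)).differentiableAt (by simp))
      ((hf.smooth.fderiv_apply hf.isOpen hY).differentiableAt hf.isOpen hx)]
    simp [add_comm, (hf.isInvertible x hx).inverse_apply_self]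

theorem isFlatConnection_pullbackFlat (hf : IsLocalDiffeoOn U f) :
    IsFlatConnection U (pullbackFlat f) where
  torsion X Y hX hY x hx := by
    have hsymm := (hf.smooth.isSymmSndFDerivAt hf.isOpen hx).eq (X x) (Y x)
    unfold pullbackFlat
    rw [hf.smooth.fderiv_fderiv_apply hf.isOpen hY hx,
      hf.smooth.fderiv_fderiv_apply hf.isOpen hX hx, hsymm, map_add, map_add,
      (hf.isInvertible x hx).inverse_apply_self, (hf.isInvertible x hx).inverse_apply_self]
    simp [VectorField.lieBracket]
  curvature X Y Z hX hY hZ x hx := by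
    have hpush : ∀ V, (fun z => fderiv ℝ f z (pullbackFlat f V Z z)) =ᶠ[nhds x]
        flatConnection V fun z => fderiv ℝ f z (Z z) := fun V => by
      filter_upwards [hf.isOpen.mem_nhds hx] with z hz using hf.fderiv_pullbackFlat V Z hz
    have hflat := (isFlatConnection_flatConnection hf.isOpen).curvature X Y _ hX hY
      (hf.smooth.fderiv_apply hf.isOpen hZ) x hx
    rw [pullbackFlat, pullbackFlat, pullbackFlat, (hpush Y).fderiv_eq, (hpush X).fderiv_eq,
      ← map_sub, ← map_sub]
    exact (congrArg _ hflat).trans (map_zero _)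

theorem pullsBackConnection_pullbackFlat (hf : IsLocalDiffeoOn U f) (hV : IsOpen V)
    (hmaps : Set.MapsTo f U V) :
    PullsBackConnection U V f (pullbackFlat f) flatConnection := by
  intro X Y X' Y' _ _ _ hY' hXX' hYY' x hx
  have hpush : (fun z => fderiv ℝ f z (Y z)) =ᶠ[nhds x] Y' ∘ f := by
    filter_upwards [hf.isOpen.mem_nhds hx] with z hz using (hYY' z hz).symm
  rw [hf.fderiv_pullbackFlat X Y hx, hpush.fderiv_eq,
    fderiv_comp x (hY'.differentiableAt hV (hmaps hx)) (hf.differentiableAt hx), flatConnection,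
    hXX' x hx]
  rfl

theorem exists_hasStrictFDerivAt_equiv (hf : IsLocalDiffeoOn U f) {x : Vec n} (hx : x ∈ U) :
    ∃ e : Vec n ≃L[ℝ] Vec n, HasStrictFDerivAt f (e : Vec n →L[ℝ] Vec n) x := by
  obtain ⟨e, he⟩ := hf.isInvertible x hx
  exact ⟨e, he ▸ (hf.smooth.contDiffAt (hf.isOpen.mem_nhds hx)).hasStrictFDerivAt (by simp)⟩

theorem isOpen_image (hf : IsLocalDiffeoOn U f) : IsOpen (f '' U) := by
  rw [isOpen_iff_mem_nhds]
  rintro _ ⟨x, hx, rfl⟩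
  obtain ⟨e, he⟩ := hf.exists_hasStrictFDerivAt_equiv hx
  exact he.map_nhds_eq_of_equiv ▸ Filter.image_mem_map (hf.isOpen.mem_nhds hx)

theorem contDiffAt_of_leftInvOn (hf : IsLocalDiffeoOn U f) {g : Vec n → Vec n}
    (hg : Set.LeftInvOn g f U) {x : Vec n} (hx : x ∈ U) : ContDiffAt ℝ ∞ g (f x) := by
  obtain ⟨e, he⟩ := hf.exists_hasStrictFDerivAt_equiv hx
  have hfx : ContDiffAt ℝ ∞ f x := hf.smooth.contDiffAt (hf.isOpen.mem_nhds hx)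
  refine (hfx.to_localInverse he.hasFDerivAt (by simp)).congr_of_eventuallyEq ?_
  exact HasStrictFDerivAt.localInverse_unique _
    (Filter.eventually_of_mem (hf.isOpen.mem_nhds hx) hg)

end IsLocalDiffeoOn

/-- `f` and `g` are mutually inverse diffeomorphisms between the open sets `U` and `V`. Unlike
`IsDiffeoOn`, this names the inverse. -/
structure AreInverseDiffeos (U V : Set (Vec n)) (f g : Vec n → Vec n) : Prop where
  isOpen_left : IsOpen U
  isOpen_right : IsOpen V
  smooth_left : IsSmoothField U f
  smooth_right : IsSmoothField V g
  mapsTo_left : Set.MapsTo f U V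
  mapsTo_right : Set.MapsTo g V U
  invOn : Set.InvOn g f U V

/-- `f^* k = h` on `U`. -/
def PullsBackMetric (U : Set (Vec n)) (f : Vec n → Vec n)
    (h k : Vec n → Vec n →L[ℝ] Vec n →L[ℝ] ℝ) : Prop :=
  ∀ x ∈ U, ∀ u v, k (f x) (fderiv ℝ f x u) (fderiv ℝ f x v) = h x u v

theorem PullsBackMetric.eqOn {h h' k : Vec n → Vec n →L[ℝ] Vec n →L[ℝ] ℝ}
    (hf : PullsBackMetric U f h k) (hf' : PullsBackMetric U f h' k) : Set.EqOn h h' U :=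
  fun x hx => by ext u v; rw [← hf x hx, ← hf' x hx]

namespace AreInverseDiffeos

variable {g : Vec n → Vec n}

theorem symm (hfg : AreInverseDiffeos U V f g) : AreInverseDiffeos V U g f :=
  ⟨hfg.isOpen_right, hfg.isOpen_left, hfg.smooth_right, hfg.smooth_left, hfg.mapsTo_right,
    hfg.mapsTo_left, hfg.invOn.symm⟩

theorem isDiffeoOn (hfg : AreInverseDiffeos U V f g) : IsDiffeoOn U V f :=
  ⟨hfg.smooth_left, hfg.mapsTo_left, g, hfg.smooth_right, hfg.mapsTo_right, hfg.invOn⟩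

theorem fderiv_comp_fderiv (hfg : AreInverseDiffeos U V f g) {x : Vec n} (hx : x ∈ U) :
    fderiv ℝ g (f x) ∘L fderiv ℝ f x = ContinuousLinearMap.id ℝ (Vec n) := by
  have hgf : g ∘ f =ᶠ[nhds x] id :=
    Filter.eventually_of_mem (hfg.isOpen_left.mem_nhds hx) hfg.invOn.1
  rw [← fderiv_comp x (hfg.smooth_right.differentiableAt hfg.isOpen_right (hfg.mapsTo_left hx))
    (hfg.smooth_left.differentiableAt hfg.isOpen_left hx), hgf.fderiv_eq, fderiv_id]

theorem fderiv_fderiv_apply (hfg : AreInverseDiffeos U V f g) {x : Vec n} (hx : x ∈ U)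
    (u : Vec n) : fderiv ℝ g (f x) (fderiv ℝ f x u) = u :=
  DFunLike.congr_fun (hfg.fderiv_comp_fderiv hx) u

theorem fderiv_fderiv_apply_left (hfg : AreInverseDiffeos U V f g) {x : Vec n} (hx : x ∈ U)
    (u : Vec n) : fderiv ℝ f x (fderiv ℝ g (f x) u) = u := by
  simpa only [hfg.invOn.1 hx] using hfg.symm.fderiv_fderiv_apply (hfg.mapsTo_left hx) u

theorem fderiv_fderiv_apply_right (hfg : AreInverseDiffeos U V f g) {z : Vec n} (hz : z ∈ V)
    (u : Vec n) : fderiv ℝ f (g z) (fderiv ℝ g z u) = u :=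
  hfg.symm.fderiv_fderiv_apply hz u

theorem isLocalDiffeoOn (hfg : AreInverseDiffeos U V f g) : IsLocalDiffeoOn U f where
  isOpen := hfg.isOpen_left
  smooth := hfg.smooth_left
  isInvertible _ hx := ContinuousLinearMap.IsInvertible.of_inverse
    (ContinuousLinearMap.ext (hfg.fderiv_fderiv_apply_left hx)) (hfg.fderiv_comp_fderiv hx)

theorem pullsBackMetric_symm (hfg : AreInverseDiffeos U V f g)
    {h k : Vec n → Vec n →L[ℝ] Vec n →L[ℝ] ℝ} (hk : PullsBackMetric U f h k) :
    PullsBackMetric V g k h := fun z hz u v => by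
  rw [← hk _ (hfg.mapsTo_right hz), hfg.invOn.2 hz, hfg.fderiv_fderiv_apply_right hz,
    hfg.fderiv_fderiv_apply_right hz]

theorem pullsBackConnection_symm (hfg : AreInverseDiffeos U V f g)
    {D D' : (Vec n → Vec n) → (Vec n → Vec n) → (Vec n → Vec n)}
    (hD : PullsBackConnection U V f D D') : PullsBackConnection V U g D' D := by
  intro X Y X' Y' hX hY hX' hY' hXX' hYY' z hz
  have hpush : ∀ X X' : Vec n → Vec n, (∀ z ∈ V, X' (g z) = fderiv ℝ g z (X z)) →
      ∀ x ∈ U, X (f x) = fderiv ℝ f x (X' x) := fun X X' hXX' x hx => by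
    rw [← hfg.fderiv_fderiv_apply_left hx (X (f x)), ← hXX' _ (hfg.mapsTo_left hx), hfg.invOn.1 hx]
  have hDz := hD X' Y' X Y hX' hY' hX hY (hpush X X' hXX') (hpush Y Y' hYY') _ (hfg.mapsTo_right hz)
  rw [hfg.invOn.2 hz] at hDz
  rw [hDz, hfg.symm.fderiv_fderiv_apply_left hz]

end AreInverseDiffeos

theorem IsLocalDiffeoOn.exists_areInverseDiffeos (hf : IsLocalDiffeoOn U f)
    (hinj : Set.InjOn f U) : ∃ g, AreInverseDiffeos U (f '' U) f g := by
  have hleft : Set.LeftInvOn (Function.invFunOn f U) f U := hinj.leftInvOn_invFunOn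
  refine ⟨Function.invFunOn f U, hf.isOpen, hf.isOpen_image, hf.smooth, ?_,
    Set.mapsTo_image f U, fun _ hz => Function.invFunOn_mem hz, hleft, hleft.rightInvOn_image⟩
  rintro _ ⟨x, hx, rfl⟩
  exact (hf.contDiffAt_of_leftInvOn hleft hx).contDiffWithinAt

theorem IsLocalDiffeoOn.isAffineCoordinateSystem (hf : IsLocalDiffeoOn U f)
    (hinj : Set.InjOn f U) : IsAffineCoordinateSystem U (pullbackFlat f) f := by
  obtain ⟨g, hfg⟩ := hf.exists_areInverseDiffeos hinj
  refine ⟨⟨hf.isOpen_image, hfg.isDiffeoOn⟩, fun i j x hx => ?_⟩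
  have hconst : (fun z => fderiv ℝ f z (coordField f j z)) =ᶠ[nhds x]
      fun _ => EuclideanSpace.single j 1 := by
    filter_upwards [hf.isOpen.mem_nhds hx] with z hz
      using (hf.isInvertible z hz).self_apply_inverse _
  rw [pullbackFlat, hconst.fderiv_eq]
  simp

theorem IsDiffeoOn.image_eq (hf : IsDiffeoOn U V f) : f '' U = V := by
  obtain ⟨-, hmaps, g, -, hmaps', -, hright⟩ := hf
  exact hmaps.image_subset.antisymm fun z hz => ⟨g z, hmaps' hz, hright hz⟩

theorem IsCoordinateSystem.isLocalDiffeoOn (hf : IsCoordinateSystem U f) (hU : IsOpen U) :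
    IsLocalDiffeoOn U f := by
  obtain ⟨hopen, hsmooth, hmaps, g, hg, hmaps', hinv⟩ := hf
  exact AreInverseDiffeos.isLocalDiffeoOn ⟨hU, hopen, hsmooth, hg, hmaps, hmaps', hinv⟩

end LocalDiffeo

section Hessian

variable {n : ℕ} {U : Set (Vec n)} {h : Vec n → Vec n →L[ℝ] Vec n →L[ℝ] ℝ} {y : Vec n → Vec n}

/-- `h` is the Hessian metric on the open set `U` with dual potential map `y`: the matrix of `h`
at `x` is the Jacobian of `y`. As this matrix is symmetric, `y` is locally a gradient and `h` is
locally the Hessian of a function. -/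
structure IsHessian (U : Set (Vec n)) (h : Vec n → Vec n →L[ℝ] Vec n →L[ℝ] ℝ)
    (y : Vec n → Vec n) : Prop where
  isOpen : IsOpen U
  smooth : IsSmoothField U y
  eq : ∀ x ∈ U, ∀ u v, h x u v = inner ℝ (fderiv ℝ y x u) v
  symm : ∀ x ∈ U, ∀ u v, h x u v = h x v u
  pos : ∀ x ∈ U, ∀ u, u ≠ 0 → 0 < h x u u

namespace IsHessian

theorem isLocalDiffeoOn (H : IsHessian U h y) : IsLocalDiffeoOn U y where
  isOpen := H.isOpen
  smooth := H.smooth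
  isInvertible x hx := by
    have hker : ∀ u, fderiv ℝ y x u = 0 → u = 0 := fun u hu => by
      by_contra hne
      exact (H.pos x hx u hne).ne' (by rw [H.eq x hx, hu, inner_zero_left])
    have hinj : Function.Injective (fderiv ℝ y x : Vec n →ₗ[ℝ] Vec n) :=
      (injective_iff_map_eq_zero _).2 hker
    exact ⟨(LinearEquiv.ofInjectiveEndo _ hinj).toContinuousLinearEquiv, by ext; rfl⟩

theorem isRiemannianMetric (H : IsHessian U h y) : IsRiemannianMetric U h where
  smooth := by
    have hinner : ContDiffOn ℝ ∞ (fun x => (innerSL ℝ).comp (fderiv ℝ y x)) U :=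
      contDiffOn_const.clm_comp (H.smooth.contDiffOn_fderiv H.isOpen)
    exact hinner.congr fun x hx => by ext u v; exact H.eq x hx u v
  symm := H.symm
  pos := H.pos

theorem isDuallyFlat (H : IsHessian U h y) : IsDuallyFlat U h flatConnection (pullbackFlat y) where
  isOpen := H.isOpen
  metric := H.isRiemannianMetric
  connection := isLinearConnection_flatConnection H.isOpen
  connection_dual := H.isLocalDiffeoOn.isLinearConnection_pullbackFlat
  dual X Y Z _ hY hZ x hx := by
    have hinner : (fun z => h z (Y z) (Z z)) =ᶠ[nhds x]
        fun z => inner ℝ (fderiv ℝ y z (Z z)) (Y z) := by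
      filter_upwards [H.isOpen.mem_nhds hx] with z hz
      rw [H.symm z hz, H.eq z hz]
    rw [hinner.fderiv_eq,
      fderiv_inner_apply ℝ ((H.smooth.fderiv_apply H.isOpen hZ).differentiableAt H.isOpen hx)
        (hY.differentiableAt H.isOpen hx),
      H.symm x hx _ (Z x), H.symm x hx (Y x), H.eq x hx, H.eq x hx,
      H.isLocalDiffeoOn.fderiv_pullbackFlat X Z hx]
    rfl
  flat := isFlatConnection_flatConnection H.isOpen
  flat_dual := H.isLocalDiffeoOn.isFlatConnection_pullbackFlat

theorem isDuallyFlat_of_isDualistic (H : IsHessian U h y)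
    {D : (Vec n → Vec n) → (Vec n → Vec n) → (Vec n → Vec n)}
    (hD : IsDualistic U h D flatConnection) : IsDuallyFlat U h D flatConnection where
  toIsDualistic := hD
  flat_dual := isFlatConnection_flatConnection H.isOpen
  flat := H.isDuallyFlat.flat_dual.congr H.isOpen H.isDuallyFlat.connection_dual hD.connection
    fun _ _ => H.isDuallyFlat.toIsDualistic.dual_unique hD.symm

/-- Along a segment with direction `v`, the derivative of `⟨y, v⟩` is `h (v, v) > 0`. -/
theorem injOn (H : IsHessian U h y) (hU : Convex ℝ U) : Set.InjOn y U := by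
  intro a ha b hb hab
  by_contra hne
  set v := b - a
  have hmem : ∀ t ∈ Set.Icc (0 : ℝ) 1, a + t • v ∈ U := fun t ht => hU.add_smul_sub_mem ha hb ht
  have hderiv : ∀ t ∈ Set.Icc (0 : ℝ) 1,
      HasDerivAt (fun t : ℝ => inner ℝ (y (a + t • v)) v) (h (a + t • v) v v) t := fun t ht => by
    have hline : HasDerivAt (fun t : ℝ => a + t • v) v t := by
      simpa using ((hasDerivAt_id t).smul_const v).const_add a
    have hy := (H.isLocalDiffeoOn.differentiableAt (hmem t ht)).hasFDerivAt.comp_hasDerivAt t hline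
    simpa [H.eq _ (hmem t ht)] using hy.inner ℝ (hasDerivAt_const t v)
  have hmono : StrictMonoOn (fun t : ℝ => inner ℝ (y (a + t • v)) v) (Set.Icc 0 1) := by
    refine strictMonoOn_of_deriv_pos (convex_Icc 0 1)
      (fun t ht => (hderiv t ht).continuousAt.continuousWithinAt) fun t ht => ?_
    have ht := interior_subset ht
    exact (hderiv t ht).deriv ▸ H.pos _ (hmem t ht) v (sub_ne_zero.2 (Ne.symm hne))
  have hlt := hmono (Set.left_mem_Icc.2 zero_le_one) (Set.right_mem_Icc.2 zero_le_one) zero_lt_one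
  simp [v, hab] at hlt

theorem exists_areInverseDiffeos_neg (H : IsHessian U h y) (hU : Convex ℝ U) :
    ∃ g, AreInverseDiffeos U ((fun x => -y x) '' U) (fun x => -y x) g :=
  H.isLocalDiffeoOn.neg.exists_areInverseDiffeos (neg_injective.comp_injOn (H.injOn hU))

theorem eqOn_fderiv {y' : Vec n → Vec n} (H : IsHessian U h y) (H' : IsHessian U h y') :
    Set.EqOn (fderiv ℝ y) (fderiv ℝ y') U := by
  intro x hx
  ext1 u
  refine ext_inner_right ℝ fun v => ?_
  rw [← H.eq x hx, ← H'.eq x hx]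

theorem exists_eq_add_const {y' : Vec n → Vec n} (H : IsHessian U h y) (H' : IsHessian U h y')
    (hU : IsPreconnected U) : ∃ C, Set.EqOn y (fun x => y' x + C) U :=
  H.isOpen.exists_eq_add_of_fderiv_eq hU (ContDiffOn.differentiableOn H.smooth (by simp))
    (ContDiffOn.differentiableOn H'.smooth (by simp)) (H.eqOn_fderiv H')

end IsHessian

theorem coordField_id (j : Fin n) :
    coordField (id : Vec n → Vec n) j = fun _ => EuclideanSpace.single j 1 := by
  funext x
  rw [coordField, fderiv_id, ContinuousLinearMap.inverse_id]
  rfl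

theorem isAffineCoordinateSystem_id (hU : IsOpen U) :
    IsAffineCoordinateSystem U flatConnection id := by
  refine ⟨⟨by simpa using hU, contDiffOn_id, Set.mapsTo_image id U, id, contDiffOn_id, ?_, ?_⟩,
    fun i j x _ => ?_⟩
  · simpa using Set.mapsTo_id U
  · exact ⟨fun _ _ => rfl, fun _ _ => rfl⟩
  · rw [coordField_id j, flatConnection]
    simp

theorem IsHessian.isDualCoordinatePair (H : IsHessian U h y) (hU : Convex ℝ U) :
    IsDualCoordinatePair U h flatConnection (pullbackFlat y) id y where
  affine := isAffineCoordinateSystem_id H.isOpen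
  affine_dual := H.isLocalDiffeoOn.isAffineCoordinateSystem (H.injOn hU)
  pairing i j z hz := by
    rw [coordField_id, H.symm z hz, H.eq z hz, coordField,
      (H.isLocalDiffeoOn.isInvertible z hz).self_apply_inverse]
    simp [EuclideanSpace.inner_single_left, PiLp.single_apply, eq_comm]

theorem IsDualCoordinatePair.isHessian
    {D D' : (Vec n → Vec n) → (Vec n → Vec n) → (Vec n → Vec n)}
    (hy : IsDualCoordinatePair U h D D' id y) (hU : IsOpen U) (hh : IsRiemannianMetric U h) :
    IsHessian U h y where
  isOpen := hU
  smooth := hy.affine_dual.1.2.1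
  symm := hh.symm
  pos := hh.pos
  eq x hx u v := by
    have hinv := (hy.affine_dual.1.isLocalDiffeoOn hU).isInvertible x hx
    -- The two bilinear forms `h x u (y'⁻¹ v)` and `⟨u, v⟩` agree on the standard basis.
    have hbasis : (h x).flip ∘L (fderiv ℝ y x).inverse = innerSL ℝ := by
      refine ContinuousLinearMap.coe_injective <|
        (EuclideanSpace.basisFun (Fin n) ℝ).toBasis.ext fun j => ?_
      refine ContinuousLinearMap.coe_injective <|
        (EuclideanSpace.basisFun (Fin n) ℝ).toBasis.ext fun i => ?_
      have hpair := hy.pairing i j x hx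
      rw [coordField_id, coordField] at hpair
      have hinner : inner ℝ (EuclideanSpace.single j (1 : ℝ)) (EuclideanSpace.single i 1)
          = if i = j then (1 : ℝ) else 0 := by
        simp [EuclideanSpace.inner_single_left, PiLp.single_apply, eq_comm]
      rw [OrthonormalBasis.coe_toBasis, EuclideanSpace.basisFun_apply,
        EuclideanSpace.basisFun_apply]
      exact hpair.trans hinner.symm
    have hu := DFunLike.congr_fun (DFunLike.congr_fun hbasis (fderiv ℝ y x u)) v
    rw [ContinuousLinearMap.comp_apply, hinv.inverse_apply_self] at hu
    exact (hh.symm x hx u v).trans hu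

section Legendre

variable {V : Set (Vec n)} {g : Vec n → Vec n} {k : Vec n → Vec n →L[ℝ] Vec n →L[ℝ] ℝ}

namespace IsHessian

theorem fderiv_fderiv_apply_of_neg (hyg : AreInverseDiffeos U V (fun x => -y x) g) {z : Vec n}
    (hz : z ∈ V) (v : Vec n) : fderiv ℝ y (g z) (fderiv ℝ g z v) = -v := by
  have hinv := hyg.fderiv_fderiv_apply_right hz v
  rwa [fderiv_fun_neg, neg_apply, neg_eq_iff_eq_neg] at hinv

theorem legendre (H : IsHessian U h y) (hyg : AreInverseDiffeos U V (fun x => -y x) g)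
    (hk : PullsBackMetric U (fun x => -y x) h k) : IsHessian V k fun z => -g z where
  isOpen := hyg.isOpen_right
  smooth := hyg.smooth_right.neg
  eq z hz u v := by
    rw [← hyg.pullsBackMetric_symm hk z hz, H.symm _ (hyg.mapsTo_right hz),
      H.eq _ (hyg.mapsTo_right hz), fderiv_fderiv_apply_of_neg hyg hz, fderiv_fun_neg,
      neg_apply, inner_neg_left, inner_neg_left, real_inner_comm]
  symm z hz u v := by
    rw [← hyg.pullsBackMetric_symm hk z hz, ← hyg.pullsBackMetric_symm hk z hz,
      H.symm _ (hyg.mapsTo_right hz)]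
  pos z hz u hu := by
    rw [← hyg.pullsBackMetric_symm hk z hz]
    refine H.pos _ (hyg.mapsTo_right hz) _ fun hzero => hu ?_
    rw [← hyg.fderiv_fderiv_apply_right hz u, hzero, map_zero]

theorem exists_pullsBackMetric (H : IsHessian U h y)
    (hyg : AreInverseDiffeos U V (fun x => -y x) g) :
    ∃ k : Vec n → Vec n →L[ℝ] Vec n →L[ℝ] ℝ, PullsBackMetric U (fun x => -y x) h k := by
  refine ⟨fun z => (innerSL ℝ).comp (-fderiv ℝ g z), fun x hx u v => ?_⟩
  simp only [ContinuousLinearMap.comp_apply, neg_apply, innerSL_apply_apply,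
    hyg.fderiv_fderiv_apply hx u]
  rw [fderiv_fun_neg, neg_apply, inner_neg_neg, real_inner_comm, ← H.eq x hx, H.symm x hx]

theorem isDuallyFlatIso (H : IsHessian U h y) (hyg : AreInverseDiffeos U V (fun x => -y x) g)
    (hk : PullsBackMetric U (fun x => -y x) h k)
    {Dk : (Vec n → Vec n) → (Vec n → Vec n) → (Vec n → Vec n)}
    (hDk : IsDualistic V k Dk flatConnection) :
    IsDuallyFlatIso U h flatConnection (pullbackFlat y) V k Dk flatConnection fun x => -y x where
  source := H.isDuallyFlat
  target := (H.legendre hyg hk).isDuallyFlat_of_isDualistic hDk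
  diffeo := hyg.isDiffeoOn
  metric := hk
  connection := by
    have hDk' : ∀ X Y, IsSmoothField V X → IsSmoothField V Y →
        Set.EqOn (pullbackFlat g X Y) (Dk X Y) V := fun X Y hX hY => by
      rw [← pullbackFlat_neg]
      exact (H.legendre hyg hk).isDuallyFlat.toIsDualistic.dual_unique hDk.symm hX hY
    exact (hyg.symm.pullsBackConnection_symm
      (hyg.symm.isLocalDiffeoOn.pullsBackConnection_pullbackFlat H.isOpen
        hyg.mapsTo_right)).congr_right hyg.mapsTo_left hDk'
  connection_dual := by
    rw [← pullbackFlat_neg]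
    exact hyg.isLocalDiffeoOn.pullsBackConnection_pullbackFlat hyg.isOpen_right hyg.mapsTo_left

theorem exists_isDualistic (H : IsHessian U h y)
    (hyg : AreInverseDiffeos U V (fun x => -y x) g) :
    ∃ k Dk, PullsBackMetric U (fun x => -y x) h k ∧ IsDualistic V k Dk flatConnection := by
  obtain ⟨k, hk⟩ := H.exists_pullsBackMetric hyg
  exact ⟨k, _, hk, (H.legendre hyg hk).isDuallyFlat.toIsDualistic.symm⟩

end IsHessian

theorem IsDualCoordinatePair.eqOn_of_image_neg_eq
    {D D' : (Vec n → Vec n) → (Vec n → Vec n) → (Vec n → Vec n)} {y₁ y₂ : Vec n → Vec n}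
    (hy₁ : IsDualCoordinatePair U h D D' id y₁) (hy₂ : IsDualCoordinatePair U h D D' id y₂)
    (hU : IsOpen U) (hconn : IsPreconnected U) (hh : IsRiemannianMetric U h)
    (himage₁ : (fun x => -y₁ x) '' U = V) (himage₂ : (fun x => -y₂ x) '' U = V)
    (hV : ¬ ∃ C : Vec n, C ≠ 0 ∧ (fun z => z + C) '' V = V) : Set.EqOn y₁ y₂ U := by
  obtain ⟨C, hC⟩ := (hy₁.isHessian hU hh).exists_eq_add_const (hy₂.isHessian hU hh) hconn
  have hinvariant : (fun z => z + -C) '' V = V := by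
    conv_lhs => rw [← himage₂, Set.image_image]
    rw [← himage₁]
    refine Set.image_congr fun x hx => ?_
    rw [hC hx, neg_add]
  have hzero : C = 0 := by
    by_contra hne
    exact hV ⟨-C, neg_ne_zero.2 hne, hinvariant⟩
  exact fun x hx => by simpa [hzero] using hC hx

end Legendre

theorem not_exists_image_add_eq_of_isBounded {S : Set (Vec n)} (hS : Bornology.IsBounded S)
    (hne : S.Nonempty) : ¬ ∃ C : Vec n, C ≠ 0 ∧ (fun z => z + C) '' S = S := by
  rintro ⟨C, hC, hSC⟩
  obtain ⟨z, hz⟩ := hne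
  obtain ⟨R, hR⟩ := hS.exists_norm_le
  have hmem : ∀ m : ℕ, z + (m : ℝ) • C ∈ S := fun m => by
    induction m with
    | zero => simpa using hz
    | succ m ih => exact hSC ▸ ⟨_, ih, by push_cast; module⟩
  obtain ⟨m, hm⟩ := exists_nat_gt ((R + ‖z‖) / ‖C‖)
  have htriangle : m * ‖C‖ ≤ ‖z + (m : ℝ) • C‖ + ‖z‖ := by
    simpa [norm_smul] using norm_sub_le (z + (m : ℝ) • C) z
  rw [div_lt_iff₀ (norm_pos_iff.2 hC)] at hm
  linarith [hR _ (hmem m)]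

end Hessian

section Thin

open Module Topology

theorem dimH_prod_univ_le {X F : Type*} [MetricSpace X] [NormedAddCommGroup F]
    [NormedSpace ℝ F] [FiniteDimensional ℝ F] {A : Set X} {P : X → F} {C : NNReal}
    (hP : AntilipschitzWith C (A.domRestrict P)) :
    dimH (A ×ˢ (Set.univ : Set ℝ)) ≤ (finrank ℝ F + 1 : ℕ) := by
  have hprod : AntilipschitzWith (max C 1) (Prod.map (A.domRestrict P) (id : ℝ → ℝ)) := by
    refine AntilipschitzWith.of_le_mul_dist fun p q => ?_
    rw [Prod.dist_eq, Prod.dist_eq]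
    refine max_le ((hP.le_mul_dist _ _).trans ?_) ?_
    · exact mul_le_mul (by simp) (le_max_left _ _) dist_nonneg (by positivity)
    · rw [← one_mul (dist p.2 q.2)]
      exact mul_le_mul (by simp) (le_max_right _ _) dist_nonneg (by positivity)
  have himage : A ×ˢ (Set.univ : Set ℝ)
      = Prod.map (Subtype.val : A → X) (id : ℝ → ℝ) '' Set.univ := by
    rw [← Set.univ_prod_univ, Set.prodMap_image_prod, Set.image_univ, Subtype.range_coe,
      Set.image_id]
  calc dimH (A ×ˢ (Set.univ : Set ℝ))
      = dimH (Set.univ : Set (A × ℝ)) := by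
        rw [himage, (isometry_subtype_coe.prodMap isometry_id).dimH_image]
    _ ≤ dimH (Prod.map (A.domRestrict P) (id : ℝ → ℝ) '' Set.univ) := hprod.le_dimH_image _
    _ ≤ dimH (Set.univ : Set (F × ℝ)) := dimH_mono (Set.subset_univ _)
    _ = (finrank ℝ F + 1 : ℕ) := by rw [Real.dimH_univ_eq_finrank, finrank_prod, finrank_self]

variable {E : Type*} [NormedAddCommGroup E] [NormedSpace ℝ E]

/-- `T` is locally a Lipschitz graph over a subset of a linear subspace of codimension at
least two: some linear map onto such a subspace has a Lipschitz inverse on a neighbourhood of each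
point of `T`. -/
def IsThin (T : Set E) : Prop :=
  ∀ s ∈ T, ∃ (L : Submodule ℝ E) (P : E →L[ℝ] L) (C : NNReal), finrank ℝ L + 2 ≤ finrank ℝ E ∧
    ∃ O ∈ 𝓝[T] s, AntilipschitzWith C (O.domRestrict P)

/-- The union of the lines through `x` and a point of `T`. -/
def lineCone (x : E) (T : Set E) : Set E :=
  (fun q : E × ℝ => x + q.2 • (q.1 - x)) '' (T ×ˢ Set.univ)

theorem subset_lineCone (x : E) (T : Set E) : T ⊆ lineCone x T :=
  fun a ha => ⟨(a, 1), ⟨ha, trivial⟩, by simp⟩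

theorem mem_lineCone_of_mem_segment {x z a : E} {T : Set E} (hx : x ∉ T) (ha : a ∈ segment ℝ x z)
    (haT : a ∈ T) : z ∈ lineCone x T := by
  rw [segment_eq_image'] at ha
  obtain ⟨c, -, rfl⟩ := ha
  have hc : c ≠ 0 := by
    rintro rfl
    exact hx (by simpa using haT)
  exact ⟨(x + c • (z - x), c⁻¹), ⟨haT, trivial⟩, by simp [smul_smul, hc]⟩

theorem lineCone_iUnion {ι : Sort*} (x : E) (T : ι → Set E) :
    lineCone x (⋃ i, T i) = ⋃ i, lineCone x (T i) := by
  simp only [lineCone, Set.iUnion_prod_const, Set.image_iUnion]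

theorem IsThin.finrank_pos {T : Set E} (hT : IsThin T) (hne : T.Nonempty) : 0 < finrank ℝ E := by
  obtain ⟨s, hs⟩ := hne
  obtain ⟨L, -, -, hL, -⟩ := hT s hs
  omega

variable [FiniteDimensional ℝ E]

theorem IsThin.dimH_lineCone_le {T : Set E} (hT : IsThin T) (x : E) :
    dimH (lineCone x T) ≤ (finrank ℝ E - 1 : ℕ) := by
  choose! L P C hL O hO hP using hT
  obtain ⟨t, htT, htc, hcov⟩ := TopologicalSpace.countable_cover_nhdsWithin hO
  have hcone : lineCone x T ⊆ ⋃ s ∈ t, lineCone x (O s) := by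
    simp only [← lineCone_iUnion]
    exact Set.image_mono (Set.prod_mono hcov le_rfl)
  refine (dimH_mono hcone).trans ?_
  rw [dimH_bUnion htc]
  refine iSup₂_le fun s hs => ?_
  have hsmooth : ContDiff ℝ 1 (fun q : E × ℝ => x + q.2 • (q.1 - x)) := by fun_prop
  have hLs := hL s (htT hs)
  calc dimH (lineCone x (O s))
      ≤ dimH (O s ×ˢ (Set.univ : Set ℝ)) :=
        hsmooth.contDiffOn.dimH_image_le convex_univ (Set.subset_univ _)
    _ ≤ (finrank ℝ (L s) + 1 : ℕ) := dimH_prod_univ_le (hP s (htT hs))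
    _ ≤ (finrank ℝ E - 1 : ℕ) := by gcongr; omega

theorem dimH_lineCone_iUnion_lt {ι : Type*} [Countable ι] {T : ι → Set E}
    (hT : ∀ i, IsThin (T i)) (hE : 0 < finrank ℝ E) (x : E) :
    dimH (lineCone x (⋃ i, T i)) < finrank ℝ E := by
  rw [lineCone_iUnion, dimH_iUnion]
  refine (iSup_le fun i => (hT i).dimH_lineCone_le x).trans_lt ?_
  exact_mod_cast Nat.sub_lt hE one_pos

theorem dense_compl_iUnion_of_isThin {ι : Type*} [Countable ι] {T : ι → Set E}
    (hT : ∀ i, IsThin (T i)) : Dense (⋃ i, T i)ᶜ := by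
  rcases Set.eq_empty_or_nonempty (⋃ i, T i) with hempty | ⟨s, hs⟩
  · rw [hempty, Set.compl_empty]
    exact dense_univ
  obtain ⟨i, hi⟩ := Set.mem_iUnion.1 hs
  exact (dense_compl_of_dimH_lt_finrank
    (dimH_lineCone_iUnion_lt hT ((hT i).finrank_pos ⟨s, hi⟩) 0)).mono
    (Set.compl_subset_compl.2 (subset_lineCone 0 _))

theorem joinedIn_diff_iUnion_of_isThin {ι : Type*} [Countable ι] {T : ι → Set E}
    (hT : ∀ i, IsThin (T i)) {B : Set E} (hconv : Convex ℝ B) (hopen : IsOpen B) {x y : E}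
    (hx : x ∈ B \ ⋃ i, T i) (hy : y ∈ B \ ⋃ i, T i) : JoinedIn (B \ ⋃ i, T i) x y := by
  rcases Set.eq_empty_or_nonempty (⋃ i, T i) with hempty | ⟨s, hs⟩
  · rw [hempty, Set.sdiff_empty]
    exact JoinedIn.of_segment_subset (hconv.segment_subset hx.1 hy.1)
  obtain ⟨i, hi⟩ := Set.mem_iUnion.1 hs
  have hE := (hT i).finrank_pos ⟨s, hi⟩
  -- A point `z` off both cones sees `x` and `y` along segments that avoid the thin sets.
  have hdense : Dense (lineCone x (⋃ i, T i) ∪ lineCone y (⋃ i, T i))ᶜ := by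
    refine dense_compl_of_dimH_lt_finrank ?_
    rw [dimH_union]
    exact max_lt (dimH_lineCone_iUnion_lt hT hE x) (dimH_lineCone_iUnion_lt hT hE y)
  obtain ⟨z, hz, hzB⟩ := hdense.exists_mem_open hopen ⟨x, hx.1⟩
  rw [Set.mem_compl_iff, Set.mem_union, not_or] at hz
  have hjoin : ∀ w ∈ B \ ⋃ i, T i, z ∉ lineCone w (⋃ i, T i) → JoinedIn (B \ ⋃ i, T i) w z :=
    fun w hw hzw => JoinedIn.of_segment_subset fun a ha =>
      ⟨hconv.segment_subset hw.1 hzB ha, fun haT => hzw (mem_lineCone_of_mem_segment hw.2 ha haT)⟩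
  exact (hjoin x hx hz.1).trans (hjoin y hy hz.2).symm

end Thin

section FixedSet

open Module Topology

variable {E : Type*} [NormedAddCommGroup E] [NormedSpace ℝ E]

theorem linearIndependent_pair_of_sq_eq_neg {J : E →ₗ[ℝ] E} (hJ : ∀ v, J (J v) = -v) {v : E}
    (hv : v ≠ 0) : LinearIndependent ℝ ![v, J v] := by
  rw [LinearIndependent.pair_iff]
  intro s t hst
  have hJst : s • J v - t • v = 0 := by
    simpa [hJ, sub_eq_add_neg] using congrArg J hst
  have hsq : (s ^ 2 + t ^ 2) • v = 0 := by
    have : (s ^ 2 + t ^ 2) • v = s • (s • v + t • J v) - t • (s • J v - t • v) := by module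
    rw [this, hst, hJst, smul_zero, smul_zero, sub_zero]
  have hzero : s ^ 2 + t ^ 2 = 0 := (smul_eq_zero.1 hsq).resolve_right hv
  constructor <;> nlinarith [sq_nonneg s, sq_nonneg t]

variable [FiniteDimensional ℝ E]

theorem finrank_ker_add_two_le {A J : E →ₗ[ℝ] E} (hJ : ∀ v, J (J v) = -v)
    (hcomm : ∀ v, A (J v) = J (A v)) (hA : A ≠ 0) :
    finrank ℝ (LinearMap.ker A) + 2 ≤ finrank ℝ E := by
  obtain ⟨v, hv⟩ := DFunLike.ne_iff.1 hA
  have hrange : Set.range ![A v, J (A v)] ⊆ LinearMap.range A := by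
    rw [Matrix.range_cons, Matrix.range_cons_empty, Set.union_subset_iff,
      Set.singleton_subset_iff, Set.singleton_subset_iff]
    exact ⟨⟨v, rfl⟩, ⟨J v, hcomm v⟩⟩
  have htwo : 2 ≤ finrank ℝ (LinearMap.range A) := by
    have hspan := Submodule.finrank_mono (Submodule.span_le.2 hrange)
    rwa [finrank_span_eq_card (linearIndependent_pair_of_sq_eq_neg hJ hv), Fintype.card_fin]
      at hspan
  have := A.finrank_range_add_finrank_ker
  omega

theorem exists_mem_nhds_antilipschitzWith {F : Type*} [NormedAddCommGroup F] [NormedSpace ℝ F]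
    {f : E → F} {f' : E →L[ℝ] F} {s : E} (hf : HasStrictFDerivAt f f' s)
    (hker : LinearMap.ker f'.toLinearMap = ⊥) :
    ∃ C, ∃ O ∈ 𝓝 s, AntilipschitzWith C (O.domRestrict f) := by
  obtain ⟨C, hC, hf'⟩ := LinearMap.exists_antilipschitzWith f'.toLinearMap hker
  obtain ⟨c, hc, hcC⟩ := exists_between (inv_pos.2 hC)
  obtain ⟨O, hO, happ⟩ := hf.approximates_deriv_on_nhds (c := c) (Or.inr hc)
  exact ⟨_, O, hO, (hf'.domRestrict O).add_sub_lipschitzWith happ.lipschitz_sub hcC⟩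

theorem isThin_of_fixed {T : Set E} {f : E → E} (hf : ∀ s ∈ T, f s = s)
    (hderiv : ∀ s ∈ T, ∃ B J : E →L[ℝ] E, HasStrictFDerivAt f B s ∧ (∀ v, J (J v) = -v) ∧
      (∀ v, B (J v) = J (B v)) ∧ B ≠ ContinuousLinearMap.id ℝ E) : IsThin T := by
  intro s hs
  obtain ⟨B, J, hB, hJ, hcomm, hne⟩ := hderiv s hs
  obtain ⟨P, hP⟩ := Submodule.ClosedComplemented.of_finiteDimensional
    (LinearMap.ker (B - ContinuousLinearMap.id ℝ E).toLinearMap)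
  have hker : LinearMap.ker (P.prod (B - ContinuousLinearMap.id ℝ E)).toLinearMap = ⊥ := by
    refine LinearMap.ker_eq_bot'.2 fun v hv => ?_
    have hPv : P v = 0 := congrArg Prod.fst hv
    have hvker : v ∈ LinearMap.ker (B - ContinuousLinearMap.id ℝ E).toLinearMap :=
      congrArg Prod.snd hv
    exact congrArg Subtype.val ((hP ⟨v, hvker⟩).symm.trans hPv)
  obtain ⟨C, O, hO, hC⟩ := exists_mem_nhds_antilipschitzWith
    (P.hasStrictFDerivAt.prodMk (hB.sub (hasStrictFDerivAt_id s))) hker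
  refine ⟨_, P, C, finrank_ker_add_two_le (J := J) hJ (fun v => ?_) fun hzero => hne ?_,
    T ∩ O, Filter.inter_mem self_mem_nhdsWithin (mem_nhdsWithin_of_mem_nhds hO), ?_⟩
  · simp [hcomm]
  · exact sub_eq_zero.1 (ContinuousLinearMap.coe_injective hzero)
  · refine AntilipschitzWith.of_le_mul_dist fun a b => ?_
    have hab : dist a b ≤ C * max (dist (P a) (P b)) (dist (f a - a) (f b - b)) :=
      hC.le_mul_dist ⟨a, a.2.2⟩ ⟨b, b.2.2⟩
    rwa [hf a a.2.1, hf b b.2.1, sub_self, sub_self, dist_self, max_eq_left dist_nonneg] at hab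

end FixedSet

section TorusTorsion

theorem exists_torsion_mem_of_isClosed_circle {G : AddSubgroup UnitAddCircle}
    (hG : IsClosed (G : Set UnitAddCircle)) {c : UnitAddCircle} (hc : c ∈ G) (hc0 : c ≠ 0) :
    ∃ a ∈ G, a ≠ 0 ∧ ∃ m : ℕ, 0 < m ∧ m • a = 0 := by
  by_cases horder : addOrderOf c = 0
  · have hdense : DenseRange (· • c : ℤ → UnitAddCircle) :=
      AddCircle.denseRange_zsmul_iff.2 horder
    have hsub : Set.range (· • c : ℤ → UnitAddCircle) ⊆ G :=
      Set.range_subset_iff.2 fun k => G.zsmul_mem hc k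
    have htop : (G : Set UnitAddCircle) = Set.univ :=
      hG.closure_eq.symm.trans (hdense.mono hsub).closure_eq
    have htwo : addOrderOf ((1 / 2 : ℝ) : UnitAddCircle) = 2 :=
      AddCircle.addOrderOf_period_div (n := 2) two_pos
    refine ⟨((1 / 2 : ℝ) : UnitAddCircle), (Set.ext_iff.1 htop _).2 trivial, fun hzero => ?_, 2,
      two_pos, htwo ▸ addOrderOf_nsmul_eq_zero _⟩
    rw [hzero, addOrderOf_zero] at htwo
    omega
  · exact ⟨c, hc, hc0, addOrderOf c, Nat.pos_of_ne_zero horder, addOrderOf_nsmul_eq_zero c⟩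

theorem exists_torsion_mem_of_isClosed {n : ℕ} {G : AddSubgroup (Torus n)}
    (hG : IsClosed (G : Set (Torus n))) {c : Torus n} (hc : c ∈ G) (hc0 : c ≠ 0) :
    ∃ a ∈ G, a ≠ 0 ∧ ∃ m : ℕ, 0 < m ∧ m • a = 0 := by
  induction n with
  | zero => exact absurd (Subsingleton.elim c 0) hc0
  | succ n ih =>
    let ι : UnitAddCircle →+ Torus (n + 1) := AddMonoidHom.single (fun _ => UnitAddCircle) 0
    let ρ : Torus (n + 1) →+ Torus n :=
      { toFun := fun a i => a i.succ, map_zero' := rfl, map_add' := fun _ _ => rfl }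
    have hι : Continuous ι := continuous_single (A := fun _ : Fin (n + 1) => UnitAddCircle) 0
    have hρ : Continuous ρ := continuous_pi fun i => continuous_apply _
    have hinj : Function.Injective ι :=
      Pi.single_injective (M := fun _ : Fin (n + 1) => UnitAddCircle) 0
    by_cases hker : ∃ d ∈ G.comap ι, d ≠ 0
    · obtain ⟨d, hd, hd0⟩ := hker
      obtain ⟨a, ha, ha0, m, hm, hma⟩ :=
        exists_torsion_mem_of_isClosed_circle (hG.preimage hι) hd hd0
      exact ⟨ι a, ha, (map_ne_zero_iff ι hinj).2 ha0, m, hm, by rw [← map_nsmul, hma, map_zero]⟩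
    · push Not at hker
      have hker_ρ : ∀ a ∈ G, ρ a = 0 → a = 0 := by
        intro a ha hρa
        have hιa : ι (a 0) = a := by
          funext i
          refine Fin.cases (by simp [ι]) (fun j => ?_) i
          have haj : a j.succ = 0 := congrFun hρa j
          simp [ι, haj]
        rw [← hιa, hker (a 0) (by rwa [AddSubgroup.mem_comap, hιa]), map_zero]
      have hclosed : IsClosed ((G.map ρ : AddSubgroup (Torus n)) : Set (Torus n)) :=
        (hG.isCompact.image hρ).isClosed
      obtain ⟨_, ⟨a, ha, rfl⟩, ha0, m, hm, hma⟩ := ih hclosed (c := ρ c) ⟨c, hc, rfl⟩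
        (mt (hker_ρ c hc) hc0)
      refine ⟨a, ha, ?_, m, hm, hker_ρ _ (G.nsmul_mem ha m) (by rwa [map_nsmul])⟩
      rintro rfl
      exact ha0 (map_zero ρ)

theorem countable_torsion (n : ℕ) : {a : Torus n | ∃ m : ℕ, 0 < m ∧ m • a = 0}.Countable := by
  have hsub : {a : Torus n | ∃ m : ℕ, 0 < m ∧ m • a = 0}
      ⊆ ⋃ m : ℕ, Set.pi Set.univ fun _ => {u : UnitAddCircle | (m + 1) • u = 0} := by
    rintro a ⟨m, hm, hma⟩
    refine Set.mem_iUnion.2 ⟨m - 1, fun i _ => ?_⟩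
    rw [Nat.sub_add_cancel hm]
    exact congrFun hma i
  exact (Set.countable_iUnion fun m => Set.Finite.countable <|
    Set.Finite.pi fun _ => AddCircle.finite_torsion (1 : ℝ) m.succ_pos).mono hsub

end TorusTorsion

section ToTorus

variable {n : ℕ}

theorem toTorus_zero : toTorus (0 : Vec n) = 0 :=
  funext fun _ => by simp [toTorus]

theorem toTorus_add (s t : Vec n) : toTorus (s + t) = toTorus s + toTorus t :=
  funext fun _ => by simp [toTorus]

theorem toTorus_eq_zero_iff {t : Vec n} : toTorus t = 0 ↔ ∃ k : Fin n → ℤ, ∀ i, t i = k i := by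
  rw [← Classical.skolem (p := fun i (k : ℤ) => t i = k), funext_iff]
  refine forall_congr' fun i => ?_
  simp only [toTorus, Pi.zero_apply, AddCircle.coe_eq_zero_iff, zsmul_eq_mul, mul_one]
  exact exists_congr fun k => eq_comm

theorem isOpenQuotientMap_toTorus : IsOpenQuotientMap (toTorus : Vec n → Torus n) :=
  (IsOpenQuotientMap.piMap (f := fun _ => ((↑) : ℝ → UnitAddCircle))
    fun _ => QuotientAddGroup.isOpenQuotientMap_mk).comp
    (EuclideanSpace.equiv (Fin n) ℝ).toHomeomorph.isOpenQuotientMap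

theorem toTorus_surjective : Function.Surjective (toTorus : Vec n → Torus n) :=
  isOpenQuotientMap_toTorus.surjective

theorem eq_zero_of_forall_toTorus_smul {ξ : Vec n} (hξ : ∀ s : ℝ, toTorus (s • ξ) = 0) :
    ξ = 0 := by
  ext i
  by_contra hi
  obtain ⟨k, hk⟩ := toTorus_eq_zero_iff.1 (hξ (1 / (2 * ξ i)))
  have hhalf : 1 / (2 * ξ i) * ξ i = 1 / 2 := by
    have : ξ i ≠ 0 := hi
    field_simp
  have hki := (hk i).symm.trans hhalf
  have : (2 * k i : ℤ) = 1 := by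
    have : 2 * (k i : ℝ) = 1 := by linarith
    exact_mod_cast this
  omega

end ToTorus

section Action

variable {n : ℕ} {E : Type*} [NormedAddCommGroup E] [NormedSpace ℝ E]
  {H : Type*} [TopologicalSpace H] {I : ModelWithCorners ℝ E H}
  {N : Type*} [AddAction (Torus n) N]

theorem toTorus_add_vadd (s t : Vec n) (q : N) :
    toTorus (s + t) +ᵥ q = toTorus s +ᵥ (toTorus t +ᵥ q) := by
  rw [toTorus_add, add_vadd]

theorem toTorus_zero_vadd (q : N) : toTorus (0 : Vec n) +ᵥ q = q := by
  rw [toTorus_zero, zero_vadd]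

variable [TopologicalSpace N] [ChartedSpace H N]

theorem contMDiff_vadd (hs : IsSmoothTorusAction n I N) (a : Torus n) :
    ContMDiff I I ∞ (fun q : N => a +ᵥ q) := by
  obtain ⟨t, rfl⟩ := toTorus_surjective a
  exact ContMDiff.comp (g := fun q : Vec n × N => toTorus q.1 +ᵥ q.2) (f := fun q : N => (t, q))
    hs (contMDiff_const.prodMk contMDiff_id)

theorem contMDiff_orbit (hs : IsSmoothTorusAction n I N) (q : N) :
    ContMDiff 𝓘(ℝ, Vec n) I ∞ (fun t : Vec n => toTorus t +ᵥ q) :=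
  ContMDiff.comp (g := fun q : Vec n × N => toTorus q.1 +ᵥ q.2) (f := fun t : Vec n => (t, q))
    hs (contMDiff_id.prodMk contMDiff_const)

theorem hasMFDerivAt_vadd (hs : IsSmoothTorusAction n I N) (a : Torus n) (q : N) :
    HasMFDerivAt I I (fun q : N => a +ᵥ q) q (mfderiv I I (fun q : N => a +ᵥ q) q) :=
  ((contMDiff_vadd hs a).mdifferentiable (by simp) q).hasMFDerivAt

theorem hasMFDerivAt_orbit_zero (hs : IsSmoothTorusAction n I N) (q : N) :
    HasMFDerivAt 𝓘(ℝ, Vec n) I (fun t : Vec n => toTorus t +ᵥ q) 0 (fundamental I q) :=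
  ((contMDiff_orbit hs q).mdifferentiable (by simp) 0).hasMFDerivAt

theorem hasMFDerivAt_orbit (hs : IsSmoothTorusAction n I N) (q : N) (t : Vec n) :
    HasMFDerivAt 𝓘(ℝ, Vec n) I (fun t : Vec n => toTorus t +ᵥ q) t
      (fundamental I (toTorus t +ᵥ q)) := by
  have htranslate : HasMFDerivAt 𝓘(ℝ, Vec n) 𝓘(ℝ, Vec n) (fun s : Vec n => s - t) t
      (ContinuousLinearMap.id ℝ (Vec n)) :=
    ((hasFDerivAt_id t).sub_const t).hasMFDerivAt
  have horbit : HasMFDerivAt 𝓘(ℝ, Vec n) I (fun s : Vec n => toTorus s +ᵥ (toTorus t +ᵥ q)) (t - t)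
      (fundamental I (toTorus t +ᵥ q)) := by
    rw [sub_self]
    exact hasMFDerivAt_orbit_zero hs _
  have hcomp : (fun s : Vec n => toTorus s +ᵥ (toTorus t +ᵥ q)) ∘ (fun s : Vec n => s - t)
      = fun s => toTorus s +ᵥ q := by
    funext s
    rw [Function.comp_apply, ← toTorus_add_vadd, sub_add_cancel]
  exact hcomp ▸ HasMFDerivAt.comp (f := fun s : Vec n => s - t) t horbit htranslate

theorem mfderiv_vadd_fundamental (hs : IsSmoothTorusAction n I N) (a : Torus n) (q : N)
    (ξ : Vec n) : mfderiv I I (fun q : N => a +ᵥ q) q (fundamental I q ξ)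
      = fundamental I (a +ᵥ q) ξ := by
  have hvadd : HasMFDerivAt I I (fun q : N => a +ᵥ q) (toTorus (0 : Vec n) +ᵥ q)
      (mfderiv I I (fun q : N => a +ᵥ q) q) := by
    rw [toTorus_zero_vadd]
    exact hasMFDerivAt_vadd hs a q
  have hcomm : (fun q : N => a +ᵥ q) ∘ (fun t : Vec n => toTorus t +ᵥ q)
      = fun t : Vec n => toTorus t +ᵥ (a +ᵥ q) := by
    funext t
    rw [Function.comp_apply, ← add_vadd, ← add_vadd, add_comm]
  have hcomp := HasMFDerivAt.comp (f := fun t : Vec n => toTorus t +ᵥ q) 0 hvadd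
    (hasMFDerivAt_orbit_zero hs q)
  rw [hcomm] at hcomp
  exact DFunLike.congr_fun (hasMFDerivAt_unique hcomp (hasMFDerivAt_orbit_zero hs (a +ᵥ q))) ξ

theorem isMIntegralCurve_orbit (hs : IsSmoothTorusAction n I N) (ξ : Vec n) (q : N) :
    IsMIntegralCurve (I := I) (fun s : ℝ => toTorus (s • ξ) +ᵥ q)
      (fun q => fundamental I q ξ) := by
  intro s
  have hline : HasMFDerivAt 𝓘(ℝ, ℝ) 𝓘(ℝ, Vec n) (fun s : ℝ => s • ξ) s
      ((1 : ℝ →L[ℝ] ℝ).smulRight ξ) :=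
    ((hasFDerivAt_id (𝕜 := ℝ) s).smul_const ξ).hasMFDerivAt
  refine (HasMFDerivAt.comp (f := fun s : ℝ => s • ξ) s (hasMFDerivAt_orbit hs q (s • ξ))
    hline).congr_mfderiv (ContinuousLinearMap.ext_ring ?_)
  exact (fundamental I (toTorus (s • ξ) +ᵥ q)).map_smul (1 : ℝ) ξ

theorem isClosed_stabilizer (hs : IsSmoothTorusAction n I N) [T2Space N] (q : N) :
    IsClosed (AddAction.stabilizer (Torus n) q : Set (Torus n)) := by
  rw [← isOpenQuotientMap_toTorus.isQuotientMap.isClosed_preimage]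
  exact isClosed_eq (contMDiff_orbit hs q).continuous continuous_const

theorem mfderiv_action_apply_left (hs : IsSmoothTorusAction n I N) (ξ : Vec n) (q : N) :
    (mfderiv (𝓘(ℝ, Vec n).prod I) I (fun q : Vec n × N => toTorus q.1 +ᵥ q.2) (0, q) (ξ, 0) : E)
      = fundamental I q ξ := by
  have haction : MDifferentiableAt (𝓘(ℝ, Vec n).prod I) I
      (fun q : Vec n × N => toTorus q.1 +ᵥ q.2) (0, q) := hs.mdifferentiable (by simp) _
  have hcomp := mfderiv_comp (f := fun t : Vec n => (t, q)) (0 : Vec n) haction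
    (mdifferentiableAt_id.prodMk mdifferentiableAt_const)
  rw [mfderiv_prod_left] at hcomp
  exact (DFunLike.congr_fun hcomp ξ).symm

theorem isSmoothVectorField_fundamental [IsManifold I ∞ N] (hs : IsSmoothTorusAction n I N)
    (ξ : Vec n) : IsSmoothVectorField (I := I) (fun q : N => fundamental I q ξ) := by
  have : IsManifold I 1 N := .of_le (n := ∞) (by simp)
  have : IsManifold I (∞ + 1) N := .of_le (n := ∞) (by simp)
  -- The field is the image of the section `q ↦ (ξ, 0)` over `q ↦ (0, q)` under the tangent map of
  -- the action.
  have hsection : ContMDiff I (𝓘(ℝ, Vec n).prod I).tangent ∞ (fun q : N =>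
      (equivTangentBundleProd 𝓘(ℝ, Vec n) (Vec n) I N).symm
        ((⟨(0 : Vec n), ξ⟩ : TangentBundle 𝓘(ℝ, Vec n) (Vec n)),
          (⟨q, 0⟩ : TangentBundle I N))) :=
    (contMDiff_equivTangentBundleProd_symm (n := ∞)).comp
      (contMDiff_const.prodMk (Bundle.contMDiff_zeroSection ℝ (TangentSpace I)))
  refine ((ContMDiff.contMDiff_tangentMap (m := ∞) hs (by simp)).comp hsection).congr fun q => ?_
  change (⟨q, fundamental I q ξ⟩ : TangentBundle I N) = ⟨toTorus (0 : Vec n) +ᵥ q,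
    mfderiv (𝓘(ℝ, Vec n).prod I) I (fun q : Vec n × N => toTorus q.1 +ᵥ q.2) (0, q) (ξ, 0)⟩
  rw [mfderiv_action_apply_left hs]
  exact congrArg (fun z : N => (⟨z, (fundamental I q ξ : E)⟩ : TangentBundle I N))
    (toTorus_zero_vadd q).symm

end Action

section Chart

open Topology

variable {E : Type*} [NormedAddCommGroup E] [NormedSpace ℝ E]
  {H : Type*} [TopologicalSpace H] {I : ModelWithCorners ℝ E H}
  {N : Type*} [TopologicalSpace N] [ChartedSpace H N]

/-- The derivative at `r` of the extended chart at `q`, as an endomorphism of the model space. -/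
noncomputable def dchart (I : ModelWithCorners ℝ E H) (q r : N) : E →L[ℝ] E :=
  mfderiv I 𝓘(ℝ, E) (extChartAt I q) r

/-- The derivative at `z` of the inverse of the extended chart at `q`, as an endomorphism of the
model space. -/
noncomputable def dchartSymm (I : ModelWithCorners ℝ E H) (q : N) (z : E) : E →L[ℝ] E :=
  mfderiv 𝓘(ℝ, E) I (extChartAt I q).symm z

/-- The expression of the vector field `V` in the extended chart at `q`. -/
noncomputable def chartField (q : N) (V : (p : N) → TangentSpace I p) (z : E) : E :=
  dchart I q ((extChartAt I q).symm z) (V ((extChartAt I q).symm z))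

variable [IsManifold I ∞ N]

theorem contMDiffAt_chart (q : N) {r : N} (hr : r ∈ (extChartAt I q).source) :
    ContMDiffAt I 𝓘(ℝ, E) ∞ (extChartAt I q) r :=
  contMDiffAt_extChartAt' (by rwa [extChartAt_source] at hr)

theorem hasMFDerivAt_chart (q : N) {r : N} (hr : r ∈ (extChartAt I q).source) :
    HasMFDerivAt I 𝓘(ℝ, E) (extChartAt I q) r (dchart I q r :) :=
  ((contMDiffAt_chart q hr).mdifferentiableAt (by simp)).hasMFDerivAt

theorem hasDerivAt_chart_comp (q : N) {γ : ℝ → N} {t : ℝ} {v : E}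
    (hγ : HasMFDerivAt 𝓘(ℝ, ℝ) I γ t ((1 : ℝ →L[ℝ] ℝ).smulRight v :))
    (ht : γ t ∈ (extChartAt I q).source) :
    HasDerivAt (fun s => extChartAt I q (γ s)) (dchart I q (γ t) v) t := by
  have hcomp : HasFDerivAt (fun s => extChartAt I q (γ s))
      (dchart I q (γ t) ∘L (1 : ℝ →L[ℝ] ℝ).smulRight v) t :=
    ((hasMFDerivAt_chart q ht).comp t hγ).hasFDerivAt
  refine hcomp.hasDerivAt.congr_deriv ?_
  change dchart I q (γ t) ((1 : ℝ) • v) = _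
  rw [one_smul]

variable [I.Boundaryless]

theorem contMDiffAt_chart_symm (q : N) {z : E} (hz : z ∈ (extChartAt I q).target) :
    ContMDiffAt 𝓘(ℝ, E) I ∞ (extChartAt I q).symm z :=
  (contMDiffOn_extChartAt_symm q).contMDiffAt ((isOpen_extChartAt_target q).mem_nhds hz)

theorem hasMFDerivAt_chart_symm (q : N) {z : E} (hz : z ∈ (extChartAt I q).target) :
    HasMFDerivAt 𝓘(ℝ, E) I (extChartAt I q).symm z (dchartSymm I q z :) :=
  ((contMDiffAt_chart_symm q hz).mdifferentiableAt (by simp)).hasMFDerivAt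

theorem hasFDerivAt_chart_conj (q : N) {f : N → N} {z : E} {D : E →L[ℝ] E}
    (hz : z ∈ (extChartAt I q).target)
    (hf : HasMFDerivAt I I f ((extChartAt I q).symm z) D)
    (hfz : f ((extChartAt I q).symm z) ∈ (extChartAt I q).source) :
    HasFDerivAt (fun w => extChartAt I q (f ((extChartAt I q).symm w)))
      (dchart I q (f ((extChartAt I q).symm z)) ∘L D ∘L dchartSymm I q z) z :=
  (((hasMFDerivAt_chart q hfz).comp ((extChartAt I q).symm z) hf).comp z
    (hasMFDerivAt_chart_symm q hz)).hasFDerivAt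

theorem contDiffAt_chart_conj (q : N) {f : N → N} {z : E}
    (hz : z ∈ (extChartAt I q).target) (hf : ContMDiffAt I I ∞ f ((extChartAt I q).symm z))
    (hfz : f ((extChartAt I q).symm z) ∈ (extChartAt I q).source) :
    ContDiffAt ℝ ∞ (fun w => extChartAt I q (f ((extChartAt I q).symm w))) z :=
  contMDiffAt_iff_contDiffAt.1
    (((contMDiffAt_chart q hfz).comp ((extChartAt I q).symm z) hf).comp z
      (contMDiffAt_chart_symm q hz))

theorem dchart_dchartSymm (q : N) {z : E} (hz : z ∈ (extChartAt I q).target) (v : E) :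
    dchart I q ((extChartAt I q).symm z) (dchartSymm I q z v) = v := by
  have : IsManifold I 1 N := .of_le (n := ∞) (by simp)
  have hcomp := mfderiv_extChartAt_comp_mfderivWithin_extChartAt_symm (I := I) hz
  rw [I.range_eq_univ, mfderivWithin_univ] at hcomp
  exact DFunLike.congr_fun hcomp v

theorem dchartSymm_dchart (q : N) {z : E} (hz : z ∈ (extChartAt I q).target) (v : E) :
    dchartSymm I q z (dchart I q ((extChartAt I q).symm z) v) = v := by
  have : IsManifold I 1 N := .of_le (n := ∞) (by simp)
  have hcomp := mfderivWithin_extChartAt_symm_comp_mfderiv_extChartAt (I := I) hz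
  rw [I.range_eq_univ, mfderivWithin_univ] at hcomp
  exact DFunLike.congr_fun hcomp v

theorem dchartSymm_dchart' (q : N) {r : N} (hr : r ∈ (extChartAt I q).source) (v : E) :
    dchartSymm I q (extChartAt I q r) (dchart I q r v) = v := by
  have hinv := dchartSymm_dchart (I := I) q ((extChartAt I q).map_source hr) v
  rwa [(extChartAt I q).left_inv hr] at hinv

theorem isInvertible_dchartSymm (q : N) {z : E} (hz : z ∈ (extChartAt I q).target) :
    (dchartSymm I q z).IsInvertible :=
  ContinuousLinearMap.IsInvertible.of_inverse (g := dchart I q ((extChartAt I q).symm z))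
    (ContinuousLinearMap.ext fun v => dchartSymm_dchart q hz v)
    (ContinuousLinearMap.ext fun v => dchart_dchartSymm q hz v)

theorem dchartSymm_chartField (q : N) (V : (p : N) → TangentSpace I p) {z : E}
    (hz : z ∈ (extChartAt I q).target) :
    dchartSymm I q z (chartField q V z) = V ((extChartAt I q).symm z) :=
  dchartSymm_dchart q hz _

theorem mpullback_eventuallyEq_chartField (q : N) (V : (p : N) → TangentSpace I p) {z : E}
    (hz : z ∈ (extChartAt I q).target) :
    VectorField.mpullback 𝓘(ℝ, E) I (extChartAt I q).symm V =ᶠ[𝓝 z] chartField q V := by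
  filter_upwards [(isOpen_extChartAt_target q).mem_nhds hz] with w hw
  exact (congrArg (dchartSymm I q w).inverse (dchartSymm_chartField q V hw)).symm.trans
    ((isInvertible_dchartSymm q hw).inverse_apply_self (chartField q V w))

theorem contDiffOn_chartField [CompleteSpace E] (q : N) {V : (p : N) → TangentSpace I p}
    (hV : IsSmoothVectorField V) :
    ContDiffOn ℝ ∞ (chartField q V) (extChartAt I q).target := by
  intro z hz
  have hpullback := ContMDiffAt.mpullback_vectorField_preimage (m := ∞) (n := ∞)
    (hV ((extChartAt I q).symm z)) (contMDiffAt_chart_symm q hz)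
    (isInvertible_dchartSymm (I := I) q hz :) (by simp)
  have hsmooth := contMDiffAt_iff_contDiffAt.1
    ((contMDiff_snd_tangentBundle_modelSpace (n := ∞) E 𝓘(ℝ, E)).contMDiffAt.comp z hpullback)
  exact (hsmooth.congr_of_eventuallyEq
    (mpullback_eventuallyEq_chartField q V hz).symm).contDiffWithinAt

theorem lieBracket_chartField [CompleteSpace E] (q : N) {V W : (p : N) → TangentSpace I p}
    (hV : IsSmoothVectorField V) (hW : IsSmoothVectorField W) {z : E}
    (hz : z ∈ (extChartAt I q).target) :
    VectorField.lieBracket ℝ (chartField q V) (chartField q W) z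
      = chartField q (VectorField.mlieBracket I V W) z := by
  have hle : minSmoothness ℝ 3 ≤ ∞ := by
    rw [minSmoothness_of_isRCLikeNormedField]
    exact ENat.LEInfty.out
  have : IsManifold I (minSmoothness ℝ 3) N := .of_le (n := ∞) hle
  have hmodel : ∀ V' W' : E → E, VectorField.mlieBracket 𝓘(ℝ, E) V' W' z
      = VectorField.lieBracket ℝ V' W' z := fun V' W' => by
    rw [← VectorField.lieBracketWithin_univ]
    exact congrFun (VectorField.mlieBracketWithin_eq_lieBracketWithin (s := Set.univ)) z
  have hpullback := VectorField.mpullback_mlieBracket (n := ∞) ((hV _).mdifferentiableAt (by simp))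
    ((hW _).mdifferentiableAt (by simp)) (contMDiffAt_chart_symm q hz)
    ((minSmoothness_monotone (by norm_num)).trans hle)
  exact ((mpullback_eventuallyEq_chartField q V hz).symm.lieBracket_vectorField_eq
    (mpullback_eventuallyEq_chartField q W hz).symm).trans ((hmodel _ _).symm.trans
    (hpullback.symm.trans (mpullback_eventuallyEq_chartField q _ hz).eq_of_nhds))

theorem chartField_eq_zero_iff (q : N) (V : (p : N) → TangentSpace I p) {z : E}
    (hz : z ∈ (extChartAt I q).target) :
    chartField q V z = 0 ↔ V ((extChartAt I q).symm z) = 0 := by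
  refine ⟨fun hzero => ?_, fun hzero => ?_⟩
  · exact (dchartSymm_chartField q V hz).symm.trans (hzero ▸ map_zero (dchartSymm I q z))
  · rw [chartField, hzero]
    exact map_zero (dchart I q _)

end Chart

section FlowBracket

open Topology

variable {E : Type*} [NormedAddCommGroup E] [NormedSpace ℝ E]

theorem lieBracket_eq_zero_of_flow {G : ℝ × E → E} {V W : E → E} {z₀ : E}
    (hG : ContDiffAt ℝ 2 G (0, z₀)) (hG0 : G (0, z₀) = z₀)
    (hV : ∀ᶠ z in 𝓝 z₀, V z = fderiv ℝ G (0, z) (1, 0)) (hW : DifferentiableAt ℝ W z₀)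
    (hinv : ∀ᶠ t in 𝓝 (0 : ℝ), W (G (t, z₀)) = fderiv ℝ G (t, z₀) (0, W z₀)) :
    VectorField.lieBracket ℝ V W z₀ = 0 := by
  have hG' : HasFDerivAt (fderiv ℝ G) (fderiv ℝ (fderiv ℝ G) (0, z₀)) (0, z₀) :=
    ((hG.fderiv_right (m := 1) (by norm_num)).differentiableAt (by simp)).hasFDerivAt
  have hGd : HasFDerivAt G (fderiv ℝ G (0, z₀)) (0, z₀) :=
    (hG.differentiableAt (by simp)).hasFDerivAt
  have hline : HasDerivAt (fun t : ℝ => (t, z₀)) ((1 : ℝ), (0 : E)) 0 :=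
    (hasDerivAt_id (0 : ℝ)).prodMk (hasDerivAt_const 0 z₀)
  have hV' : fderiv ℝ V z₀ (W z₀) = fderiv ℝ (fderiv ℝ G) (0, z₀) (0, W z₀) (1, 0) := by
    have hd := (hG'.comp z₀ (hasFDerivAt_prodMk_right 0 z₀)).clm_apply
      (hasFDerivAt_const ((1 : ℝ), (0 : E)) z₀)
    have hVeq : V =ᶠ[𝓝 z₀] fun z => (fderiv ℝ G ∘ fun z : E => ((0 : ℝ), z)) z (1, 0) := hV
    rw [hVeq.fderiv_eq, hd.fderiv]
    simp
  have hWflow : HasDerivAt (fun t : ℝ => W (G (t, z₀))) (fderiv ℝ W z₀ (V z₀)) 0 := by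
    have hflow : HasDerivAt (fun t : ℝ => G (t, z₀)) (V z₀) 0 := by
      rw [hV.self_of_nhds]
      exact hGd.comp_hasDerivAt (0 : ℝ) hline
    have hWd : HasFDerivAt W (fderiv ℝ W z₀) (G (0, z₀)) := hG0.symm ▸ hW.hasFDerivAt
    exact hWd.comp_hasDerivAt (0 : ℝ) hflow
  have hinv' : HasDerivAt (fun t : ℝ => fderiv ℝ G (t, z₀) (0, W z₀))
      (fderiv ℝ (fderiv ℝ G) (0, z₀) (1, 0) (0, W z₀)) 0 := by
    have hfderiv := hG'.comp_hasDerivAt (0 : ℝ) hline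
    simpa using hfderiv.clm_apply (hasDerivAt_const (0 : ℝ) ((0 : ℝ), W z₀))
  have hW' : fderiv ℝ W z₀ (V z₀) = fderiv ℝ (fderiv ℝ G) (0, z₀) (1, 0) (0, W z₀) :=
    hWflow.unique (hinv'.congr_of_eventuallyEq hinv)
  rw [VectorField.lieBracket, hW', hV', (hG.isSymmSndFDerivAt (by simp)).eq, sub_self]

end FlowBracket

section Brackets

open Topology

variable {n : ℕ} {E : Type*} [NormedAddCommGroup E] [NormedSpace ℝ E]
  {H : Type*} [TopologicalSpace H] {I : ModelWithCorners ℝ E H}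
  {N : Type*} [TopologicalSpace N] [ChartedSpace H N] [AddAction (Torus n) N]

variable (I) in
/-- The action of the one-parameter subgroup generated by `ξ`, read in the chart at `q` as a map
of time and position. -/
noncomputable def chartAction (q : N) (ξ : Vec n) (p : ℝ × E) : E :=
  extChartAt I q (toTorus (p.1 • ξ) +ᵥ (extChartAt I q).symm p.2)

theorem chartAction_zero (q : N) (ξ : Vec n) {z : E} (hz : z ∈ (extChartAt I q).target) :
    chartAction I q ξ (0, z) = z := by
  rw [chartAction, zero_smul, toTorus_zero_vadd, (extChartAt I q).right_inv hz]

variable [IsManifold I ∞ N]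

theorem contDiffAt_chartAction [I.Boundaryless] (hs : IsSmoothTorusAction n I N) (q : N)
    (ξ : Vec n) {p : ℝ × E} (hp : p.2 ∈ (extChartAt I q).target)
    (hpq : toTorus (p.1 • ξ) +ᵥ (extChartAt I q).symm p.2 ∈ (extChartAt I q).source) :
    ContDiffAt ℝ ∞ (chartAction I q ξ) p := by
  have htime : ContMDiffAt 𝓘(ℝ, ℝ × E) 𝓘(ℝ, Vec n) ∞ (fun p : ℝ × E => p.1 • ξ) p :=
    (ContDiff.contMDiff (by fun_prop)).contMDiffAt
  have hposition : ContMDiffAt 𝓘(ℝ, ℝ × E) I ∞ (fun p : ℝ × E => (extChartAt I q).symm p.2) p :=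
    (contMDiffAt_chart_symm q hp).comp p contDiff_snd.contMDiff.contMDiffAt
  have haction : ContMDiffAt 𝓘(ℝ, ℝ × E) I ∞
      (fun p : ℝ × E => toTorus (p.1 • ξ) +ᵥ (extChartAt I q).symm p.2) p :=
    hs.contMDiffAt.comp p (htime.prodMk hposition)
  exact contMDiffAt_iff_contDiffAt.1 ((contMDiffAt_chart q hpq).comp p haction)

theorem hasFDerivAt_chartAction [I.Boundaryless] (hs : IsSmoothTorusAction n I N) (q : N)
    (ξ : Vec n) {p : ℝ × E} (hp : p.2 ∈ (extChartAt I q).target)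
    (hpq : toTorus (p.1 • ξ) +ᵥ (extChartAt I q).symm p.2 ∈ (extChartAt I q).source) :
    HasFDerivAt (chartAction I q ξ) (fderiv ℝ (chartAction I q ξ) p) p :=
  ((contDiffAt_chartAction hs q ξ hp hpq).differentiableAt (by simp)).hasFDerivAt

theorem fderiv_chartAction_time [I.Boundaryless] (hs : IsSmoothTorusAction n I N) (q : N)
    (ξ : Vec n) {z : E} (hz : z ∈ (extChartAt I q).target) :
    fderiv ℝ (chartAction I q ξ) (0, z) (1, 0)
      = chartField q (fun q' => fundamental I q' ξ) z := by
  have hzero : toTorus ((0 : ℝ) • ξ) +ᵥ (extChartAt I q).symm z = (extChartAt I q).symm z := by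
    rw [zero_smul, toTorus_zero_vadd]
  have hsource : toTorus ((0 : ℝ) • ξ) +ᵥ (extChartAt I q).symm z ∈ (extChartAt I q).source :=
    Set.mem_of_eq_of_mem hzero ((extChartAt I q).map_target hz)
  have hline : HasDerivAt (fun t : ℝ => (t, z)) ((1 : ℝ), (0 : E)) 0 :=
    (hasDerivAt_id (0 : ℝ)).prodMk (hasDerivAt_const 0 z)
  have hpartial := (hasFDerivAt_chartAction hs q ξ (p := (0, z)) hz hsource).comp_hasDerivAt
    (0 : ℝ) hline
  have horbit := hasDerivAt_chart_comp q
    (isMIntegralCurve_orbit hs ξ ((extChartAt I q).symm z) 0) hsource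
  exact (hpartial.unique horbit).trans
    (congrArg (fun r : N => dchart I q r (fundamental I r ξ : E)) hzero)

theorem fderiv_chartAction_space [I.Boundaryless] (hs : IsSmoothTorusAction n I N) (q : N)
    (ξ : Vec n) {t : ℝ} {z : E} (hz : z ∈ (extChartAt I q).target)
    (htz : toTorus (t • ξ) +ᵥ (extChartAt I q).symm z ∈ (extChartAt I q).source) (v : E) :
    fderiv ℝ (chartAction I q ξ) (t, z) (0, v)
      = dchart I q (toTorus (t • ξ) +ᵥ (extChartAt I q).symm z)
        (mfderiv I I (fun q : N => toTorus (t • ξ) +ᵥ q) ((extChartAt I q).symm z)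
          (dchartSymm I q z v : E)) := by
  have hpartial := (hasFDerivAt_chartAction hs q ξ (p := (t, z)) hz htz).comp z
    (hasFDerivAt_prodMk_right t z)
  exact DFunLike.congr_fun (hpartial.unique (hasFDerivAt_chart_conj (I := I) q hz
    (hasMFDerivAt_vadd hs (toTorus (t • ξ)) ((extChartAt I q).symm z)) htz)) v

theorem chartField_chartAction [I.Boundaryless] (hs : IsSmoothTorusAction n I N) (q : N)
    (ξ : Vec n) {W : (p : N) → TangentSpace I p}
    (hinv : ∀ (a : Torus n) (q : N), mfderiv I I (fun q : N => a +ᵥ q) q (W q) = W (a +ᵥ q))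
    {t : ℝ} {z : E} (hz : z ∈ (extChartAt I q).target)
    (htz : toTorus (t • ξ) +ᵥ (extChartAt I q).symm z ∈ (extChartAt I q).source) :
    chartField q W (chartAction I q ξ (t, z))
      = fderiv ℝ (chartAction I q ξ) (t, z) (0, chartField q W z) := by
  have hflow : (extChartAt I q).symm (chartAction I q ξ (t, z))
      = toTorus (t • ξ) +ᵥ (extChartAt I q).symm z := (extChartAt I q).left_inv htz
  have hpush : mfderiv I I (fun q : N => toTorus (t • ξ) +ᵥ q) ((extChartAt I q).symm z)
      (dchartSymm I q z (chartField q W z) : E)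
      = W (toTorus (t • ξ) +ᵥ (extChartAt I q).symm z) :=
    (congrArg (fun v : E => (mfderiv I I (fun q : N => toTorus (t • ξ) +ᵥ q)
      ((extChartAt I q).symm z) v : E)) (dchartSymm_chartField q W hz)).trans (hinv _ _)
  rw [fderiv_chartAction_space hs q ξ hz htz]
  exact (congrArg (fun r : N => dchart I q r (W r : E)) hflow).trans
    (congrArg (dchart I q (toTorus (t • ξ) +ᵥ (extChartAt I q).symm z)) hpush.symm)

theorem mlieBracket_fundamental_eq_zero [CompleteSpace E] [I.Boundaryless]
    (hs : IsSmoothTorusAction n I N) (ξ : Vec n)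
    {W : (p : N) → TangentSpace I p} (hW : IsSmoothVectorField W)
    (hinv : ∀ (a : Torus n) (q : N), mfderiv I I (fun q : N => a +ᵥ q) q (W q) = W (a +ᵥ q))
    (q : N) : VectorField.mlieBracket I (fun q => fundamental I q ξ) W q = 0 := by
  have hq : extChartAt I q q ∈ (extChartAt I q).target := mem_extChartAt_target q
  have hzero : toTorus ((0 : ℝ) • ξ) +ᵥ q = q := by rw [zero_smul, toTorus_zero_vadd]
  have hchart := (isOpen_extChartAt_target (I := I) q).mem_nhds hq
  have hsource : ∀ᶠ t in 𝓝 (0 : ℝ), toTorus (t • ξ) +ᵥ q ∈ (extChartAt I q).source :=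
    (isMIntegralCurve_orbit hs ξ q).continuous.continuousAt.eventually_mem
      ((isOpen_extChartAt_source q).mem_nhds (hzero.symm ▸ mem_extChartAt_source q))
  have hbracket := lieBracket_eq_zero_of_flow (G := chartAction I q ξ)
    ((contDiffAt_chartAction hs q ξ (p := (0, extChartAt I q q)) hq
      (by simpa only [extChartAt_to_inv] using hsource.self_of_nhds)).of_le ENat.LEInfty.out)
    (chartAction_zero q ξ hq)
    (by filter_upwards [hchart] with z hz using (fderiv_chartAction_time hs q ξ hz).symm)
    (((contDiffOn_chartField q hW).contDiffAt hchart).differentiableAt (by simp))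
    (by
      filter_upwards [hsource] with t ht using
        chartField_chartAction hs q ξ hinv hq (by rwa [extChartAt_to_inv]))
  rw [lieBracket_chartField q (isSmoothVectorField_fundamental hs ξ) hW hq,
    chartField_eq_zero_iff q _ hq] at hbracket
  rwa [extChartAt_to_inv] at hbracket

variable (K : KahlerStructure I N)

theorem isSmoothVectorField_J {V : (p : N) → TangentSpace I p} (hV : IsSmoothVectorField V) :
    IsSmoothVectorField (fun q => K.J q (V q)) :=
  ContMDiff.clm_bundle_apply K.J_smooth hV

/-- The infinitesimal action of the complexified torus: `(x, r)` acts by `-J x_N + r_N`. -/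
noncomputable def complexFundamental (q : N) : Vec n × Vec n →L[ℝ] TangentSpace I q :=
  (-(K.J q ∘L fundamental I q)).coprod (fundamental I q)

theorem complexFundamental_apply (q : N) (c : Vec n × Vec n) :
    complexFundamental K q c = -(K.J q (fundamental I q c.1)) + fundamental I q c.2 :=
  rfl

theorem complexFundamental_eq (c : Vec n × Vec n) :
    (fun q : N => complexFundamental K q c)
      = ((-1 : ℝ) • fun q => K.J q (fundamental I q c.1)) + fun q => fundamental I q c.2 := by
  funext q
  rw [complexFundamental_apply, ← neg_one_smul ℝ]
  rfl

theorem isSmoothVectorField_complexFundamental (hs : IsSmoothTorusAction n I N)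
    (c : Vec n × Vec n) : IsSmoothVectorField (fun q : N => complexFundamental K q c) := by
  rw [complexFundamental_eq]
  exact ContMDiff.add_section (ContMDiff.const_smul_section
    (isSmoothVectorField_J K (isSmoothVectorField_fundamental hs c.1)))
    (isSmoothVectorField_fundamental hs c.2)

variable [CompleteSpace E] [I.Boundaryless]

theorem mlieBracket_fundamental_fundamental (hs : IsSmoothTorusAction n I N) (ξ η : Vec n)
    (q : N) : VectorField.mlieBracket I (fun q => fundamental I q ξ)
      (fun q => fundamental I q η) q = 0 :=
  mlieBracket_fundamental_eq_zero hs ξ (isSmoothVectorField_fundamental hs η)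
    (fun a q => mfderiv_vadd_fundamental hs a q η) q

theorem mlieBracket_fundamental_J_fundamental (hs : IsSmoothTorusAction n I N)
    (hhol : IsHolomorphicAction K n) (ξ η : Vec n) (q : N) :
    VectorField.mlieBracket I (fun q => fundamental I q ξ)
      (fun q => K.J q (fundamental I q η)) q = 0 := by
  refine mlieBracket_fundamental_eq_zero hs ξ
    (isSmoothVectorField_J K (isSmoothVectorField_fundamental hs η)) (fun a q => ?_) q
  rw [hhol a q, mfderiv_vadd_fundamental hs]

theorem mlieBracket_J_fundamental_fundamental (hs : IsSmoothTorusAction n I N)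
    (hhol : IsHolomorphicAction K n) (ξ η : Vec n) (q : N) :
    VectorField.mlieBracket I (fun q => K.J q (fundamental I q ξ))
      (fun q => fundamental I q η) q = 0 := by
  rw [VectorField.mlieBracket_swap_apply, mlieBracket_fundamental_J_fundamental K hs hhol,
    neg_zero]

theorem mlieBracket_J_fundamental_J_fundamental (hs : IsSmoothTorusAction n I N)
    (hhol : IsHolomorphicAction K n) (ξ η : Vec n) (q : N) :
    VectorField.mlieBracket I (fun q => K.J q (fundamental I q ξ))
      (fun q => K.J q (fundamental I q η)) q = 0 := by
  have hnijenhuis := K.integrable _ _ (isSmoothVectorField_fundamental hs ξ)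
    (isSmoothVectorField_fundamental hs η) q
  rw [mlieBracket_fundamental_J_fundamental K hs hhol,
    mlieBracket_fundamental_fundamental hs ξ η,
    mlieBracket_J_fundamental_fundamental K hs hhol] at hnijenhuis
  simpa using hnijenhuis

theorem mlieBracket_complexFundamental (hs : IsSmoothTorusAction n I N)
    (hhol : IsHolomorphicAction K n) (c d : Vec n × Vec n) (q : N) :
    VectorField.mlieBracket I (fun q => complexFundamental K q c)
      (fun q => complexFundamental K q d) q = 0 := by
  have : IsManifold I 2 N := .of_le (n := ∞) ENat.LEInfty.out
  have hX : ∀ ξ : Vec n, MDifferentiableAt I I.tangent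
      (fun p : N => (⟨p, fundamental I p ξ⟩ : TangentBundle I N)) q := fun ξ =>
    (isSmoothVectorField_fundamental hs ξ q).mdifferentiableAt (by simp)
  have hJX := fun ξ => isSmoothVectorField_J K (isSmoothVectorField_fundamental hs ξ)
  have hJ : ∀ ξ : Vec n, MDifferentiableAt I I.tangent
      (fun p : N => (⟨p, K.J p (fundamental I p ξ)⟩ : TangentBundle I N)) q := fun ξ =>
    (hJX ξ q).mdifferentiableAt (by simp)
  have hnegJ : ∀ ξ : Vec n, MDifferentiableAt I I.tangent (fun p : N =>
      (⟨p, ((-1 : ℝ) • fun q => K.J q (fundamental I q ξ)) p⟩ : TangentBundle I N)) q := fun ξ =>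
    (ContMDiff.const_smul_section (hJX ξ) q).mdifferentiableAt (by simp)
  rw [complexFundamental_eq, complexFundamental_eq,
    VectorField.mlieBracket_add_left (hnegJ _) (hX _),
    VectorField.mlieBracket_add_right (hnegJ _) (hX _),
    VectorField.mlieBracket_add_right (hnegJ _) (hX _),
    VectorField.mlieBracket_const_smul_left (hJ _), VectorField.mlieBracket_const_smul_left (hJ _),
    VectorField.mlieBracket_const_smul_right (hJ _),
    VectorField.mlieBracket_const_smul_right (hJ _),
    mlieBracket_fundamental_fundamental hs, mlieBracket_fundamental_J_fundamental K hs hhol,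
    mlieBracket_J_fundamental_fundamental K hs hhol,
    mlieBracket_J_fundamental_J_fundamental K hs hhol]
  simp

end Brackets

section Flattening

open Topology

variable {E F : Type*} [NormedAddCommGroup E] [NormedSpace ℝ E]
  [NormedAddCommGroup F] [NormedSpace ℝ F]

theorem eventually_isInvertible [CompleteSpace F] {X : Type*} [TopologicalSpace X]
    {A : X → F →L[ℝ] E} {x₀ : X} (hA : ContinuousAt A x₀) (hinv : (A x₀).IsInvertible) :
    ∀ᶠ x in 𝓝 x₀, (A x).IsInvertible := by
  obtain ⟨e, he⟩ := hinv
  exact hA.eventually_mem (s := Set.range ((↑) : (F ≃L[ℝ] E) → F →L[ℝ] E)) (he ▸ e.nhds)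

theorem contDiffAt_inverse [CompleteSpace F] {A : E → F →L[ℝ] E} {z : E} {m : WithTop ℕ∞}
    (hA : ContDiffAt ℝ m A z) (hinv : (A z).IsInvertible) :
    ContDiffAt ℝ m (fun w => (A w).inverse) z := by
  obtain ⟨e, he⟩ := hinv
  exact ContDiffAt.comp (g := ContinuousLinearMap.inverse) z (he ▸ contDiffAt_map_inverse e) hA

theorem fderiv_inverse_apply [CompleteSpace F] {A : E → F →L[ℝ] E} {z : E}
    (hA : DifferentiableAt ℝ A z) (hinv : (A z).IsInvertible) (c : F) (u : E) :
    fderiv ℝ (fun w => (A w).inverse) z u (A z c)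
      = -(A z).inverse (fderiv ℝ (fun w => A w c) z u) := by
  have hθ : DifferentiableAt ℝ (fun w => (A w).inverse) z := by
    obtain ⟨e, he⟩ := hinv
    have h : DifferentiableAt ℝ ContinuousLinearMap.inverse (A z) :=
      he ▸ (contDiffAt_map_inverse (n := 1) e).differentiableAt (by simp)
    exact h.comp z hA
  have hconst : (fun w => (A w).inverse (A w c)) =ᶠ[𝓝 z] fun _ => c := by
    filter_upwards [eventually_isInvertible hA.continuousAt hinv] with w hw using
      hw.inverse_apply_self c
  have hzero := (hθ.hasFDerivAt.clm_apply
    (hA.clm_apply (differentiableAt_const c)).hasFDerivAt).unique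
    ((hasFDerivAt_const c z).congr_of_eventuallyEq hconst)
  have hzero_apply := DFunLike.congr_fun hzero u
  simp only [add_apply, ContinuousLinearMap.comp_apply, ContinuousLinearMap.flip_apply,
    zero_apply] at hzero_apply
  exact eq_neg_of_add_eq_zero_right hzero_apply

-- The vanishing brackets say that the coframe dual to `A` is closed.
theorem exists_hasFDerivAt_inverse_of_lieBracket [CompleteSpace F] {A : E → F →L[ℝ] E} {B : Set E}
    (hconv : Convex ℝ B) (hB : IsOpen B) (hA : ContDiffOn ℝ ∞ A B)
    (hinv : ∀ z ∈ B, (A z).IsInvertible)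
    (hbr : ∀ z ∈ B, ∀ c d, VectorField.lieBracket ℝ (fun z => A z c) (fun z => A z d) z = 0) :
    ∃ f : E → F, ContDiffOn ℝ ∞ f B ∧ ∀ z ∈ B, HasFDerivAt f (A z).inverse z := by
  have hAat : ∀ z ∈ B, ContDiffAt ℝ ∞ A z := fun z hz => hA.contDiffAt (hB.mem_nhds hz)
  have hθ : ContDiffOn ℝ ∞ (fun z => (A z).inverse) B := fun z hz =>
    (contDiffAt_inverse (hAat z hz) (hinv z hz)).contDiffWithinAt
  have hclosed : ∀ z ∈ B, ∀ u v, fderiv ℝ (fun z => (A z).inverse) z u v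
      = fderiv ℝ (fun z => (A z).inverse) z v u := by
    intro z hz u v
    obtain ⟨c, rfl⟩ : ∃ c, A z c = u := ⟨_, (hinv z hz).self_apply_inverse u⟩
    obtain ⟨d, rfl⟩ : ∃ d, A z d = v := ⟨_, (hinv z hz).self_apply_inverse v⟩
    have hAd := (hAat z hz).differentiableAt (by simp)
    rw [fderiv_inverse_apply hAd (hinv z hz), fderiv_inverse_apply hAd (hinv z hz),
      sub_eq_zero.1 (hbr z hz c d)]
  obtain ⟨f, hf⟩ := hconv.exists_forall_hasFDerivAt_of_fderiv_symmetric hB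
    (hθ.differentiableOn (by simp)) hclosed
  refine ⟨f, ?_, hf⟩
  rw [contDiffOn_infty_iff_fderiv_of_isOpen hB]
  exact ⟨fun z hz => (hf z hz).differentiableAt.differentiableWithinAt,
    hθ.congr fun z hz => (hf z hz).fderiv⟩

theorem exists_openPartialHomeomorph_of_hasFDerivAt_inverse [CompleteSpace E]
    {A : E → F →L[ℝ] E} {f : E → F} {B : Set E} (hB : IsOpen B) (hf : ContDiffOn ℝ ∞ f B)
    (hfA : ∀ z ∈ B, HasFDerivAt f (A z).inverse z) (hinv : ∀ z ∈ B, (A z).IsInvertible)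
    {z₀ : E} (hz₀ : z₀ ∈ B) :
    ∃ g : OpenPartialHomeomorph E F, z₀ ∈ g.source ∧ g.source ⊆ B ∧
      (∀ z ∈ g.source, ContDiffAt ℝ ∞ g z) ∧
      ∀ w ∈ g.target, ContDiffAt ℝ ∞ g.symm w ∧ HasFDerivAt g.symm (A (g.symm w)) w := by
  have hequiv : ∀ z ∈ B, ∃ e : F ≃L[ℝ] E, (e : F →L[ℝ] E) = A z ∧
      HasFDerivAt f (e.symm : E →L[ℝ] F) z := by
    intro z hz
    obtain ⟨e, he⟩ := hinv z hz
    refine ⟨e, he, ?_⟩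
    have hfz := hfA z hz
    rwa [← he, ContinuousLinearMap.inverse_equiv] at hfz
  have hfat : ∀ z ∈ B, ContDiffAt ℝ ∞ f z := fun z hz => hf.contDiffAt (hB.mem_nhds hz)
  obtain ⟨e₀, -, hf₀⟩ := hequiv z₀ hz₀
  let g := ((hfat z₀ hz₀).toOpenPartialHomeomorph f hf₀ (by simp)).restrOpen B hB
  have hgB : g.source ⊆ B := Set.inter_subset_right
  refine ⟨g, ⟨ContDiffAt.mem_toOpenPartialHomeomorph_source _ _ _, hz₀⟩, hgB,
    fun z hz => hfat z (hgB hz), fun w hw => ?_⟩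
  have hwB := hgB (g.map_target hw)
  obtain ⟨e, he, hfe⟩ := hequiv _ hwB
  refine ⟨g.contDiffAt_symm hw hfe (hfat _ hwB), ?_⟩
  have hsymm := g.hasFDerivAt_symm hw hfe
  rwa [ContinuousLinearEquiv.symm_symm, he] at hsymm

theorem exists_flattening [CompleteSpace E] [CompleteSpace F] {A : E → F →L[ℝ] E} {Ω : Set E}
    (hΩ : IsOpen Ω) (hA : ContDiffOn ℝ ∞ A Ω) {z₀ : E} (hz₀ : z₀ ∈ Ω) (hinv : (A z₀).IsInvertible)
    (hbr : ∀ z ∈ Ω, ∀ c d, VectorField.lieBracket ℝ (fun z => A z c) (fun z => A z d) z = 0) :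
    ∃ f : OpenPartialHomeomorph E F, z₀ ∈ f.source ∧ f.source ⊆ Ω ∧
      (∀ z ∈ f.source, ContDiffAt ℝ ∞ f z) ∧
      ∀ w ∈ f.target, ContDiffAt ℝ ∞ f.symm w ∧ HasFDerivAt f.symm (A (f.symm w)) w := by
  have hgood : ∀ᶠ z in 𝓝 z₀, z ∈ Ω ∧ (A z).IsInvertible := (hΩ.eventually_mem hz₀).and
    (eventually_isInvertible (hA.contDiffAt (hΩ.mem_nhds hz₀)).continuousAt hinv)
  obtain ⟨ε, hε, hball⟩ := Metric.eventually_nhds_iff_ball.1 hgood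
  obtain ⟨f, hf, hfA⟩ := exists_hasFDerivAt_inverse_of_lieBracket (convex_ball z₀ ε)
    Metric.isOpen_ball (hA.mono fun z hz => (hball z hz).1) (fun z hz => (hball z hz).2)
    fun z hz => hbr z (hball z hz).1
  obtain ⟨g, hz₀g, hgball, hg, hgsymm⟩ := exists_openPartialHomeomorph_of_hasFDerivAt_inverse
    Metric.isOpen_ball hf hfA (fun z hz => (hball z hz).2) (Metric.mem_ball_self hε)
  exact ⟨g, hz₀g, fun z hz => (hball z (hgball hz)).1, hg, hgsymm⟩

end Flattening

section CommutingFlow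

open Topology

variable {E F : Type*} [NormedAddCommGroup E] [NormedSpace ℝ E]
  [NormedAddCommGroup F] [NormedSpace ℝ F]
  {H : Type*} [TopologicalSpace H] {I : ModelWithCorners ℝ E H}
  {N : Type*} [TopologicalSpace N] [ChartedSpace H N]

theorem hasMFDerivAt_comp_line {f : F → N} {a c : F} {s : ℝ} {L : F →L[ℝ] E}
    (hf : HasMFDerivAt 𝓘(ℝ, F) I f (a + s • c) (L :)) :
    HasMFDerivAt 𝓘(ℝ, ℝ) I (fun s : ℝ => f (a + s • c)) s
      ((1 : ℝ →L[ℝ] ℝ).smulRight (L c) :) := by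
  have hline : HasMFDerivAt 𝓘(ℝ, ℝ) 𝓘(ℝ, F) (fun s : ℝ => a + s • c) s
      ((1 : ℝ →L[ℝ] ℝ).smulRight c) :=
    (((hasFDerivAt_id (𝕜 := ℝ) s).smul_const c).const_add a).hasMFDerivAt
  exact (HasMFDerivAt.comp (f := fun s : ℝ => a + s • c) s hf hline).congr_mfderiv
    (ContinuousLinearMap.ext_ring (L.map_smul (1 : ℝ) c))

theorem isLocalDiffeomorphAt_of_eventuallyEq {f g : F → N} {c : F}
    (hg : IsLocalDiffeomorphAt 𝓘(ℝ, F) I ∞ g c) (hfg : f =ᶠ[𝓝 c] g) :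
    IsLocalDiffeomorphAt 𝓘(ℝ, F) I ∞ f c := by
  obtain ⟨Φ, hcΦ, hgΦ⟩ := hg
  obtain ⟨U, hfgU, hUo, hcU⟩ := eventually_nhds_iff.1 hfg
  let e : OpenPartialHomeomorph F N := Φ.toOpenPartialHomeomorph.restrOpen U hUo
  exact ⟨⟨e.toPartialEquiv, e.open_source, e.open_target,
    Φ.contMDiffOn_toFun.mono Set.inter_subset_left, Φ.contMDiffOn_invFun.mono fun _ hw => hw.1⟩,
    ⟨hcΦ, hcU⟩, fun c' hc' => (hfgU c' hc'.2).trans (hgΦ hc'.1)⟩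

/-- The coordinate system `χ` straightens the fields `Z c`: in it they are the constant fields
`c`. -/
structure IsFlatteningChart (Z : (q : N) → F →L[ℝ] TangentSpace I q)
    (χ : OpenPartialHomeomorph N F) : Prop where
  contMDiffOn : ContMDiffOn I 𝓘(ℝ, F) ∞ χ χ.source
  contMDiffOn_symm : ContMDiffOn 𝓘(ℝ, F) I ∞ χ.symm χ.target
  hasMFDerivAt_symm : ∀ w ∈ χ.target, HasMFDerivAt 𝓘(ℝ, F) I χ.symm w (Z (χ.symm w))

/-- The complete commuting vector fields `Z c`, `c ∈ F`, with time-one maps `Ψ c`, form a frame at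
the points of the invariant set `S`. -/
structure IsCommutingFlow [IsManifold I ∞ N] (Z : (q : N) → F →L[ℝ] TangentSpace I q)
    (Ψ : F → N → N) (S : Set N) : Prop where
  smooth : ∀ c, IsSmoothVectorField (fun q => Z q c)
  bracket : ∀ c d q, VectorField.mlieBracket I (fun q => Z q c) (fun q => Z q d) q = 0
  zero : ∀ q, Ψ 0 q = q
  curve : ∀ c q, IsMIntegralCurve (fun s : ℝ => Ψ (s • c) q) (fun q => Z q c)
  invariant : ∀ c, ∀ q ∈ S, Ψ c q ∈ S
  bijective : ∀ q ∈ S, Function.Bijective (Z q)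

/-- `Ψ (a + d) q = Ψ d (Ψ a q)` for all small `d`: the germ form of the action property, which is
propagated along the ray through `a`. -/
def IsAdditiveNear (Ψ : F → N → N) (q : N) (a : F) : Prop :=
  ∀ᶠ d in 𝓝 (0 : F), Ψ (a + d) q = Ψ d (Ψ a q)

/-- `Ψ` acts additively, for parameters of norm less than `ε`, on the points of `V`. -/
def IsAdditiveOn (Ψ : F → N → N) (V : Set N) (ε : ℝ) : Prop :=
  ∀ q ∈ V, ∀ c d, ‖c‖ < ε → ‖d‖ < ε → Ψ c (Ψ d q) = Ψ (c + d) q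

theorem IsFlatteningChart.isLocalDiffeomorphAt_symm {Z : (q : N) → F →L[ℝ] TangentSpace I q}
    {χ : OpenPartialHomeomorph N F} (hχ : IsFlatteningChart Z χ) {w : F} (hw : w ∈ χ.target) :
    IsLocalDiffeomorphAt 𝓘(ℝ, F) I ∞ χ.symm w :=
  ⟨⟨χ.symm.toPartialEquiv, χ.open_target, χ.open_source, hχ.contMDiffOn_symm, hχ.contMDiffOn⟩, hw,
    fun _ _ => rfl⟩

variable (I) in
/-- The chart at `q` as a homeomorphism between open subsets of the manifold and of its model
vector space. -/
noncomputable def openChart [I.Boundaryless] (q : N) : OpenPartialHomeomorph N E where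
  toPartialEquiv := extChartAt I q
  open_source := isOpen_extChartAt_source q
  open_target := isOpen_extChartAt_target q
  continuousOn_toFun := continuousOn_extChartAt q
  continuousOn_invFun := continuousOn_extChartAt_symm q

/-- The expression of the fields `Z c` in the chart at `q`. -/
noncomputable def chartFrame (q : N) (Z : (p : N) → F →L[ℝ] TangentSpace I p) (z : E) :
    F →L[ℝ] E :=
  dchart I q ((extChartAt I q).symm z) ∘L (Z ((extChartAt I q).symm z) : F →L[ℝ] E)

variable [IsManifold I ∞ N] [FiniteDimensional ℝ E]

theorem isInvertible_chartFrame [I.Boundaryless] (q : N)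
    {Z : (p : N) → F →L[ℝ] TangentSpace I p} {z : E}
    (hz : z ∈ (extChartAt I q).target)
    (hbij : Function.Bijective (Z ((extChartAt I q).symm z))) :
    (chartFrame q Z z).IsInvertible := by
  have hdchart : Function.Bijective (dchart I q ((extChartAt I q).symm z)) :=
    ⟨Function.LeftInverse.injective (g := dchartSymm I q z) (dchartSymm_dchart q hz),
      Function.RightInverse.surjective (g := dchartSymm I q z) (dchart_dchartSymm q hz)⟩
  have hframe : Function.Bijective (chartFrame q Z z) := hdchart.comp hbij
  have : FiniteDimensional ℝ F :=
    .of_injective (chartFrame q Z z : F →ₗ[ℝ] E) hframe.injective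
  exact ⟨(LinearEquiv.ofBijective (chartFrame q Z z : F →ₗ[ℝ] E) hframe).toContinuousLinearEquiv,
    ContinuousLinearMap.ext fun _ => rfl⟩

namespace IsCommutingFlow

variable {Z : (q : N) → F →L[ℝ] TangentSpace I q} {Ψ : F → N → N} {S : Set N}

theorem finiteDimensional (hΨ : IsCommutingFlow Z Ψ S) {q : N} (hq : q ∈ S) :
    FiniteDimensional ℝ F :=
  have : FiniteDimensional ℝ (TangentSpace I q) := inferInstanceAs (FiniteDimensional ℝ E)
  .of_injective (Z q).toLinearMap (hΨ.bijective q hq).injective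

theorem contDiffOn_chartFrame [I.Boundaryless] [FiniteDimensional ℝ F]
    (hΨ : IsCommutingFlow Z Ψ S) (q : N) :
    ContDiffOn ℝ ∞ (chartFrame q Z) (extChartAt I q).target := by
  have : CompleteSpace E := FiniteDimensional.complete ℝ E
  exact contDiffOn_clm_apply.2 fun c => contDiffOn_chartField q (hΨ.smooth c)

theorem lieBracket_chartFrame [I.Boundaryless] (hΨ : IsCommutingFlow Z Ψ S) (q : N) {z : E}
    (hz : z ∈ (extChartAt I q).target) (c d : F) :
    VectorField.lieBracket ℝ (fun z => chartFrame q Z z c) (fun z => chartFrame q Z z d) z = 0 := by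
  have : CompleteSpace E := FiniteDimensional.complete ℝ E
  exact (lieBracket_chartField q (hΨ.smooth c) (hΨ.smooth d) hz).trans
    ((chartField_eq_zero_iff q _ hz).2 (hΨ.bracket c d _))

theorem exists_isFlatteningChart [I.Boundaryless] (hΨ : IsCommutingFlow Z Ψ S) {q : N}
    (hq : q ∈ S) :
    ∃ χ : OpenPartialHomeomorph N F, q ∈ χ.source ∧ IsFlatteningChart Z χ := by
  have : FiniteDimensional ℝ F := hΨ.finiteDimensional hq
  have : CompleteSpace E := FiniteDimensional.complete ℝ E
  have : CompleteSpace F := FiniteDimensional.complete ℝ F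
  have hqt := mem_extChartAt_target (I := I) q
  obtain ⟨f, hqf, -, hf, hfsymm⟩ := exists_flattening (isOpen_extChartAt_target (I := I) q)
    (hΨ.contDiffOn_chartFrame q) hqt
    (isInvertible_chartFrame q hqt ((extChartAt_to_inv (I := I) q).symm ▸ hΨ.bijective q hq))
    fun z hz => hΨ.lieBracket_chartFrame q hz
  refine ⟨(openChart I q).trans f, ⟨mem_extChartAt_source q, hqf⟩, fun q' hq' => ?_,
    fun w hw => ?_, fun w hw => ?_⟩
  · exact ((hf _ hq'.2).contMDiffAt.comp q' (contMDiffAt_chart q hq'.1)).contMDiffWithinAt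
  · exact ((contMDiffAt_chart_symm q hw.2).comp w
      (hfsymm w hw.1).1.contMDiffAt).contMDiffWithinAt
  · exact ((hasMFDerivAt_chart_symm q hw.2).comp w (hfsymm w hw.1).2.hasMFDerivAt).congr_mfderiv
      (ContinuousLinearMap.ext fun c => dchartSymm_dchart q hw.2
        (Z ((extChartAt I q).symm (f.symm w)) c))

variable [I.Boundaryless] [T2Space N]

theorem eq_of_isMIntegralCurve (hΨ : IsCommutingFlow Z Ψ S) {c : F} {γ : ℝ → N}
    (hγ : IsMIntegralCurve γ (fun q => Z q c)) (s : ℝ) : γ s = Ψ (s • c) (γ 0) := by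
  have : CompleteSpace E := FiniteDimensional.complete ℝ E
  have : IsManifold I 1 N := .of_le (n := ∞) (by simp)
  exact congrFun (isMIntegralCurve_Ioo_eq_of_contMDiff_boundaryless (t₀ := 0)
    ((hΨ.smooth c).of_le (by simp)) hγ (hΨ.curve c (γ 0)) (by simp [hΨ.zero])) s

theorem apply_smul_apply_smul (hΨ : IsCommutingFlow Z Ψ S) (c : F) (s t : ℝ) (q : N) :
    Ψ (s • c) (Ψ (t • c) q) = Ψ ((s + t) • c) q := by
  have hshift := hΨ.eq_of_isMIntegralCurve ((hΨ.curve c q).comp_add t) s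
  simp only [Function.comp_apply, zero_add] at hshift
  exact hshift.symm

theorem apply_one_sub_smul (hΨ : IsCommutingFlow Z Ψ S) (c : F) (l : ℝ) (q : N) :
    Ψ ((1 - l) • c) (Ψ (l • c) q) = Ψ c q := by
  rw [hΨ.apply_smul_apply_smul, sub_add_cancel, one_smul]

theorem exists_eq_translation (hΨ : IsCommutingFlow Z Ψ S) {q : N}
    {χ : OpenPartialHomeomorph N F} (hq : q ∈ χ.source) (hχ : IsFlatteningChart Z χ) :
    ∃ ε > 0, ∀ q' ∈ χ.source, ‖χ q' - χ q‖ < ε → ∀ c, ‖c‖ < ε →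
      χ q' + c ∈ χ.target ∧ Ψ c q' = χ.symm (χ q' + c) := by
  have : CompleteSpace E := FiniteDimensional.complete ℝ E
  have : IsManifold I 1 N := .of_le (n := ∞) (by simp)
  obtain ⟨δ, hδ, hball⟩ := Metric.isOpen_iff.1 χ.open_target (χ q) (χ.map_source hq)
  refine ⟨δ / 3, by positivity, fun q' hq' hqq' c hc => ?_⟩
  have hsegment : ∀ s ∈ Set.Ioo (-1 : ℝ) 2, χ q' + s • c ∈ χ.target := by
    intro s hs
    apply hball
    rw [mem_ball_iff_norm, add_sub_right_comm]
    have hsc : ‖s • c‖ ≤ 2 * ‖c‖ := by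
      rw [norm_smul, Real.norm_eq_abs]
      exact mul_le_mul_of_nonneg_right (abs_le.2 ⟨by linarith [hs.1], hs.2.le⟩) (norm_nonneg c)
    linarith [norm_add_le (χ q' - χ q) (s • c)]
  have hline : IsMIntegralCurveOn (I := I) (fun s : ℝ => χ.symm (χ q' + s • c)) (fun q => Z q c)
      (Set.Ioo (-1) 2) := fun s hs =>
    (hasMFDerivAt_comp_line (hχ.hasMFDerivAt_symm _ (hsegment s hs))).hasMFDerivWithinAt
  have heqOn := isMIntegralCurveOn_Ioo_eqOn_of_contMDiff_boundaryless (t₀ := 0) (by norm_num)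
    ((hΨ.smooth c).of_le (by simp)) ((hΨ.curve c q').isMIntegralCurveOn _) hline
    (by simp [hΨ.zero, χ.left_inv hq'])
  have hone : (1 : ℝ) ∈ Set.Ioo (-1 : ℝ) 2 := by norm_num
  simpa only [one_smul] using And.intro (hsegment 1 hone) (heqOn hone)

theorem exists_isAdditiveOn (hΨ : IsCommutingFlow Z Ψ S) {q : N} (hq : q ∈ S) :
    ∃ V ∈ 𝓝 q, ∃ ε > 0, IsAdditiveOn Ψ V ε := by
  obtain ⟨χ, hqχ, hχ⟩ := hΨ.exists_isFlatteningChart hq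
  obtain ⟨ε, hε, htrans⟩ := hΨ.exists_eq_translation hqχ hχ
  have hnear : ∀ᶠ q' in 𝓝 q, ‖χ q' - χ q‖ < ε / 2 := by
    filter_upwards [(χ.continuousAt hqχ).eventually (Metric.ball_mem_nhds (χ q) (half_pos hε))]
      with q' hq'
    rwa [dist_eq_norm] at hq'
  refine ⟨_, (χ.open_source.eventually_mem hqχ).and hnear, ε / 2, by positivity, ?_⟩
  rintro q' ⟨hq'χ, hq'⟩ c d hc hd
  obtain ⟨hd_target, hΨd⟩ := htrans q' hq'χ (by linarith) d (by linarith)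
  obtain ⟨-, hΨcd⟩ := htrans q' hq'χ (by linarith) (c + d) (by linarith [norm_add_le c d])
  have hχd : χ (Ψ d q') = χ q' + d := by rw [hΨd, χ.right_inv hd_target]
  have hd_near : ‖χ (Ψ d q') - χ q‖ < ε := by
    rw [hχd, add_sub_right_comm]
    linarith [norm_add_le (χ q' - χ q) d]
  have hd_source : Ψ d q' ∈ χ.source := hΨd ▸ χ.map_target hd_target
  obtain ⟨-, hΨc⟩ := htrans _ hd_source hd_near c (by linarith)
  rw [hΨc, hΨcd, hχd, add_assoc, add_comm d c]

-- The rays through `a` and `a + d` are flow lines; they are compared at the time `l`, after which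
-- only parameters of norm less than `ε` remain.
theorem apply_add_of_apply_smul_add (hΨ : IsCommutingFlow Z Ψ S) {V : Set N} {ε : ℝ}
    (hV : IsAdditiveOn Ψ V ε) {q : N} {a d : F} {l : ℝ} (hlV : Ψ (l • a) q ∈ V)
    (ha : ‖(1 - l) • a‖ < ε) (hd : ‖d‖ < ε) (hld : ‖l • d‖ < ε) (had : ‖(1 - l) • (a + d)‖ < ε)
    (hl : Ψ (l • a + l • d) q = Ψ (l • d) (Ψ (l • a) q)) : Ψ (a + d) q = Ψ d (Ψ a q) :=
  calc Ψ (a + d) q = Ψ ((1 - l) • (a + d)) (Ψ (l • (a + d)) q) :=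
        (hΨ.apply_one_sub_smul _ _ _).symm
    _ = Ψ ((1 - l) • (a + d)) (Ψ (l • d) (Ψ (l • a) q)) := by rw [smul_add l, hl]
    _ = Ψ ((1 - l) • (a + d) + l • d) (Ψ (l • a) q) := hV _ hlV _ _ had hld
    _ = Ψ (d + (1 - l) • a) (Ψ (l • a) q) := by congr 1; module
    _ = Ψ d (Ψ ((1 - l) • a) (Ψ (l • a) q)) := (hV _ hlV _ _ hd ha).symm
    _ = Ψ d (Ψ a q) := by rw [hΨ.apply_one_sub_smul]

theorem isAdditiveNear_of_smul (hΨ : IsCommutingFlow Z Ψ S) {V : Set N} {ε : ℝ}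
    (hV : IsAdditiveOn Ψ V ε) {q : N} {a : F} {l : ℝ} (hlV : Ψ (l • a) q ∈ V)
    (ha : ‖(1 - l) • a‖ < ε) (hl : IsAdditiveNear Ψ q (l • a)) : IsAdditiveNear Ψ q a := by
  have hε : 0 < ε := (norm_nonneg _).trans_lt ha
  have hsmall : ∀ f : F → F, Continuous f → ‖f 0‖ < ε → ∀ᶠ d in 𝓝 (0 : F), ‖f d‖ < ε :=
    fun f hf hf0 => hf.norm.continuousAt.eventually_lt continuousAt_const hf0
  have hscale : Filter.Tendsto (fun d : F => l • d) (𝓝 0) (𝓝 0) :=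
    (continuous_const_smul l).tendsto' _ _ (smul_zero l)
  filter_upwards [hscale.eventually hl, hsmall id continuous_id (by simpa using hε),
    hsmall (fun d => l • d) (by fun_prop) (by simpa using hε),
    hsmall (fun d => (1 - l) • (a + d)) (by fun_prop) (by simpa using ha)] with d hld hd hld' had
  exact hΨ.apply_add_of_apply_smul_add hV hlV ha hd hld' had hld

theorem eventually_isAdditiveNear_smul (hΨ : IsCommutingFlow Z Ψ S) {q : N} (hq : q ∈ S) (c : F)
    (s₀ : ℝ) : ∀ᶠ p : ℝ × ℝ in 𝓝 (s₀, s₀),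
      IsAdditiveNear Ψ q (p.1 • c) → IsAdditiveNear Ψ q (p.2 • c) := by
  obtain ⟨V, hV, ε, hε, hadd⟩ := hΨ.exists_isAdditiveOn (hΨ.invariant (s₀ • c) q hq)
  have hmem : ∀ᶠ s in 𝓝 s₀, Ψ (s • c) q ∈ V :=
    (hΨ.curve c q).continuous.continuousAt.eventually_mem hV
  have hclose : ∀ᶠ p : ℝ × ℝ in 𝓝 (s₀, s₀), ‖(p.2 - p.1) • c‖ < ε :=
    Continuous.continuousAt (by fun_prop) |>.eventually_lt continuousAt_const (by simpa using hε)
  filter_upwards [hclose, (continuous_fst.tendsto (s₀, s₀)).eventually hmem] with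
    ⟨s, s'⟩ hss' hs hadd_s
  rcases eq_or_ne s' 0 with rfl | hs'
  · exact .of_forall fun d => by simp only [zero_smul, zero_add, hΨ.zero]
  have hquot : (s / s') • s' • c = s • c := by rw [smul_smul, div_mul_cancel₀ s hs']
  refine hΨ.isAdditiveNear_of_smul (l := s / s') hadd ?_ ?_ ?_
  · rwa [hquot]
  · rwa [sub_smul, one_smul, hquot, ← sub_smul]
  · rwa [hquot]

theorem isAdditiveNear (hΨ : IsCommutingFlow Z Ψ S) {q : N} (hq : q ∈ S) (c : F) :
    IsAdditiveNear Ψ q c := by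
  have hpropagate : IsAdditiveNear Ψ q ((0 : ℝ) • c) → IsAdditiveNear Ψ q ((1 : ℝ) • c) := by
    refine PreconnectedSpace.induction₂'
      (fun s t : ℝ => IsAdditiveNear Ψ q (s • c) → IsAdditiveNear Ψ q (t • c)) (fun s => ?_)
      ⟨fun _ _ _ hst htu hs => htu (hst hs)⟩ 0 1
    have hnear := hΨ.eventually_isAdditiveNear_smul hq c s
    exact ((Continuous.prodMk_right s).tendsto s |>.eventually hnear).and
      ((Continuous.prodMk_left s).tendsto s |>.eventually hnear)
  rw [zero_smul, one_smul] at hpropagate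
  exact hpropagate (.of_forall fun d => by simp only [zero_add, hΨ.zero])

theorem eventually_eq_translation (hΨ : IsCommutingFlow Z Ψ S) {q : N} (hq : q ∈ S) (c : F) :
    ∃ χ : OpenPartialHomeomorph N F, Ψ c q ∈ χ.source ∧ IsFlatteningChart Z χ ∧
      ∀ᶠ c' in 𝓝 c, Ψ c' q = χ.symm (c' + (χ (Ψ c q) - c)) := by
  obtain ⟨χ, hqχ, hχ⟩ := hΨ.exists_isFlatteningChart (hΨ.invariant c q hq)
  obtain ⟨ε, hε, htrans⟩ := hΨ.exists_eq_translation hqχ hχ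
  refine ⟨χ, hqχ, hχ, ?_⟩
  have hsub : Filter.Tendsto (fun c' : F => c' - c) (𝓝 c) (𝓝 0) :=
    (continuous_sub_right c).tendsto' _ _ (sub_self c)
  filter_upwards [hsub.eventually (hΨ.isAdditiveNear hq c),
    hsub.eventually (Metric.ball_mem_nhds 0 hε)] with c' hadd hc'
  rw [add_sub_cancel] at hadd
  rw [hadd, (htrans _ hqχ (by simpa using hε) _ (by simpa using hc')).2]
  congr 1
  abel

theorem hasMFDerivAt (hΨ : IsCommutingFlow Z Ψ S) {q : N} (hq : q ∈ S) (c : F) :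
    HasMFDerivAt 𝓘(ℝ, F) I (fun c => Ψ c q) c (Z (Ψ c q)) := by
  obtain ⟨χ, hqχ, hχ, hev⟩ := hΨ.eventually_eq_translation hq c
  have hsymm : HasMFDerivAt 𝓘(ℝ, F) I χ.symm (c + (χ (Ψ c q) - c)) (Z (Ψ c q)) := by
    have hderiv := hχ.hasMFDerivAt_symm _ (χ.map_source hqχ)
    rw [χ.left_inv hqχ] at hderiv
    rwa [add_sub_cancel]
  have htranslation : HasMFDerivAt 𝓘(ℝ, F) 𝓘(ℝ, F) (fun c' : F => c' + (χ (Ψ c q) - c)) c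
      (ContinuousLinearMap.id ℝ F) := ((hasFDerivAt_id c).add_const _).hasMFDerivAt
  exact (HasMFDerivAt.comp (f := fun c' : F => c' + (χ (Ψ c q) - c)) c hsymm
    htranslation).congr_of_eventuallyEq hev

theorem isLocalDiffeomorphAt (hΨ : IsCommutingFlow Z Ψ S) {q : N} (hq : q ∈ S) (c : F) :
    IsLocalDiffeomorphAt 𝓘(ℝ, F) I ∞ (fun c => Ψ c q) c := by
  obtain ⟨χ, hqχ, hχ, hev⟩ := hΨ.eventually_eq_translation hq c
  let translation : Diffeomorph 𝓘(ℝ, F) 𝓘(ℝ, F) F F ∞ :=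
    { toEquiv := Equiv.addRight (χ (Ψ c q) - c)
      contMDiff_toFun := (contDiff_id.add contDiff_const).contMDiff
      contMDiff_invFun := (contDiff_id.add contDiff_const).contMDiff }
  refine isLocalDiffeomorphAt_of_eventuallyEq
    ((translation.isLocalDiffeomorph c).comp I N (hχ.isLocalDiffeomorphAt_symm ?_)) hev
  change c + (χ (Ψ c q) - c) ∈ χ.target
  rw [add_sub_cancel]
  exact χ.map_source hqχ

theorem apply_add (hΨ : IsCommutingFlow Z Ψ S) {q : N} (hq : q ∈ S) (c d : F) :
    Ψ (c + d) q = Ψ d (Ψ c q) := by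
  have hcurve : IsMIntegralCurve (I := I) (fun s : ℝ => Ψ (c + s • d) q) (fun q => Z q d) :=
    fun s => hasMFDerivAt_comp_line (hΨ.hasMFDerivAt hq (c + s • d))
  simpa using hΨ.eq_of_isMIntegralCurve hcurve 1

theorem contMDiff (hΨ : IsCommutingFlow Z Ψ S) {q : N} (hq : q ∈ S) :
    ContMDiff 𝓘(ℝ, F) I ∞ (fun c => Ψ c q) :=
  fun c => (hΨ.isLocalDiffeomorphAt hq c).contMDiffAt

theorem isOpen_range (hΨ : IsCommutingFlow Z Ψ S) {q : N} (hq : q ∈ S) :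
    IsOpen (Set.range fun c => Ψ c q) :=
  IsLocalDiffeomorph.isOpen_range fun c => hΨ.isLocalDiffeomorphAt hq c

end IsCommutingFlow

end CommutingFlow

section ComplexFlow

open Topology

variable {n : ℕ} {E : Type*} [NormedAddCommGroup E] [NormedSpace ℝ E]
  {H : Type*} [TopologicalSpace H] {I : ModelWithCorners ℝ E H}
  {N : Type*} [AddAction (Torus n) N]

theorem vadd_mem_freeSet (a : Torus n) {q : N} (hq : q ∈ freeSet n N) :
    a +ᵥ q ∈ freeSet n N := fun b hb =>
  hq b ((vadd_left_cancel_iff a).1 (by rwa [← add_vadd, add_comm, add_vadd] at hb))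

variable [TopologicalSpace N] [ChartedSpace H N]

theorem hasMFDerivAt_action (hs : IsSmoothTorusAction n I N) (t : Vec n) (q : N) :
    HasMFDerivAt (𝓘(ℝ, Vec n).prod I) I (fun q : Vec n × N => toTorus q.1 +ᵥ q.2) (t, q)
      ((fundamental I (toTorus t +ᵥ q) : Vec n →L[ℝ] E).coprod
        (mfderiv I I (fun q : N => toTorus t +ᵥ q) q : E →L[ℝ] E) :) := by
  have hdiff : MDifferentiableAt (𝓘(ℝ, Vec n).prod I) I
      (fun q : Vec n × N => toTorus q.1 +ᵥ q.2) (t, q) := hs.mdifferentiable (by simp) _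
  refine hdiff.hasMFDerivAt.congr_mfderiv (ContinuousLinearMap.ext fun v => ?_)
  refine (mfderiv_prod_eq_add_apply hdiff).trans ?_
  exact congrArg (fun w : E => HAdd.hAdd (α := E) (β := E) w
    (mfderiv I I (fun q : N => toTorus t +ᵥ q) q v.2))
    (DFunLike.congr_fun (hasMFDerivAt_orbit hs q t).mfderiv v.1)

variable [IsManifold I ∞ N] {K : KahlerStructure I N}

theorem KahlerStructure.inner_self_nonneg (K : KahlerStructure I N) (q : N)
    (v : TangentSpace I q) : 0 ≤ K.g.inner q v v := by
  rcases eq_or_ne v 0 with rfl | hv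
  · rw [map_zero]
  · exact (K.g.pos q v hv).le

theorem KahlerStructure.eq_zero_of_inner_self (K : KahlerStructure I N) {q : N}
    {v : TangentSpace I q} (hv : K.g.inner q v v = 0) : v = 0 :=
  by_contra fun hne => (K.g.pos q v hne).ne' hv

namespace IsMomentumMap

variable {μ : N → Vec n}

theorem hasMFDerivAt (hμ : IsMomentumMap K μ) (q : N) :
    HasMFDerivAt I 𝓘(ℝ, Vec n) μ q (mfderiv I 𝓘(ℝ, Vec n) μ q) :=
  (hμ.smooth.mdifferentiable (by simp) q).hasMFDerivAt

theorem inner_mfderiv (hμ : IsMomentumMap K μ) (q : N) (v : TangentSpace I q) (ξ : Vec n) :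
    inner (E := Vec n) ℝ (mfderiv I 𝓘(ℝ, Vec n) μ q v) ξ
      = K.g.inner q (K.J q (fundamental I q ξ)) v := by
  have hinner : HasMFDerivAt 𝓘(ℝ, Vec n) 𝓘(ℝ, ℝ) (fun z : Vec n => inner ℝ z ξ) (μ q)
      ((innerSL ℝ).flip ξ :) := ((innerSL ℝ).flip ξ).hasFDerivAt.hasMFDerivAt
  exact (DFunLike.congr_fun (hinner.comp q (hμ.hasMFDerivAt q)).mfderiv v).symm.trans
    (hμ.hamiltonian ξ q v).symm

theorem mfderiv_fundamental (hs : IsSmoothTorusAction n I N) (hμ : IsMomentumMap K μ) (q : N)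
    (ξ : Vec n) : mfderiv I 𝓘(ℝ, Vec n) μ q (fundamental I q ξ) = 0 := by
  have hμq : HasMFDerivAt I 𝓘(ℝ, Vec n) μ (toTorus (0 : Vec n) +ᵥ q)
      (mfderiv I 𝓘(ℝ, Vec n) μ q) := by
    rw [toTorus_zero_vadd]
    exact hμ.hasMFDerivAt q
  have hcomp := HasMFDerivAt.comp (f := fun t : Vec n => toTorus t +ᵥ q) 0 hμq
    (hasMFDerivAt_orbit_zero hs q)
  have hconst : μ ∘ (fun t : Vec n => toTorus t +ᵥ q) = fun _ => μ q :=
    funext fun _ => hμ.invariant _ _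
  rw [hconst] at hcomp
  exact DFunLike.congr_fun (hasMFDerivAt_unique hcomp (hasMFDerivAt_const (μ q) 0)) ξ

theorem inner_J_fundamental (hs : IsSmoothTorusAction n I N) (hμ : IsMomentumMap K μ) (q : N)
    (ξ η : Vec n) : K.g.inner q (K.J q (fundamental I q ξ)) (fundamental I q η) = 0 := by
  rw [← hμ.inner_mfderiv, hμ.mfderiv_fundamental hs]
  exact inner_zero_left _

theorem inner_complexFundamental (hs : IsSmoothTorusAction n I N) (hμ : IsMomentumMap K μ) (q : N)
    (c d : Vec n × Vec n) :
    K.g.inner q (complexFundamental K q c) (complexFundamental K q d)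
      = K.g.inner q (fundamental I q c.1) (fundamental I q d.1)
        + K.g.inner q (fundamental I q c.2) (fundamental I q d.2) := by
  have hcd := hμ.inner_J_fundamental hs q c.1 d.2
  have hdc := hμ.inner_J_fundamental hs q d.1 c.2
  rw [K.g.symm] at hdc
  simp [complexFundamental_apply, K.hermitian, hcd, hdc]

end IsMomentumMap

variable [FiniteDimensional ℝ E] [I.Boundaryless] [T2Space N]

theorem fundamental_injective (hs : IsSmoothTorusAction n I N) {q : N} (hq : q ∈ freeSet n N) :
    Function.Injective (fundamental (n := n) I q) := by
  have : CompleteSpace E := FiniteDimensional.complete ℝ E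
  have : IsManifold I 1 N := .of_le (n := ∞) (by simp)
  refine (injective_iff_map_eq_zero _).2 fun ξ hξ =>
    eq_zero_of_forall_toTorus_smul fun s => hq _ ?_
  have hconst := isMIntegralCurve_Ioo_eq_of_contMDiff_boundaryless (t₀ := 0)
    ((isSmoothVectorField_fundamental hs ξ).of_le (by simp)) (isMIntegralCurve_orbit hs ξ q)
    (isMIntegralCurve_const (v := fun q => fundamental I q ξ) hξ)
    (by simp [toTorus_zero])
  exact congrFun hconst s

theorem complexFundamental_injective {μ : N → Vec n} (hs : IsSmoothTorusAction n I N)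
    (hμ : IsMomentumMap K μ) {q : N} (hq : q ∈ freeSet n N) :
    Function.Injective (complexFundamental (n := n) K q) := by
  refine (injective_iff_map_eq_zero _).2 fun c hc => ?_
  have hsum : K.g.inner q (fundamental I q c.1) (fundamental I q c.1)
      + K.g.inner q (fundamental I q c.2) (fundamental I q c.2) = 0 := by
    rw [← hμ.inner_complexFundamental hs q c c, hc, map_zero]
  have hfst := K.inner_self_nonneg q (fundamental I q c.1)
  have hsnd := K.inner_self_nonneg q (fundamental I q c.2)
  have heq_zero : ∀ ξ : Vec n, K.g.inner q (fundamental I q ξ) (fundamental I q ξ) = 0 → ξ = 0 :=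
    fun ξ hξ => (injective_iff_map_eq_zero _).1 (fundamental_injective hs hq) ξ
      (K.eq_zero_of_inner_self hξ)
  exact Prod.ext (heq_zero _ (by linarith)) (heq_zero _ (by linarith))

theorem complexFundamental_bijective {μ : N → Vec n} (hs : IsSmoothTorusAction n I N)
    (hμ : IsMomentumMap K μ) (hE : Module.finrank ℝ E = 2 * n) {q : N} (hq : q ∈ freeSet n N) :
    Function.Bijective (complexFundamental (n := n) K q) := by
  have hinj := complexFundamental_injective hs hμ hq
  have hdim : Module.finrank ℝ (Vec n × Vec n) = Module.finrank ℝ E := by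
    rw [hE, Module.finrank_prod, finrank_euclideanSpace_fin, two_mul]
  let L : Vec n × Vec n →L[ℝ] E := complexFundamental (n := n) K q
  exact ⟨hinj, (LinearMap.injective_iff_surjective_of_finrank_eq_finrank
    (f := (L : Vec n × Vec n →ₗ[ℝ] E)) hdim).1 hinj⟩

/-- `φ ξ` is the flow of `-J ξ_N`, for all `ξ`: the flows in the imaginary directions of the
complexified torus. -/
def IsImaginaryFlow (K : KahlerStructure I N) (φ : Vec n → ℝ → N → N) : Prop :=
  ∀ ξ : Vec n, IsFlow (fun q : N => -(K.J q (fundamental I q ξ))) (φ ξ)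

/-- The joint action of `ℝⁿ`, by the time-one maps of the flows `φ`, and of the torus. -/
def complexFlow (φ : Vec n → ℝ → N → N) (c : Vec n × Vec n) (q : N) : N :=
  toTorus c.2 +ᵥ φ c.1 1 q

namespace IsImaginaryFlow

variable {φ : Vec n → ℝ → N → N}

theorem eq_of_isMIntegralCurve (hφ : IsImaginaryFlow K φ) (hs : IsSmoothTorusAction n I N)
    {x : Vec n} {γ : ℝ → N} (hγ : IsMIntegralCurve γ (fun q => -(K.J q (fundamental I q x))))
    (s : ℝ) : γ s = φ x s (γ 0) := by
  have : CompleteSpace E := FiniteDimensional.complete ℝ E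
  have : IsManifold I 1 N := .of_le (n := ∞) (by simp)
  have hsmooth : IsSmoothVectorField (fun q : N => -(K.J q (fundamental I q x))) := by
    simpa only [complexFundamental_apply, map_zero, add_zero] using
      isSmoothVectorField_complexFundamental K hs (x, 0)
  exact congrFun (isMIntegralCurve_Ioo_eq_of_contMDiff_boundaryless (t₀ := 0)
    (hsmooth.of_le (by simp)) hγ (hφ x (γ 0)).2 (hφ x (γ 0)).1.symm) s

theorem apply_smul_one (hφ : IsImaginaryFlow K φ) (hs : IsSmoothTorusAction n I N) (x : Vec n)
    (s : ℝ) (q : N) : φ (s • x) 1 q = φ x s q := by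
  have hcurve := (hφ x q).2.comp_mul s
  have hfield : (s • fun q : N => -(K.J q (fundamental I q x)))
      = fun q : N => -(K.J q (fundamental I q (s • x))) := by
    funext q
    simp
  rw [hfield] at hcurve
  have hone := hφ.eq_of_isMIntegralCurve hs hcurve 1
  simp only [Function.comp_apply, one_mul, zero_mul, (hφ x q).1] at hone
  exact hone.symm

theorem apply_add (hφ : IsImaginaryFlow K φ) (hs : IsSmoothTorusAction n I N) (x : Vec n)
    (s t : ℝ) (q : N) : φ x (s + t) q = φ x s (φ x t q) := by
  have hshift := hφ.eq_of_isMIntegralCurve hs ((hφ x q).2.comp_add t) s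
  simpa only [Function.comp_apply, zero_add] using hshift

theorem apply_neg_apply (hφ : IsImaginaryFlow K φ) (hs : IsSmoothTorusAction n I N) (x : Vec n)
    (s : ℝ) (q : N) : φ x (-s) (φ x s q) = q := by
  rw [← hφ.apply_add hs, neg_add_cancel, (hφ x q).1]

theorem vadd_apply (hφ : IsImaginaryFlow K φ) (hs : IsSmoothTorusAction n I N)
    (hhol : IsHolomorphicAction K n) (a : Torus n) (x : Vec n) (s : ℝ) (q : N) :
    a +ᵥ φ x s q = φ x s (a +ᵥ q) := by
  have hcurve : IsMIntegralCurve (I := I) (fun s => a +ᵥ φ x s q)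
      (fun q => -(K.J q (fundamental I q x))) := by
    intro s
    refine ((hasMFDerivAt_vadd hs a (φ x s q)).comp s ((hφ x q).2 s)).congr_mfderiv
      (ContinuousLinearMap.ext_ring ?_)
    change mfderiv I I (fun q : N => a +ᵥ q) (φ x s q)
      ((1 : ℝ) • -(K.J (φ x s q) (fundamental I (φ x s q) x)))
        = (1 : ℝ) • -(K.J (a +ᵥ φ x s q) (fundamental I (a +ᵥ φ x s q) x))
    rw [one_smul, one_smul, map_neg, hhol a, mfderiv_vadd_fundamental hs]
  simpa only [(hφ x q).1] using hφ.eq_of_isMIntegralCurve hs hcurve s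

theorem apply_mem_freeSet (hφ : IsImaginaryFlow K φ) (hs : IsSmoothTorusAction n I N)
    (hhol : IsHolomorphicAction K n) (x : Vec n) (s : ℝ) {q : N} (hq : q ∈ freeSet n N) :
    φ x s q ∈ freeSet n N := fun a ha => hq a <| by
  rw [hφ.vadd_apply hs hhol] at ha
  rw [← hφ.apply_neg_apply hs x s (a +ᵥ q), ha, hφ.apply_neg_apply hs]

theorem isMIntegralCurve_complexFlow (hφ : IsImaginaryFlow K φ) (hs : IsSmoothTorusAction n I N)
    (hhol : IsHolomorphicAction K n) (c : Vec n × Vec n) (q : N) :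
    IsMIntegralCurve (I := I) (fun s : ℝ => complexFlow φ (s • c) q)
      (fun q => complexFundamental K q c) := by
  have hfactor : (fun s : ℝ => complexFlow φ (s • c) q)
      = (fun q : Vec n × N => toTorus q.1 +ᵥ q.2) ∘ fun s : ℝ => (s • c.2, φ c.1 s q) :=
    funext fun s => congrArg (toTorus (s • c.2) +ᵥ ·) (hφ.apply_smul_one hs c.1 s q)
  intro s
  have hline : HasMFDerivAt 𝓘(ℝ, ℝ) 𝓘(ℝ, Vec n) (fun s : ℝ => s • c.2) s
      ((1 : ℝ →L[ℝ] ℝ).smulRight c.2) :=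
    ((hasFDerivAt_id (𝕜 := ℝ) s).smul_const c.2).hasMFDerivAt
  have hcomp := HasMFDerivAt.comp s (hasMFDerivAt_action hs (s • c.2) (φ c.1 s q))
    (hline.prodMk ((hφ c.1 q).2 s))
  rw [← hfactor] at hcomp
  refine hcomp.congr_mfderiv (ContinuousLinearMap.ext_ring ?_)
  change (fundamental I (toTorus (s • c.2) +ᵥ φ c.1 s q) ((1 : ℝ) • c.2) : E)
      + (mfderiv I I (fun q : N => toTorus (s • c.2) +ᵥ q) (φ c.1 s q)
        ((1 : ℝ) • -(K.J (φ c.1 s q) (fundamental I (φ c.1 s q) c.1))) : E)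
    = (1 : ℝ) • (complexFundamental K (complexFlow φ (s • c) q) c : E)
  have hpoint : complexFlow φ (s • c) q = toTorus (s • c.2) +ᵥ φ c.1 s q := congrFun hfactor s
  rw [hpoint, one_smul, one_smul, one_smul, map_neg, hhol, mfderiv_vadd_fundamental hs]
  exact (add_comm _ _).trans (complexFundamental_apply K _ c).symm

theorem isCommutingFlow_complexFlow {μ : N → Vec n} (hφ : IsImaginaryFlow K φ)
    (hs : IsSmoothTorusAction n I N) (hhol : IsHolomorphicAction K n) (hμ : IsMomentumMap K μ)
    (hE : Module.finrank ℝ E = 2 * n) :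
    IsCommutingFlow (fun q => complexFundamental (n := n) K q) (complexFlow φ) (freeSet n N) where
  smooth c := isSmoothVectorField_complexFundamental K hs c
  bracket c d q :=
    have : CompleteSpace E := FiniteDimensional.complete ℝ E
    mlieBracket_complexFundamental K hs hhol c d q
  zero q := by
    have hzero := hφ.apply_smul_one hs 0 0 q
    rw [smul_zero, (hφ 0 q).1] at hzero
    exact (toTorus_zero_vadd _).trans hzero
  curve c q := hφ.isMIntegralCurve_complexFlow hs hhol c q
  invariant c q hq := vadd_mem_freeSet _ (hφ.apply_mem_freeSet hs hhol _ _ hq)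
  bijective q hq := complexFundamental_bijective hs hμ hE hq

end IsImaginaryFlow

end ComplexFlow

section JoinedIn

open Topology

theorem joinedIn_of_dense_of_locally_joinedIn {X : Type*} [TopologicalSpace X]
    [PreconnectedSpace X] {S : Set X} (hS : Dense S)
    (hloc : ∀ q, ∃ U ∈ 𝓝 q, ∀ x ∈ U ∩ S, ∀ y ∈ U ∩ S, JoinedIn S x y) {x y : X} (hx : x ∈ S)
    (hy : y ∈ S) : JoinedIn S x y := by
  let A : Set X := {q | ∀ᶠ z in 𝓝 q, z ∈ S → JoinedIn S x z}
  have mem_of_frequently : ∀ q, (∃ᶠ z in 𝓝 q, z ∈ S ∧ JoinedIn S x z) → q ∈ A := by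
    intro q hq
    obtain ⟨U, hU, hUS⟩ := hloc q
    obtain ⟨z, ⟨hzS, hxz⟩, hzU⟩ := (hq.and_eventually hU).exists
    filter_upwards [hU] with w hwU hwS using hxz.trans (hUS z ⟨hzU, hzS⟩ w ⟨hwU, hwS⟩)
  have hA_open : IsOpen A := isOpen_setOfPred_eventually_nhds
  have hA_closed : IsClosed A := by
    refine isClosed_iff_frequently.2 fun q hq => mem_of_frequently q ?_
    refine frequently_frequently_nhds.1 (hq.mono fun r hr => ?_)
    exact ((mem_closure_iff_frequently.1 (hS r)).and_eventually hr).mono fun z hz =>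
      ⟨hz.1, hz.2 hz.1⟩
  have hxA : x ∈ A := mem_of_frequently x fun h => h.self_of_nhds ⟨hx, JoinedIn.refl hx⟩
  have hyA : y ∈ A := IsClopen.eq_univ ⟨hA_closed, hA_open⟩ ⟨x, hxA⟩ ▸ Set.mem_univ y
  exact hyA.self_of_nhds hy

end JoinedIn

section FiniteOrder

open Topology Function

variable {E : Type*} [NormedAddCommGroup E] [NormedSpace ℝ E]
  {H : Type*} [TopologicalSpace H] {I : ModelWithCorners ℝ E H}
  {N : Type*} [TopologicalSpace N] [ChartedSpace H N] {f : N → N} {q : N}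

theorem hasMFDerivAt_id_iterate (hq : f q = q)
    (hD : HasMFDerivAt I I f q (ContinuousLinearMap.id ℝ E :)) (j : ℕ) :
    HasMFDerivAt I I f^[j] q (ContinuousLinearMap.id ℝ E :) := by
  induction j with
  | zero => exact hasMFDerivAt_id q
  | succ j ih =>
    have hDj : HasMFDerivAt I I f^[j] (f q) (ContinuousLinearMap.id ℝ E :) := by rwa [hq]
    exact hDj.comp q hD

theorem sum_iterate_comp_self {M : Type*} [AddCommMonoid M] [IsLeftCancelAdd M] {X : Type*}
    {f : X → X} {m : ℕ} (hm : f^[m] = id) (φ : X → M) (x : X) :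
    ∑ j ∈ Finset.range m, φ (f^[j] (f x)) = ∑ j ∈ Finset.range m, φ (f^[j] x) := by
  have hsplit := (Finset.sum_range_succ' (fun j => φ (f^[j] x)) m).symm.trans
    (Finset.sum_range_succ (fun j => φ (f^[j] x)) m)
  rw [hm, iterate_zero, add_comm, add_comm _ (φ (id x))] at hsplit
  exact add_left_cancel hsplit

variable [IsManifold I ∞ N] [I.Boundaryless]

theorem hasStrictFDerivAt_chart_of_fixed (hf : ContMDiff I I ∞ f) (q : N) {z : E}
    (hz : z ∈ (extChartAt I q).target)
    (hfz : f ((extChartAt I q).symm z) = (extChartAt I q).symm z) {D : E →L[ℝ] E}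
    (hD : HasMFDerivAt I I f ((extChartAt I q).symm z) D) :
    HasStrictFDerivAt (fun w => extChartAt I q (f ((extChartAt I q).symm w)))
      (dchart I q ((extChartAt I q).symm z) ∘L D ∘L dchartSymm I q z) z := by
  have hsrc : f ((extChartAt I q).symm z) ∈ (extChartAt I q).source := by
    rw [hfz]
    exact (extChartAt I q).map_target hz
  have hfderiv := hasFDerivAt_chart_conj q hz hD hsrc
  rw [hfz] at hfderiv
  exact (contDiffAt_chart_conj q hz (hf _) hsrc).hasStrictFDerivAt' hfderiv (by simp)

theorem hasStrictFDerivAt_chart_self_of_fixed (hf : ContMDiff I I ∞ f) (hq : f q = q)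
    {D : E →L[ℝ] E} (hD : HasMFDerivAt I I f q D) :
    HasStrictFDerivAt (fun w => extChartAt I q (f ((extChartAt I q).symm w)))
      (dchart I q q ∘L D ∘L dchartSymm I q (extChartAt I q q)) (extChartAt I q q) := by
  have hzq : (extChartAt I q).symm (extChartAt I q q) = q := extChartAt_to_inv q
  have hderiv := hasStrictFDerivAt_chart_of_fixed hf q (mem_extChartAt_target q) (D := D)
    (by rwa [hzq]) (by rwa [hzq])
  rwa [hzq] at hderiv

theorem dchart_comp_dchartSymm_self (q : N) :
    dchart I q q ∘L dchartSymm I q (extChartAt I q q) = ContinuousLinearMap.id ℝ E := by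
  ext v
  have hinv := dchart_dchartSymm (I := I) q (mem_extChartAt_target q) v
  rwa [extChartAt_to_inv] at hinv

/- In a chart, the sum of the iterates of `f` is invariant under `f`, and it is injective near `q`
because its derivative there is multiplication by the order of `f`. -/
theorem eventually_eq_self_of_hasMFDerivAt_id [FiniteDimensional ℝ E] (hf : ContMDiff I I ∞ f)
    {m : ℕ} (hm : 0 < m) (hfm : f^[m] = id) (hq : f q = q)
    (hD : HasMFDerivAt I I f q (ContinuousLinearMap.id ℝ E :)) : ∀ᶠ r in 𝓝 q, f r = r := by
  have : CompleteSpace E := FiniteDimensional.complete ℝ E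
  let ψ := extChartAt I q
  let S : E → E := fun w => ∑ j ∈ Finset.range m, ψ (f^[j] (ψ.symm w))
  have hS : HasStrictFDerivAt S (∑ _j ∈ Finset.range m, ContinuousLinearMap.id ℝ E) (ψ q) := by
    refine HasStrictFDerivAt.fun_sum fun j _ => ?_
    refine (hasStrictFDerivAt_chart_self_of_fixed (hf.iterate j) (iterate_fixed hq j)
      (hasMFDerivAt_id_iterate hq hD j)).congr_fderiv ?_
    exact dchart_comp_dchartSymm_self q
  have hm_ne : (m : ℝ) ≠ 0 := Nat.cast_ne_zero.2 hm.ne'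
  have hS_equiv : HasStrictFDerivAt S
      ((ContinuousLinearEquiv.smulLeft (Units.mk0 (m : ℝ) hm_ne) : E ≃L[ℝ] E) : E →L[ℝ] E)
      (ψ q) := by
    refine hS.congr_fderiv (ContinuousLinearMap.ext fun v => ?_)
    rw [Finset.sum_const, Finset.card_range]
    exact (Nat.cast_smul_eq_nsmul ℝ m v).symm
  have hinj : ∀ᶠ w in 𝓝 (ψ q), w ∈ (hS_equiv.toOpenPartialHomeomorph S).source :=
    (hS_equiv.toOpenPartialHomeomorph S).open_source.mem_nhds
      hS_equiv.mem_toOpenPartialHomeomorph_source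
  have hnear : ∀ᶠ r in 𝓝 q, r ∈ ψ.source ∧ ψ r ∈ (hS_equiv.toOpenPartialHomeomorph S).source :=
    Filter.Eventually.and (extChartAt_source_mem_nhds q)
      ((continuousAt_extChartAt q).eventually hinj)
  have hf_tendsto : Filter.Tendsto f (𝓝 q) (𝓝 q) := by
    have := hf.continuous.tendsto q
    rwa [hq] at this
  filter_upwards [hnear, hf_tendsto.eventually hnear] with r hr hfr
  refine ψ.injOn hfr.1 hr.1 ((hS_equiv.toOpenPartialHomeomorph S).injOn hfr.2 hr.2 ?_)
  change S (ψ (f r)) = S (ψ r)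
  simp only [S, ψ.left_inv hr.1, ψ.left_inv hfr.1]
  exact sum_iterate_comp_self hfm ψ r

theorem eq_self_of_frequently_eventually [T2Space N] (hf : Continuous f)
    (hfreq : ∃ᶠ r in 𝓝 q, ∀ᶠ r' in 𝓝 r, f r' = r') : f q = q :=
  (isClosed_eq hf continuous_id).mem_of_frequently_of_tendsto
    (hfreq.mono fun _ hr => hr.self_of_nhds) Filter.tendsto_id

theorem fderiv_chart_of_eventually_eq_self (q : N) {r : N} (hr : r ∈ (extChartAt I q).source)
    (hfr : ∀ᶠ r' in 𝓝 r, f r' = r') :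
    fderiv ℝ (fun w => extChartAt I q (f ((extChartAt I q).symm w))) (extChartAt I q r)
      = ContinuousLinearMap.id ℝ E := by
  have hr_target := (extChartAt I q).map_source hr
  have hsymm : Filter.Tendsto (extChartAt I q).symm (𝓝 (extChartAt I q r)) (𝓝 r) := by
    have := (contMDiffAt_chart_symm (I := I) q hr_target).continuousAt.tendsto
    rwa [(extChartAt I q).left_inv hr] at this
  have hid : (fun w => extChartAt I q (f ((extChartAt I q).symm w)))
      =ᶠ[𝓝 (extChartAt I q r)] id := by
    filter_upwards [hsymm.eventually hfr, (isOpen_extChartAt_target q).mem_nhds hr_target]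
      with w hw hw_target
    rw [hw, (extChartAt I q).right_inv hw_target, id]
  rw [hid.fderiv_eq, fderiv_id]

theorem hasMFDerivAt_id_of_frequently_eventually [T2Space N] (hf : ContMDiff I I ∞ f)
    (hfreq : ∃ᶠ r in 𝓝 q, ∀ᶠ r' in 𝓝 r, f r' = r') :
    HasMFDerivAt I I f q (ContinuousLinearMap.id ℝ E :) := by
  have hq : f q = q := eq_self_of_frequently_eventually hf.continuous hfreq
  let ψ := extChartAt I q
  let G : E → E := fun w => ψ (f (ψ.symm w))
  let D : E →L[ℝ] E := mfderiv I I f q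
  have hD : HasMFDerivAt I I f q D := (hf.mdifferentiable (by simp) q).hasMFDerivAt
  have hG : ContDiffAt ℝ ∞ G (ψ q) := by
    refine contDiffAt_chart_conj q (mem_extChartAt_target q) (hf _) ?_
    rw [extChartAt_to_inv, hq]
    exact mem_extChartAt_source q
  have hfderiv_id : fderiv ℝ G (ψ q) = ContinuousLinearMap.id ℝ E := by
    refine isClosed_singleton.mem_of_frequently_of_tendsto (s := {ContinuousLinearMap.id ℝ E})
      (f := fun r => fderiv ℝ G (ψ r)) (b := 𝓝 q) ?_
      ((hG.continuousAt_fderiv (by simp)).tendsto.comp (continuousAt_extChartAt q))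
    exact (hfreq.and_eventually (extChartAt_source_mem_nhds (I := I) q)).mono fun r hr =>
      fderiv_chart_of_eventually_eq_self q hr.2 hr.1
  have hconj : dchart I q q ∘L D ∘L dchartSymm I q (ψ q) = ContinuousLinearMap.id ℝ E :=
    (hasStrictFDerivAt_chart_self_of_fixed hf hq hD).hasFDerivAt.fderiv.symm.trans hfderiv_id
  have hinv : ∀ v : E, dchartSymm I q (ψ q) (dchart I q q v) = v :=
    dchartSymm_dchart' q (mem_extChartAt_source q)
  refine hD.congr_mfderiv (ContinuousLinearMap.ext fun v : E => ?_)
  have happly := DFunLike.congr_fun hconj (dchart I q q v)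
  simp only [ContinuousLinearMap.comp_apply, hinv, ContinuousLinearMap.id_apply] at happly
  exact (hinv (D v)).symm.trans ((congrArg (dchartSymm I q (ψ q)) happly).trans (hinv v))

theorem eq_id_of_hasMFDerivAt_id [FiniteDimensional ℝ E] [T2Space N] [PreconnectedSpace N]
    (hf : ContMDiff I I ∞ f) {m : ℕ} (hm : 0 < m) (hfm : f^[m] = id) (hq : f q = q)
    (hD : HasMFDerivAt I I f q (ContinuousLinearMap.id ℝ E :)) : f = id := by
  have hclopen : IsClopen {r : N | ∀ᶠ r' in 𝓝 r, f r' = r'} :=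
    ⟨isClosed_iff_frequently.2 fun r hr =>
      eventually_eq_self_of_hasMFDerivAt_id hf hm hfm
        (eq_self_of_frequently_eventually hf.continuous hr)
        (hasMFDerivAt_id_of_frequently_eventually hf hr),
      isOpen_setOfPred_eventually_nhds⟩
  have huniv := hclopen.eq_univ ⟨q, eventually_eq_self_of_hasMFDerivAt_id hf hm hfm hq hD⟩
  funext r
  exact (Set.eq_univ_iff_forall.1 huniv r).self_of_nhds

end FiniteOrder

section ThinComplement

open Topology

variable {E : Type*} [NormedAddCommGroup E] [NormedSpace ℝ E] [FiniteDimensional ℝ E]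
  {H : Type*} [TopologicalSpace H] {I : ModelWithCorners ℝ E H} [I.Boundaryless]
  {N : Type*} [TopologicalSpace N] [ChartedSpace H N]
  {ι : Type*} [Countable ι] {T : ι → Set N}

theorem exists_mem_nhds_joinedIn_of_isThin_chart
    (hT : ∀ i q, IsThin ((extChartAt I q).target ∩ (extChartAt I q).symm ⁻¹' T i)) (q : N) :
    ∃ U ∈ 𝓝 q, ∀ x ∈ U ∩ (⋃ i, T i)ᶜ, ∀ y ∈ U ∩ (⋃ i, T i)ᶜ, JoinedIn (⋃ i, T i)ᶜ x y := by
  let ψ := extChartAt I q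
  obtain ⟨ε, hε, hball⟩ := Metric.isOpen_iff.1 (isOpen_extChartAt_target (I := I) q) _
    (mem_extChartAt_target q)
  let B := Metric.ball (ψ q) ε
  let S := ⋃ i, ψ.target ∩ ψ.symm ⁻¹' T i
  have hS : ∀ w ∈ B \ S, ψ.symm w ∈ (⋃ i, T i)ᶜ := fun w hw hmem => by
    obtain ⟨i, hi⟩ := Set.mem_iUnion.1 hmem
    exact hw.2 (Set.mem_iUnion.2 ⟨i, hball hw.1, hi⟩)
  have hchart : ∀ z ∈ (ψ.source ∩ ψ ⁻¹' B) ∩ (⋃ i, T i)ᶜ, ψ z ∈ B \ S := fun z hz =>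
    ⟨hz.1.2, fun hmem => by
      obtain ⟨i, -, hi⟩ := Set.mem_iUnion.1 hmem
      rw [Set.mem_preimage, ψ.left_inv hz.1.1] at hi
      exact hz.2 (Set.mem_iUnion.2 ⟨i, hi⟩)⟩
  refine ⟨ψ.source ∩ ψ ⁻¹' B, Filter.inter_mem (extChartAt_source_mem_nhds q)
    ((continuousAt_extChartAt q).preimage_mem_nhds (Metric.ball_mem_nhds _ hε)),
    fun x hx y hy => ?_⟩
  have hjoined : JoinedIn (B \ S) (ψ x) (ψ y) :=
    joinedIn_diff_iUnion_of_isThin (fun i => hT i q) (convex_ball _ ε) Metric.isOpen_ball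
      (hchart x hx) (hchart y hy)
  have himage := hjoined.map_continuousOn (f := ψ.symm)
    ((continuousOn_extChartAt_symm q).mono fun w hw => hball hw.1)
  rw [ψ.left_inv hx.1.1, ψ.left_inv hy.1.1] at himage
  exact himage.mono (Set.image_subset_iff.2 hS)

variable [IsManifold I ∞ N]

theorem dense_compl_iUnion_of_isThin_chart
    (hT : ∀ i q, IsThin ((extChartAt I q).target ∩ (extChartAt I q).symm ⁻¹' T i)) :
    Dense (⋃ i, T i)ᶜ := by
  intro q
  refine mem_closure_iff_nhds.2 fun V hV => ?_
  have hq := mem_extChartAt_target (I := I) q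
  have hsymm : ∀ᶠ w in 𝓝 (extChartAt I q q), (extChartAt I q).symm w ∈ V := by
    refine (contMDiffAt_chart_symm (I := I) q hq).continuousAt.eventually_mem ?_
    rwa [extChartAt_to_inv]
  obtain ⟨w, hwT, hwV, hw⟩ := (dense_compl_iUnion_of_isThin fun i => hT i q).inter_nhds_nonempty
    (hsymm.and ((isOpen_extChartAt_target q).mem_nhds hq))
  refine ⟨_, hwV, fun hmem => hwT ?_⟩
  obtain ⟨i, hi⟩ := Set.mem_iUnion.1 hmem
  exact Set.mem_iUnion.2 ⟨i, hw, hi⟩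

theorem isPreconnected_compl_iUnion_of_isThin_chart [PreconnectedSpace N]
    (hT : ∀ i q, IsThin ((extChartAt I q).target ∩ (extChartAt I q).symm ⁻¹' T i)) :
    IsPreconnected (⋃ i, T i)ᶜ :=
  isPreconnected_of_forall_pair fun _ hx _ hy =>
    have hxy := joinedIn_of_dense_of_locally_joinedIn (dense_compl_iUnion_of_isThin_chart hT)
      (exists_mem_nhds_joinedIn_of_isThin_chart hT) hx hy
    ⟨Set.range hxy.somePath, Set.range_subset_iff.2 hxy.somePath_mem,
      ⟨0, hxy.somePath.source⟩, ⟨1, hxy.somePath.target⟩,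
      isPreconnected_range hxy.somePath.continuous⟩

theorem isThin_chart_fixedPoints [T2Space N] [PreconnectedSpace N] {f : N → N}
    (hf : ContMDiff I I ∞ f) {m : ℕ} (hm : 0 < m) (hfm : f^[m] = id) (hne : f ≠ id)
    {J : (p : N) → TangentSpace I p →L[ℝ] TangentSpace I p} (hJ : ∀ p v, J p (J p v) = -v)
    (hfJ : ∀ p v, mfderiv I I f p (J p v) = J (f p) (mfderiv I I f p v)) (q : N) :
    IsThin ((extChartAt I q).target ∩ (extChartAt I q).symm ⁻¹' Function.fixedPoints f) := by
  let ψ := extChartAt I q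
  refine isThin_of_fixed (f := fun w => ψ (f (ψ.symm w))) ?_ ?_
  · rintro w ⟨hw, hfix⟩
    rw [hfix, ψ.right_inv hw]
  rintro w ⟨hw, hfix⟩
  let D : E →L[ℝ] E := mfderiv I I f (ψ.symm w)
  let J' : E →L[ℝ] E := J (ψ.symm w)
  have hD : HasMFDerivAt I I f (ψ.symm w) D := (hf.mdifferentiable (by simp) _).hasMFDerivAt
  have hJ' : ∀ v, J' (J' v) = -v := hJ (ψ.symm w)
  have hDJ : ∀ v, D (J' v) = J' (D v) := fun v =>
    (hfJ (ψ.symm w) v).trans (congrArg (fun r : N => (J r (D v : E) : E)) hfix)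
  refine ⟨dchart I q (ψ.symm w) ∘L D ∘L dchartSymm I q w,
    dchart I q (ψ.symm w) ∘L J' ∘L dchartSymm I q w,
    hasStrictFDerivAt_chart_of_fixed hf q hw hfix hD, fun v => ?_, fun v => ?_, fun hid => ?_⟩
  · simp only [ContinuousLinearMap.comp_apply]
    rw [dchartSymm_dchart q hw, hJ', map_neg, dchart_dchartSymm q hw]
  · simp only [ContinuousLinearMap.comp_apply]
    rw [dchartSymm_dchart q hw, dchartSymm_dchart q hw, hDJ]
  · refine hne (eq_id_of_hasMFDerivAt_id hf hm hfm hfix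
      (hD.congr_mfderiv (ContinuousLinearMap.ext fun v : E => ?_)))
    have happly := congrArg (dchartSymm I q w)
      (DFunLike.congr_fun hid (dchart I q (ψ.symm w) v))
    simp only [ContinuousLinearMap.comp_apply, ContinuousLinearMap.id_apply] at happly
    rwa [dchartSymm_dchart q hw, dchartSymm_dchart q hw] at happly

end ThinComplement

section FreeSet

variable {n : ℕ} {E : Type*} [NormedAddCommGroup E] [InnerProductSpace ℝ E]
  {H : Type*} [TopologicalSpace H] {I : ModelWithCorners ℝ E H}
  {N : Type*} [TopologicalSpace N] [T2Space N] [ChartedSpace H N] [AddAction (Torus n) N]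

theorem freeSet_eq_compl_iUnion_fixedPoints (hs : IsSmoothTorusAction n I N) :
    freeSet n N = (⋃ a : {a : Torus n | a ≠ 0 ∧ ∃ m : ℕ, 0 < m ∧ m • a = 0},
      Function.fixedPoints fun q : N => (a : Torus n) +ᵥ q)ᶜ := by
  ext q
  simp only [freeSet, Set.mem_ofPred_eq, Set.mem_compl_iff, Set.mem_iUnion, not_exists]
  refine ⟨fun hq a ha => a.2.1 (hq a ha), fun hq c hc => ?_⟩
  by_contra hc0
  obtain ⟨a, haq, ha0, ham⟩ := exists_torsion_mem_of_isClosed (isClosed_stabilizer hs q) hc hc0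
  exact hq ⟨a, ha0, ham⟩ haq

variable [FiniteDimensional ℝ E] [I.Boundaryless] [IsManifold I ∞ N] [PreconnectedSpace N]
  [FaithfulVAdd (Torus n) N] {K : KahlerStructure I N}

theorem isPreconnected_freeSet (hs : IsSmoothTorusAction n I N) (hhol : IsHolomorphicAction K n) :
    IsPreconnected (freeSet n N) := by
  have : Countable {a : Torus n | a ≠ 0 ∧ ∃ m : ℕ, 0 < m ∧ m • a = 0} :=
    ((countable_torsion n).mono fun _ ha => ha.2).to_subtype
  rw [freeSet_eq_compl_iUnion_fixedPoints hs]
  refine isPreconnected_compl_iUnion_of_isThin_chart (I := I) ?_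
  rintro ⟨a, ha0, m, hm, hma⟩ q
  have hiterate : (fun q : N => a +ᵥ q)^[m] = id := by
    rw [vadd_iterate, hma]
    exact funext (zero_vadd _)
  have hne : (fun q : N => a +ᵥ q) ≠ id := fun hid =>
    ha0 (FaithfulVAdd.eq_of_vadd_eq_vadd fun q : N => (congrFun hid q).trans (zero_vadd _ q).symm)
  exact isThin_chart_fixedPoints (contMDiff_vadd hs a) hm hiterate hne K.J_sq (hhol a) q

theorem IsImaginaryFlow.range_complexFlow {μ : N → Vec n} {φ : Vec n → ℝ → N → N}
    (hφ : IsImaginaryFlow K φ) (hs : IsSmoothTorusAction n I N) (hhol : IsHolomorphicAction K n)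
    (hμ : IsMomentumMap K μ) (hE : Module.finrank ℝ E = 2 * n) {p : N} (hp : p ∈ freeSet n N) :
    Set.range (fun c => complexFlow φ c p) = freeSet n N := by
  have hΨ := hφ.isCommutingFlow_complexFlow hs hhol hμ hE
  let orbit : N → Set N := fun q => Set.range fun c => complexFlow φ c q
  have horbit_open : ∀ q ∈ freeSet n N, IsOpen (orbit q) := fun q hq => hΨ.isOpen_range hq
  have mem_orbit_self : ∀ q, q ∈ orbit q := fun q => ⟨0, hΨ.zero q⟩
  have horbit_subset : orbit p ⊆ freeSet n N := Set.range_subset_iff.2 fun c => hΨ.invariant c p hp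
  refine horbit_subset.antisymm ((isPreconnected_freeSet hs hhol).subset_left_of_subset_union
    (v := ⋃ q ∈ freeSet n N \ orbit p, orbit q) (horbit_open p hp)
    (isOpen_biUnion fun q hq => horbit_open q hq.1) ?_ (fun q hq => ?_) ⟨p, hp, mem_orbit_self p⟩)
  · rw [Set.disjoint_left]
    rintro _ ⟨c, rfl⟩ hmem
    obtain ⟨q, ⟨hq, hqp⟩, d, hd : complexFlow φ d q = complexFlow φ c p⟩ := Set.mem_iUnion₂.1 hmem
    refine hqp ⟨c + -d, ?_⟩
    change complexFlow φ (c + -d) p = q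
    rw [hΨ.apply_add hp, ← hd, ← hΨ.apply_add hq, add_neg_cancel, hΨ.zero]
  · by_cases hqp : q ∈ orbit p
    · exact Or.inl hqp
    · exact Or.inr (Set.mem_iUnion₂.2 ⟨q, ⟨hq, hqp⟩, mem_orbit_self q⟩)

end FreeSet

section Momentum

variable {n : ℕ} {E : Type*} [NormedAddCommGroup E] [NormedSpace ℝ E]
  {H : Type*} [TopologicalSpace H] {I : ModelWithCorners ℝ E H}
  {N : Type*} [TopologicalSpace N] [ChartedSpace H N] [IsManifold I ∞ N]
  [AddAction (Torus n) N] {K : KahlerStructure I N}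

theorem isIsometricAction_of_isSymplecticAction (hsymp : IsSymplecticAction K n)
    (hhol : IsHolomorphicAction K n) : IsIsometricAction K n := by
  intro a q v w
  have homega := hsymp a q v (K.J q w)
  rw [hhol] at homega
  rw [← K.hermitian, ← K.hermitian q]
  exact homega

theorem inner_fundamental_vadd (hs : IsSmoothTorusAction n I N) (hiso : IsIsometricAction K n)
    (a : Torus n) (q : N) (u v : Vec n) :
    K.g.inner (a +ᵥ q) (fundamental I (a +ᵥ q) u) (fundamental I (a +ᵥ q) v)
      = K.g.inner q (fundamental I q u) (fundamental I q v) := by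
  rw [← mfderiv_vadd_fundamental hs, ← mfderiv_vadd_fundamental hs]
  exact hiso a q _ _

variable {μ : N → Vec n}

variable (K μ) in
/-- The derivative of `μ` along the imaginary directions, `v ↦ dμ (-J v_N)`. -/
noncomputable def momentumDeriv (q : N) : Vec n →L[ℝ] Vec n :=
  (mfderiv I 𝓘(ℝ, Vec n) μ q : TangentSpace I q →L[ℝ] Vec n) ∘L
    complexFundamental K q ∘L ContinuousLinearMap.inl ℝ (Vec n) (Vec n)

namespace IsMomentumMap

theorem mfderiv_complexFundamental (hs : IsSmoothTorusAction n I N) (hμ : IsMomentumMap K μ)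
    (q : N) (c : Vec n × Vec n) :
    mfderiv I 𝓘(ℝ, Vec n) μ q (complexFundamental K q c) = momentumDeriv K μ q c.1 := by
  change _ = mfderiv I 𝓘(ℝ, Vec n) μ q (complexFundamental K q (c.1, 0))
  rw [complexFundamental_apply, complexFundamental_apply, map_add, map_add,
    hμ.mfderiv_fundamental hs, hμ.mfderiv_fundamental hs]

theorem inner_momentumDeriv (hμ : IsMomentumMap K μ) (q : N) (v w : Vec n) :
    inner ℝ (momentumDeriv K μ q v) w = -K.g.inner q (fundamental I q v) (fundamental I q w) := by
  change inner (E := Vec n) ℝ (mfderiv I 𝓘(ℝ, Vec n) μ q (complexFundamental K q (v, 0))) w = _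
  rw [hμ.inner_mfderiv, complexFundamental_apply, map_zero, add_zero, map_neg, K.hermitian,
    K.g.symm]

theorem momentumDeriv_vadd (hs : IsSmoothTorusAction n I N) (hμ : IsMomentumMap K μ)
    (hiso : IsIsometricAction K n) (a : Torus n) (q : N) :
    momentumDeriv K μ (a +ᵥ q) = momentumDeriv K μ q := by
  ext1 v
  refine ext_inner_right ℝ fun w => ?_
  rw [hμ.inner_momentumDeriv, hμ.inner_momentumDeriv, inner_fundamental_vadd hs hiso]

end IsMomentumMap

variable [FiniteDimensional ℝ E] [I.Boundaryless] [T2Space N]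

theorem inner_fundamental_pos (K : KahlerStructure I N) (hs : IsSmoothTorusAction n I N) {q : N}
    (hq : q ∈ freeSet n N) {u : Vec n} (hu : u ≠ 0) :
    0 < K.g.inner q (fundamental I q u) (fundamental I q u) :=
  K.g.pos q _ fun hzero =>
    hu ((injective_iff_map_eq_zero _).1 (fundamental_injective hs hq) u hzero)

namespace IsMomentumMap

theorem injective_momentumDeriv (hs : IsSmoothTorusAction n I N) (hμ : IsMomentumMap K μ) {q : N}
    (hq : q ∈ freeSet n N) : Function.Injective (momentumDeriv K μ q) := by
  refine (injective_iff_map_eq_zero _).2 fun v hv => ?_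
  by_contra hne
  have hinner := hμ.inner_momentumDeriv q v v
  rw [hv, inner_zero_left] at hinner
  linarith [inner_fundamental_pos K hs hq hne]

theorem surjective_mfderiv (hs : IsSmoothTorusAction n I N) (hμ : IsMomentumMap K μ) {q : N}
    (hq : q ∈ freeSet n N) : Function.Surjective (mfderiv I 𝓘(ℝ, Vec n) μ q) := fun z =>
  let ⟨v, hv⟩ := LinearMap.injective_iff_surjective (f := (momentumDeriv K μ q : Vec n →ₗ[ℝ] Vec n))
    |>.1 (hμ.injective_momentumDeriv hs hq) z
  ⟨complexFundamental K q (v, 0), hv⟩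

theorem orthogonal_ker_mfderiv_iff (hs : IsSmoothTorusAction n I N) (hμ : IsMomentumMap K μ)
    (hE : Module.finrank ℝ E = 2 * n) {q : N} (hq : q ∈ freeSet n N) (c : Vec n × Vec n) :
    (∀ w : TangentSpace I q, mfderiv I 𝓘(ℝ, Vec n) μ q w = 0 →
      K.g.inner q (complexFundamental K q c) w = 0) ↔ c.2 = 0 := by
  constructor
  · intro horth
    by_contra hne
    have hinner := horth (complexFundamental K q (0, c.2))
      ((hμ.mfderiv_complexFundamental hs q _).trans (map_zero _))
    simp only [hμ.inner_complexFundamental hs, map_zero, zero_add] at hinner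
    exact (inner_fundamental_pos K hs hq hne).ne' hinner
  · intro hc w hw
    obtain ⟨d, rfl⟩ := (complexFundamental_bijective hs hμ hE hq).2 w
    have hd : d.1 = 0 := (injective_iff_map_eq_zero _).1 (hμ.injective_momentumDeriv hs hq) _
      ((hμ.mfderiv_complexFundamental hs q d).symm.trans hw)
    simp only [hμ.inner_complexFundamental hs, hc, hd, map_zero, zero_apply, add_zero]

theorem isSubmersionMetric_iff (hs : IsSmoothTorusAction n I N) (hμ : IsMomentumMap K μ)
    (hE : Module.finrank ℝ E = 2 * n) {k : Vec n → Vec n →L[ℝ] Vec n →L[ℝ] ℝ}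
    (hk : IsRiemannianMetric (μ '' freeSet n N) k) :
    IsSubmersionMetric K μ k ↔ ∀ q ∈ freeSet n N, ∀ u v : Vec n,
      k (μ q) (momentumDeriv K μ q u) (momentumDeriv K μ q v)
        = K.g.inner q (fundamental I q u) (fundamental I q v) := by
  have hinner : ∀ (q : N) (u v : Vec n),
      K.g.inner q (complexFundamental K q (u, 0)) (complexFundamental K q (v, 0))
        = K.g.inner q (fundamental I q u) (fundamental I q v) := fun q u v => by
    simp only [hμ.inner_complexFundamental hs, map_zero, add_zero]
  constructor
  · intro hsub q hq u v
    have horth := fun u => (hμ.orthogonal_ker_mfderiv_iff hs hE hq (u, 0)).2 rfl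
    exact (hsub.isometric q hq _ _ fun w hw => ⟨horth u w hw, horth v w hw⟩).trans (hinner q u v)
  · intro hiso
    refine ⟨hk, fun q hq => hμ.surjective_mfderiv hs hq, fun q hq u v huv => ?_⟩
    obtain ⟨⟨u, r⟩, rfl⟩ := (complexFundamental_bijective hs hμ hE hq).2 u
    obtain ⟨⟨v, s⟩, rfl⟩ := (complexFundamental_bijective hs hμ hE hq).2 v
    obtain rfl : r = 0 :=
      (hμ.orthogonal_ker_mfderiv_iff hs hE hq _).1 fun w hw => (huv w hw).1
    obtain rfl : s = 0 :=
      (hμ.orthogonal_ker_mfderiv_iff hs hE hq _).1 fun w hw => (huv w hw).2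
    exact (hiso q hq u v).trans (hinner q u v).symm

end IsMomentumMap

end Momentum

section DualCoordinates

variable {n : ℕ} {E : Type*} [NormedAddCommGroup E] [NormedSpace ℝ E]
  {H : Type*} [TopologicalSpace H] {I : ModelWithCorners ℝ E H}
  {N : Type*} {μ : N → Vec n} {φ : Vec n → ℝ → N → N} {p : N}

/-- The coordinates `y` of the theorem: minus the momentum map along the imaginary orbit of `p`. -/
def dualCoord (μ : N → Vec n) (φ : Vec n → ℝ → N → N) (p : N) (x : Vec n) : Vec n := -μ (φ x 1 p)

variable [AddAction (Torus n) N]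

theorem complexFlow_mk_zero (φ : Vec n → ℝ → N → N) (x : Vec n) (q : N) :
    complexFlow φ (x, 0) q = φ x 1 q :=
  toTorus_zero_vadd _

variable [TopologicalSpace N] [ChartedSpace H N] [IsManifold I ∞ N] {K : KahlerStructure I N}
  {h : Vec n → Vec n →L[ℝ] Vec n →L[ℝ] ℝ}

theorem IsMomentumMap.apply_complexFlow (hμ : IsMomentumMap K μ) (c : Vec n × Vec n) :
    μ (complexFlow φ c p) = -dualCoord μ φ p c.1 :=
  (hμ.invariant _ _).trans (neg_neg _).symm

variable [FiniteDimensional ℝ E] [I.Boundaryless] [T2Space N]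

namespace IsImaginaryFlow

theorem hasFDerivAt_dualCoord (hφ : IsImaginaryFlow K φ) (hs : IsSmoothTorusAction n I N)
    (hhol : IsHolomorphicAction K n) (hμ : IsMomentumMap K μ) (hE : Module.finrank ℝ E = 2 * n)
    (hp : p ∈ freeSet n N) (x : Vec n) :
    HasFDerivAt (dualCoord μ φ p) (-momentumDeriv K μ (φ x 1 p)) x := by
  have hline : HasMFDerivAt 𝓘(ℝ, Vec n) 𝓘(ℝ, Vec n × Vec n) (fun x : Vec n => (x, (0 : Vec n))) x
      (ContinuousLinearMap.inl ℝ (Vec n) (Vec n) :) :=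
    (hasFDerivAt_prodMk_left x (0 : Vec n)).hasMFDerivAt
  have hflow := HasMFDerivAt.comp (f := fun x : Vec n => (x, (0 : Vec n))) x
    ((hφ.isCommutingFlow_complexFlow hs hhol hμ hE).hasMFDerivAt hp (x, 0)) hline
  have hcomp := ((hμ.hasMFDerivAt (complexFlow φ (x, 0) p)).comp x hflow).hasFDerivAt.neg
  have heq : -(μ ∘ (fun c => complexFlow φ c p) ∘ fun x : Vec n => (x, (0 : Vec n)))
      = dualCoord μ φ p :=
    funext fun x => congrArg (fun q => -μ q) (complexFlow_mk_zero φ x p)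
  rw [heq] at hcomp
  rw [← complexFlow_mk_zero φ x p]
  exact hcomp

theorem contDiff_dualCoord (hφ : IsImaginaryFlow K φ) (hs : IsSmoothTorusAction n I N)
    (hhol : IsHolomorphicAction K n) (hμ : IsMomentumMap K μ) (hE : Module.finrank ℝ E = 2 * n)
    (hp : p ∈ freeSet n N) : ContDiff ℝ ∞ (dualCoord μ φ p) := by
  have hline : ContMDiff 𝓘(ℝ, Vec n) 𝓘(ℝ, Vec n × Vec n) ∞ fun x : Vec n => (x, (0 : Vec n)) :=
    ContDiff.contMDiff (by fun_prop)
  have hcomp : ContMDiff 𝓘(ℝ, Vec n) 𝓘(ℝ, Vec n) ∞ fun x : Vec n => μ (complexFlow φ (x, 0) p) :=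
    hμ.smooth.comp (((hφ.isCommutingFlow_complexFlow hs hhol hμ hE).contMDiff hp).comp hline)
  simp only [complexFlow_mk_zero] at hcomp
  exact hcomp.contDiff.neg

theorem isHessian_dualCoord (hφ : IsImaginaryFlow K φ) (hs : IsSmoothTorusAction n I N)
    (hhol : IsHolomorphicAction K n) (hμ : IsMomentumMap K μ) (hE : Module.finrank ℝ E = 2 * n)
    (hp : p ∈ freeSet n N)
    (hh : ∀ x u v : Vec n, h x u v = K.g.inner (φ x 1 p) (fundamental I (φ x 1 p) u)
      (fundamental I (φ x 1 p) v)) :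
    IsHessian Set.univ h (dualCoord μ φ p) where
  isOpen := isOpen_univ
  smooth := (hφ.contDiff_dualCoord hs hhol hμ hE hp).contDiffOn
  eq x _ u v := by
    rw [(hφ.hasFDerivAt_dualCoord hs hhol hμ hE hp x).fderiv, neg_apply, inner_neg_left,
      hμ.inner_momentumDeriv, neg_neg, hh]
  symm x _ u v := by rw [hh, hh, K.g.symm]
  pos x _ u hu := by
    rw [hh]
    exact inner_fundamental_pos K hs (hφ.apply_mem_freeSet hs hhol x 1 hp) hu

theorem complexFlow_eq_iff (hφ : IsImaginaryFlow K φ) (hs : IsSmoothTorusAction n I N)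
    (hhol : IsHolomorphicAction K n) (hμ : IsMomentumMap K μ) (hp : p ∈ freeSet n N)
    (hinj : Function.Injective (dualCoord μ φ p)) (c d : Vec n × Vec n) :
    complexFlow φ c p = complexFlow φ d p ↔ c.1 = d.1 ∧ toTorus (d.2 - c.2) = 0 := by
  constructor
  · intro heq
    have hfst : c.1 = d.1 := hinj (neg_injective
      (by rw [← hμ.apply_complexFlow, ← hμ.apply_complexFlow, heq]))
    refine ⟨hfst, hφ.apply_mem_freeSet hs hhol d.1 1 hp _ ?_⟩
    rw [complexFlow, complexFlow, hfst] at heq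
    rw [sub_eq_neg_add, toTorus_add_vadd, ← heq, ← toTorus_add_vadd, neg_add_cancel,
      toTorus_zero_vadd]
  · rintro ⟨hfst, hsnd⟩
    rw [complexFlow, complexFlow, hfst, ← sub_add_cancel d.2 c.2, toTorus_add, hsnd, zero_add]

end IsImaginaryFlow

theorem sum_smul_single (t : Vec n) : ∑ i, t i • (EuclideanSpace.single i 1 : Vec n) = t := by
  simpa using (EuclideanSpace.basisFun (Fin n) ℝ).sum_repr t

theorem toTorus_sub_eq_zero_iff (r s : Vec n) :
    toTorus (s - r) = 0 ↔
      ∃ k : Fin n → ℤ, s = r + ∑ i, (k i : ℝ) • EuclideanSpace.single i 1 := by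
  rw [toTorus_eq_zero_iff]
  refine exists_congr fun k => ?_
  rw [← sub_eq_iff_eq_add']
  constructor
  · intro hcoord
    rw [← sum_smul_single (s - r)]
    simp only [hcoord]
  · intro hsum i
    rw [hsum]
    simp [Finset.sum_apply, Pi.single_apply]

end DualCoordinates

section Torification

variable {n : ℕ} {E : Type*} [NormedAddCommGroup E] [InnerProductSpace ℝ E]
  {H : Type*} [TopologicalSpace H] {I : ModelWithCorners ℝ E H}
  {N : Type*} [TopologicalSpace N] [ChartedSpace H N] [IsManifold I ∞ N]
  [AddAction (Torus n) N] {K : KahlerStructure I N} {μ : N → Vec n} {φ : Vec n → ℝ → N → N}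
  {p : N} {h : Vec n → Vec n →L[ℝ] Vec n →L[ℝ] ℝ}

theorem isParallelFrame_single (U : Set (Vec n)) :
    IsParallelFrame U flatConnection fun i _ => (EuclideanSpace.single i 1 : Vec n) where
  smooth _ := contDiffOn_const
  parallel i Y _ x _ := by simp [flatConnection]
  basis x _ := by
    have hbasis := (EuclideanSpace.basisFun (Fin n) ℝ).toBasis.linearIndependent
    rw [OrthonormalBasis.coe_toBasis] at hbasis
    exact funext (EuclideanSpace.basisFun_apply (Fin n) ℝ) ▸ hbasis

theorem complexFundamental_dombrowskiJ (K : KahlerStructure I N) (q : N) (c A : Vec n × Vec n) :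
    complexFundamental K q (dombrowskiJ flatConnection c A) = K.J q (complexFundamental K q A) := by
  simp [complexFundamental_apply, dombrowskiJ, connector, flatConnection, K.J_sq, add_comm]

theorem inner_fundamental_complexFlow (hs : IsSmoothTorusAction n I N)
    (hiso : IsIsometricAction K n)
    (hh : ∀ x u v : Vec n, h x u v = K.g.inner (φ x 1 p) (fundamental I (φ x 1 p) u)
      (fundamental I (φ x 1 p) v)) (c : Vec n × Vec n) (u v : Vec n) :
    K.g.inner (complexFlow φ c p) (fundamental I (complexFlow φ c p) u)
      (fundamental I (complexFlow φ c p) v) = h c.1 u v :=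
  (inner_fundamental_vadd hs hiso _ _ u v).trans (hh c.1 u v).symm

theorem inner_complexFundamental_complexFlow (hs : IsSmoothTorusAction n I N)
    (hiso : IsIsometricAction K n) (hμ : IsMomentumMap K μ)
    (hh : ∀ x u v : Vec n, h x u v = K.g.inner (φ x 1 p) (fundamental I (φ x 1 p) u)
      (fundamental I (φ x 1 p) v)) (c A B : Vec n × Vec n) :
    K.g.inner (complexFlow φ c p) (complexFundamental K (complexFlow φ c p) A)
        (complexFundamental K (complexFlow φ c p) B)
      = dombrowskiMetric h flatConnection c A B := by
  rw [hμ.inner_complexFundamental hs, inner_fundamental_complexFlow hs hiso hh,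
    inner_fundamental_complexFlow hs hiso hh]
  simp [dombrowskiMetric, connector, flatConnection]

variable [FiniteDimensional ℝ E] [I.Boundaryless] [T2Space N]

namespace IsImaginaryFlow

theorem mfderiv_complexFlow (hφ : IsImaginaryFlow K φ) (hs : IsSmoothTorusAction n I N)
    (hhol : IsHolomorphicAction K n) (hμ : IsMomentumMap K μ) (hE : Module.finrank ℝ E = 2 * n)
    (hp : p ∈ freeSet n N) (c A : Vec n × Vec n) :
    mfderiv 𝓘(ℝ, Vec n × Vec n) I (fun c => complexFlow φ c p) c A
      = complexFundamental K (complexFlow φ c p) A :=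
  DFunLike.congr_fun ((hφ.isCommutingFlow_complexFlow hs hhol hμ hE).hasMFDerivAt hp c).mfderiv A

theorem isTorification_flatConnection [PreconnectedSpace N] [FaithfulVAdd (Torus n) N]
    (hφ : IsImaginaryFlow K φ) (hs : IsSmoothTorusAction n I N) (hhol : IsHolomorphicAction K n)
    (hsymp : IsSymplecticAction K n) (hμ : IsMomentumMap K μ) (hE : Module.finrank ℝ E = 2 * n)
    (hp : p ∈ freeSet n N)
    (hh : ∀ x u v : Vec n, h x u v = K.g.inner (φ x 1 p) (fundamental I (φ x 1 p) u)
      (fundamental I (φ x 1 p) v)) :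
    IsTorification K Set.univ h flatConnection := by
  have hiso := isIsometricAction_of_isSymplecticAction hsymp hhol
  have hderiv := hφ.mfderiv_complexFlow hs hhol hμ hE hp
  have hinj := (hφ.isHessian_dualCoord hs hhol hμ hE hp hh).injOn convex_univ
  have hfiber : ∀ u v : {u : Vec n × Vec n // u.1 ∈ Set.univ},
      complexFlow φ u.1 p = complexFlow φ v.1 p
        ↔ latticeSetoid Set.univ (fun i _ => EuclideanSpace.single i 1) u v := fun u v =>
    (hφ.complexFlow_eq_iff hs hhol hμ hp (Set.injOn_univ.1 hinj) u.1 v.1).trans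
      (and_congr_right' (toTorus_sub_eq_zero_iff _ _))
  refine ⟨inferInstance, hhol, hiso, fun i _ => EuclideanSpace.single i 1,
    isParallelFrame_single _,
    Quotient.lift (fun u => complexFlow φ u.1 p) fun u v huv => (hfiber u v).2 huv,
    ?injective, ?range, fun t u v hfst hsnd => ?equivariant, fun c => complexFlow φ c p,
    fun _ => rfl, fun u => ?localDiffeo, fun u _ A => ?holomorphic, fun u _ A B => ?isometric⟩
  case injective =>
    rintro ⟨u⟩ ⟨v⟩ huv
    exact Quotient.sound ((hfiber u v).1 huv)
  case range =>
    rw [← hφ.range_complexFlow hs hhol hμ hE hp]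
    exact (Set.range_quot_lift _).trans
      ((Equiv.subtypeUnivEquiv fun _ => Set.mem_univ _).surjective.range_comp
        fun c => complexFlow φ c p)
  case equivariant =>
    rw [sum_smul_single] at hsnd
    change complexFlow φ v.1 p = toTorus t +ᵥ complexFlow φ u.1 p
    rw [complexFlow, complexFlow, hfst, hsnd, add_comm, toTorus_add_vadd]
  case localDiffeo =>
    exact (hφ.isCommutingFlow_complexFlow hs hhol hμ hE).isLocalDiffeomorphAt hp u.1
  case holomorphic =>
    rw [hderiv, hderiv, complexFundamental_dombrowskiJ]
  case isometric =>
    rw [hderiv, hderiv, inner_complexFundamental_complexFlow hs hiso hμ hh]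

end IsImaginaryFlow

end Torification

section Image

variable {n : ℕ} {E : Type*} [NormedAddCommGroup E] [InnerProductSpace ℝ E] [FiniteDimensional ℝ E]
  {H : Type*} [TopologicalSpace H] {I : ModelWithCorners ℝ E H} [I.Boundaryless]
  {N : Type*} [TopologicalSpace N] [T2Space N] [PreconnectedSpace N] [ChartedSpace H N]
  [IsManifold I ∞ N] [AddAction (Torus n) N] [FaithfulVAdd (Torus n) N] {K : KahlerStructure I N}
  {μ : N → Vec n} {φ : Vec n → ℝ → N → N} {p : N} {h k : Vec n → Vec n →L[ℝ] Vec n →L[ℝ] ℝ}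

namespace IsImaginaryFlow

theorem image_freeSet (hφ : IsImaginaryFlow K φ) (hs : IsSmoothTorusAction n I N)
    (hhol : IsHolomorphicAction K n) (hμ : IsMomentumMap K μ) (hE : Module.finrank ℝ E = 2 * n)
    (hp : p ∈ freeSet n N) : μ '' freeSet n N = (fun x => -dualCoord μ φ p x) '' Set.univ := by
  rw [← hφ.range_complexFlow hs hhol hμ hE hp, ← Set.range_comp, Set.image_univ]
  have hfactor : (μ ∘ fun c => complexFlow φ c p) = (fun x => -dualCoord μ φ p x) ∘ Prod.fst :=
    funext fun c => hμ.apply_complexFlow c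
  rw [hfactor, Prod.fst_surjective.range_comp]

theorem isSubmersionMetric_iff_pullsBackMetric (hφ : IsImaginaryFlow K φ)
    (hs : IsSmoothTorusAction n I N) (hhol : IsHolomorphicAction K n)
    (hsymp : IsSymplecticAction K n) (hμ : IsMomentumMap K μ) (hE : Module.finrank ℝ E = 2 * n)
    (hp : p ∈ freeSet n N)
    (hh : ∀ x u v : Vec n, h x u v = K.g.inner (φ x 1 p) (fundamental I (φ x 1 p) u)
      (fundamental I (φ x 1 p) v)) (hk : IsRiemannianMetric (μ '' freeSet n N) k) :
    IsSubmersionMetric K μ k ↔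
      PullsBackMetric Set.univ (fun x => -dualCoord μ φ p x) h k := by
  have hiso := isIsometricAction_of_isSymplecticAction hsymp hhol
  have hderiv : ∀ x, fderiv ℝ (fun x => -dualCoord μ φ p x) x = momentumDeriv K μ (φ x 1 p) :=
    fun x => (hφ.hasFDerivAt_dualCoord hs hhol hμ hE hp x).fun_neg.fderiv.trans (neg_neg _)
  have hmomentum : ∀ c, momentumDeriv K μ (complexFlow φ c p) = momentumDeriv K μ (φ c.1 1 p) :=
    fun c => hμ.momentumDeriv_vadd hs hiso _ _
  have horbit := inner_fundamental_complexFlow hs hiso hh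
  rw [hμ.isSubmersionMetric_iff hs hE hk, ← hφ.range_complexFlow hs hhol hμ hE hp,
    Set.forall_mem_range]
  constructor
  · intro hc x _ u v
    rw [hderiv, ← horbit (x, 0) u v, ← hc (x, 0) u v, hμ.apply_complexFlow, hmomentum]
  · intro hx c u v
    rw [horbit, hμ.apply_complexFlow, hmomentum, ← hderiv, hx c.1 trivial]

end IsImaginaryFlow

end Image

end KahlerToric

theorem theorem7p1 {n : ℕ} {N : Type*} [TopologicalSpace N] [T2Space N]
    [SecondCountableTopology N] [ConnectedSpace N]
    [ChartedSpace (EuclideanSpace ℝ (Fin (2 * n))) N] [IsManifold (𝓡 (2 * n)) ∞ N]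
    (K : KahlerStructure (𝓡 (2 * n)) N)
    [AddAction (Torus n) N] (hsmooth : IsSmoothTorusAction n (𝓡 (2 * n)) N)
    (heff : FaithfulVAdd (Torus n) N)
    (hham : IsHamiltonianAction K n)
    (hhol : IsHolomorphicAction K n)
    (φ : Vec n → ℝ → N → N)
    (hφ : ∀ ξ : Vec n, IsFlow (fun q : N => -(K.J q (fundamental (𝓡 (2 * n)) q ξ))) (φ ξ))
    (p : N) (hp : p ∈ freeSet n N)
    (h : Vec n → Vec n →L[ℝ] Vec n →L[ℝ] ℝ)
    (hh : ∀ x u v : Vec n, h x u v =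
      K.g.inner (φ x 1 p) (fundamental (𝓡 (2 * n)) (φ x 1 p) u)
        (fundamental (𝓡 (2 * n)) (φ x 1 p) v)) :
    ∃ Dstar : (Vec n → Vec n) → (Vec n → Vec n) → (Vec n → Vec n),
      -- (1)
      IsDuallyFlat Set.univ h flatConnection Dstar ∧
      -- (2)
      IsTorification K Set.univ h flatConnection ∧
      -- (3)
      ∀ μ : N → Vec n, IsMomentumMap K μ →
        (∃ k Dk, IsCanonicalStructure K μ k Dk) ∧
        (∀ k k', IsSubmersionMetric K μ k → IsSubmersionMetric K μ k' →
          ∀ z ∈ μ '' freeSet n N, k z = k' z) ∧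
        (CompactSpace N →
          ¬ ∃ C : Vec n, C ≠ 0 ∧ (fun z => z + C) '' (μ '' freeSet n N) = μ '' freeSet n N) ∧
        ∀ k Dk, IsCanonicalStructure K μ k Dk →
          (∃ y : Vec n → Vec n,
            IsDualCoordinatePair Set.univ h flatConnection Dstar id y ∧
            IsDuallyFlatIso Set.univ h flatConnection Dstar
              (μ '' freeSet n N) k Dk flatConnection (fun x => -y x)) ∧
          ((¬ ∃ C : Vec n, C ≠ 0 ∧
              (fun z => z + C) '' (μ '' freeSet n N) = μ '' freeSet n N) →
            ∀ y₁ y₂ : Vec n → Vec n,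
              IsDualCoordinatePair Set.univ h flatConnection Dstar id y₁ →
              IsDuallyFlatIso Set.univ h flatConnection Dstar
                (μ '' freeSet n N) k Dk flatConnection (fun x => -y₁ x) →
              IsDualCoordinatePair Set.univ h flatConnection Dstar id y₂ →
              IsDuallyFlatIso Set.univ h flatConnection Dstar
                (μ '' freeSet n N) k Dk flatConnection (fun x => -y₂ x) →
              y₁ = y₂) := by
  have hE : Module.finrank ℝ (EuclideanSpace ℝ (Fin (2 * n))) = 2 * n := finrank_euclideanSpace_fin
  replace hφ : IsImaginaryFlow K φ := hφ
  obtain ⟨hsymp, μ₀, hμ₀⟩ := hham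
  have H₀ := hφ.isHessian_dualCoord hsmooth hhol hμ₀ hE hp hh
  refine ⟨pullbackFlat (dualCoord μ₀ φ p), H₀.isDuallyFlat,
    hφ.isTorification_flatConnection hsmooth hhol hsymp hμ₀ hE hp hh, fun μ hμ => ?_⟩
  have H := hφ.isHessian_dualCoord hsmooth hhol hμ hE hp hh
  obtain ⟨g, hyg⟩ := H.exists_areInverseDiffeos_neg convex_univ
  rw [← hφ.image_freeSet hsmooth hhol hμ hE hp] at hyg
  rw [pullbackFlat_congr (funext fun x => H₀.eqOn_fderiv H (Set.mem_univ x))]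
  have hsubmersion {k} (hk : IsRiemannianMetric (μ '' freeSet n N) k) :=
    hφ.isSubmersionMetric_iff_pullsBackMetric hsmooth hhol hsymp hμ hE hp hh hk
  have hpull {k} (hk : IsSubmersionMetric K μ k) := (hsubmersion hk.metric).1 hk
  refine ⟨?_, fun k k' hk hk' => ?_, fun _ => ?_, fun k Dk hk =>
    ⟨⟨dualCoord μ φ p, H.isDualCoordinatePair convex_univ,
      H.isDuallyFlatIso hyg (hpull hk.submersion) hk.dualistic⟩,
    fun hC y₁ y₂ hy₁ hiso₁ hy₂ hiso₂ => funext fun x => ?_⟩⟩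
  · obtain ⟨k, Dk, hk, hDk⟩ := H.exists_isDualistic hyg
    exact ⟨k, Dk, (hsubmersion hDk.metric).2 hk, hDk⟩
  · exact (hyg.pullsBackMetric_symm (hpull hk)).eqOn (hyg.pullsBackMetric_symm (hpull hk'))
  · exact not_exists_image_add_eq_of_isBounded ((isCompact_range hμ.smooth.continuous).isBounded
      |>.subset (Set.image_subset_range μ _)) ⟨μ p, p, hp, rfl⟩
  · exact hy₁.eqOn_of_image_neg_eq hy₂ isOpen_univ isPreconnected_univ H.isRiemannianMetric
      hiso₁.diffeo.image_eq hiso₂.diffeo.image_eq hC (Set.mem_univ x)
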